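/- **Setting.** Let $\Omega$ be a smooth Riemannian manifold of dimension $n$, without boundary (the interior of the physical domain; Hausdorff, second countable, not necessarily compact or orientable). Straight forms are ordinary differential forms; twisted forms are differential forms that change sign when the orientation is reversed. For a $k$-form $\eta$ and an $(n-k)$-form $\xi$ of opposite parities (one straight, one twisted) put $\langle\eta,\xi\rangle=\int_\Omega\eta\wedge\xi$. Let $H\Lambda^k$ be the space of square integrable $k$-forms with square integrable weak exterior derivative, and $\mathring H\Lambda^k$ the closure in $H\Lambda^k$ of the smooth compactly supported forms (homogeneous boundary conditions; the condition is void, i.e. periodic boundary conditions, if $\Omega$ is a closed manifold such as a torus). Let $V$ be a linear space of $k$-forms with $C_c^\infty\Lambda^k\subseteq V\subseteq H\Lambda^k$, with a seminorm dominating the norm of $H\Lambda^k$ (for example $V=H^1\Lambda^k$). The *twisted functional derivative* of $K:V\to\mathbb R$ at $\omega\in V$ is the square integrable $(n-k)$-form $\frac{\tilde\delta K}{\delta\omega}$, of parity opposite to that of $\omega$, with $K[\omega+\eta]-K[\omega]=\big\langle\eta,\frac{\tilde\delta K}{\delta\omega}\big\rangle+o(\|\eta\|_V)$ for $\eta\in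 V$; for functionals $\hat K$ on $L^2\Lambda^{k+1}$ it is defined in the same way with the $L^2$ norm. **Proposition.** Let $0\le k\le n-1$, let $\hat K:L^2\Lambda^{k+1}\to\mathbb R$ and $K[\omega]=\hat K[\mathsf d\omega]$ for $\omega\in V$, where the forms $\omega$ may be straight or twisted. Let $\omega\in V$ be such that $\hat K$ has at $\mathsf d\omega$ a twisted functional derivative $\psi=\frac{\tilde\delta\hat K}{\delta\mathsf d\omega}\in H\Lambda^{n-k-1}$, and assume that $V\subseteq\mathring H\Lambda^k$ or $\psi\in\mathring H\Lambda^{n-k-1}$. Then the twisted functional derivative of $K$ at $\omega$ exists, is unique up to equality almost everywhere, and $$\frac{\tilde\delta K}{\delta\omega}=(-1)^{k+1}\,\mathsf d\,\frac{\tilde\delta\hat K}{\delta\mathsf d\omega};\qquad\text{in particular, if $n$ is odd,}\qquad\frac{\tilde\delta K}{\delta\omega}=(-1)^{n-k}\,\mathsf d\,\frac{\tilde\delta\hat K}{\delta\mathsf d\omega}.$$ If both functional derivatives are instead defined with the pairing in the opposite order, $DK[\omega]\eta=\int_\Omega\frac{\tilde\delta K}{\delta\omega}\wedge\eta$, then,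 under the same assumptions, $\frac{\tilde\delta K}{\delta\omega}=(-1)^{n-k}\,\mathsf d\,\frac{\tilde\delta\hat K}{\delta\mathsf d\omega}$ for every $n$. In either case $\frac{\tilde\delta K}{\delta\omega}$ is exact: it is $\mathsf d$ of an element of $H\Lambda^{n-k-1}$. **Casimir invariants.** Let $n=3$ and $c\in\mathbb R$. For functionals $F,G$ of a twisted $2$-form $\tilde{\boldsymbol d}^2$ and a straight $2$-form $\boldsymbol b^2$ (each ranging over a space $V$ as above, with Fréchet derivatives represented jointly as above by partial twisted functional derivatives in $L^2$) let $$\{F,G\}=4\pi c\left[\left\langle\frac{\tilde\delta F}{\delta\tilde{\boldsymbol d}^2},\mathsf d\frac{\tilde\delta G}{\delta\boldsymbol b^2}\right\rangle-\left\langle\frac{\tilde\delta G}{\delta\tilde{\boldsymbol d}^2},\mathsf d\frac{\tilde\delta F}{\delta\boldsymbol b^2}\right\rangle\right]$$ at every field where the four functional derivatives lie in $H\Lambda^1$ and either both derivatives with respect to $\tilde{\boldsymbol d}^2$ or both derivatives with respect to $\boldsymbol b^2$ lie in $\mathring H\Lambda^1$. Then for every functional $F$ of straight, respectively twisted, $3$-forms,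 the functional $\mathcal C=F[\mathsf d\boldsymbol b^2]$, respectively $\mathcal C=F[\mathsf d\tilde{\boldsymbol d}^2]$, is a Casimir invariant: $\{\mathcal C,G\}=0$ for every $G$, wherever the bracket is defined. Moreover, if $F$ has a twisted functional derivative $\psi\in H\Lambda^0$ at $\mathsf d\boldsymbol b^2$ (respectively $\mathsf d\tilde{\boldsymbol d}^2$) and the space of fields $\boldsymbol b^2$ (respectively $\tilde{\boldsymbol d}^2$) is contained in $\mathring H\Lambda^2$ or $\psi\in\mathring H\Lambda^0$, then $\mathcal C$ has the functional derivatives $\frac{\tilde\delta\mathcal C}{\delta\boldsymbol b^2}=-\mathsf d\psi$ and $\frac{\tilde\delta\mathcal C}{\delta\tilde{\boldsymbol d}^2}=0$ (respectively $0$ and $-\mathsf d\psi$). -/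

import Mathlib

open scoped Manifold ContDiff Bundle ENNReal Topology
open MeasureTheory Module Bundle

noncomputable section

namespace DoubleDeRham

/-! ### Pointwise algebra -/

/-- The wedge product of alternating forms: the sum over shuffles, without factorial factors
(so that `(α ∧ β) (u, v) = α u * β v - α v * β u` for two covectors). -/
def wedge {T : Type*} [AddCommGroup T] [Module ℝ T] [TopologicalSpace T] {k l : ℕ}
    (α : T [⋀^Fin k]→L[ℝ] ℝ) (β : T [⋀^Fin l]→L[ℝ] ℝ) : T [⋀^Fin (k + l)]→ₗ[ℝ] ℝ :=
  ((LinearMap.mul' ℝ ℝ).compAlternatingMap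
    (α.toAlternatingMap.domCoprod β.toAlternatingMap)).domDomCongr finSumFinEquiv

/-- The model space `ℝⁿ`. -/
abbrev Model (n : ℕ) : Type := EuclideanSpace ℝ (Fin n)

section Forms

variable (n : ℕ) (M : Type*) [TopologicalSpace M] [ChartedSpace (Model n) M]

/-- Differential `k`-forms of parity `s` on the `n`-manifold `M` (no regularity is imposed).
At a point, the value is an alternating form depending on an orientation of the tangent space,
multiplied by `s` when the orientation is reversed. Since there are exactly two orientations,
`s = 1` gives the usual (straight) forms, which do not depend on the orientation, and `s = -1`
gives the twisted forms. -/
def Form (s : ℤˣ) (k : ℕ) :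
    Submodule ℝ ((x : M) → Orientation ℝ (TangentSpace (𝓡 n) x) (Fin n) →
      TangentSpace (𝓡 n) x [⋀^Fin k]→L[ℝ] ℝ) where
  carrier := {w | ∀ x o, w x (-o) = ((s : ℤ) : ℝ) • w x o}
  add_mem' := by
    intro a b ha hb x o
    simp only [Pi.add_apply, ha x o, hb x o, smul_add]
  zero_mem' := by
    intro x o
    simp
  smul_mem' := by
    intro c a ha x o
    simp only [Pi.smul_apply, ha x o]
    rw [smul_comm]

/-- Straight differential forms. -/
abbrev Straight (k : ℕ) := Form n M 1 k

/-- Twisted differential forms. -/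
abbrev Twisted (k : ℕ) := Form n M (-1) k

end Forms

section Charts

variable {n : ℕ} {M : Type*} [TopologicalSpace M] [ChartedSpace (Model n) M]
  [IsManifold (𝓡 n) ∞ M]

/-- The identification of the tangent space at `p` with `ℝⁿ` given by the differential at `p` of
the chart `chartAt x₀` (a dummy value if `p` is not in the domain of that chart). -/
def coordEquiv (x₀ p : M) : TangentSpace (𝓡 n) p ≃L[ℝ] Model n :=
  open Classical in
  if h : p ∈ (chartAt (Model n) x₀).source then
    (trivializationAt (Model n) (TangentSpace (𝓡 n) : M → Type) x₀).continuousLinearEquivAt ℝ p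
      (by simpa using h)
  else ContinuousLinearEquiv.refl ℝ (Model n)

/-- The orientation of the tangent space at `p` for which the coordinate frame of the chart
`chartAt x₀` is positive. -/
def coordOrientation (x₀ p : M) : Orientation ℝ (TangentSpace (𝓡 n) p) (Fin n) :=
  Orientation.map (Fin n) (coordEquiv x₀ p).symm.toLinearEquiv
    (EuclideanSpace.basisFun (Fin n) ℝ).toBasis.orientation

/-- The coordinate expression of a form in the chart `chartAt x₀`, a function on `ℝⁿ` of which
only the values on the target of the chart matter. A twisted form is evaluated at the orientation
defined by the chart. -/
def inChart {s : ℤˣ} {k : ℕ} (w : Form n M s k) (x₀ : M) (y : Model n) :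
    Model n [⋀^Fin k]→L[ℝ] ℝ :=
  let p : M := (chartAt (Model n) x₀).symm y
  (w.1 p (coordOrientation x₀ p)).compContinuousLinearMap
    ((coordEquiv (n := n) x₀ p).symm : Model n →L[ℝ] TangentSpace (𝓡 n) p)

/-- `θ` is the exterior derivative of `w` in the sense of distributions: in each chart both are
locally integrable, and `∫ χ θ = - ∫ dχ ∧ w` for every test function `χ`.
The integrals are integrals of functions on `ℝⁿ` with values in alternating `(k+1)`-forms, and
`dχ ∧ w` is written with Mathlib's antisymmetrization, the one which defines `extDeriv`. -/
def IsExtDeriv {s : ℤˣ} {k : ℕ} (w : Form n M s k) (θ : Form n M s (k + 1)) : Prop :=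
  ∀ x₀ : M,
    LocallyIntegrableOn (inChart w x₀) (chartAt (Model n) x₀).target ∧
    LocallyIntegrableOn (inChart θ x₀) (chartAt (Model n) x₀).target ∧
    ∀ χ : Model n → ℝ, ContDiff ℝ ∞ χ → HasCompactSupport χ →
      tsupport χ ⊆ (chartAt (Model n) x₀).target →
      ∫ y, χ y • inChart θ x₀ y =
        - ∫ y, ContinuousAlternatingMap.alternatizeUncurryFin
            ((fderiv ℝ χ y).smulRight (inChart w x₀ y))

/-- The exterior derivative `d w`, in the sense of distributions (unique up to null sets; zero by
convention if `w` has no locally integrable exterior derivative). -/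
def extD {s : ℤˣ} {k : ℕ} (w : Form n M s k) : Form n M s (k + 1) :=
  open Classical in
  if h : ∃ θ : Form n M s (k + 1), IsExtDeriv w θ then h.choose else 0

/-- Smooth forms with compact support (in `M`, which has no boundary: `M` is the interior of the
physical domain). -/
def IsTestForm {s : ℤˣ} {k : ℕ} (η : Form n M s k) : Prop :=
  (∀ x₀ : M, ContDiffOn ℝ ∞ (inChart η x₀) (chartAt (Model n) x₀).target) ∧
  ∃ C : Set M, IsCompact C ∧ ∀ x ∉ C, η.1 x = 0

end Charts

section Metric

variable {n : ℕ} {M : Type*} [TopologicalSpace M] [ChartedSpace (Model n) M]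
  [IsManifold (𝓡 n) ∞ M] [RiemannianBundle (fun x : M => TangentSpace (𝓡 n) x)]

/-- The Gram matrix `g_ij` of the Riemannian metric in the chart `chartAt x₀`. -/
def gram (x₀ : M) (y : Model n) : Matrix (Fin n) (Fin n) ℝ :=
  let p : M := (chartAt (Model n) x₀).symm y
  Matrix.of fun i j => inner ℝ
    ((coordEquiv x₀ p).symm (EuclideanSpace.single i (1 : ℝ)))
    ((coordEquiv x₀ p).symm (EuclideanSpace.single j (1 : ℝ)))

variable (n M) in
/-- The Riemannian volume measure: the smallest measure which dominates, for each chart, the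
measure `√(det g) dy¹ ⋯ dyⁿ` carried by the domain of the chart (these measures agree on
overlaps). -/
def vol [MeasurableSpace M] : Measure M :=
  ⨆ x₀ : M, Measure.map (chartAt (Model n) x₀).symm
    ((volume.restrict (chartAt (Model n) x₀).target).withDensity
      fun y => ENNReal.ofReal (Real.sqrt (gram x₀ y).det))

/-- An orthonormal basis of the tangent space at `x`. -/
def frame (x : M) : OrthonormalBasis (Fin n) ℝ (TangentSpace (𝓡 n) x) :=
  have : FiniteDimensional ℝ (TangentSpace (𝓡 n) x) :=
    inferInstanceAs (FiniteDimensional ℝ (Model n))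
  (stdOrthonormalBasis ℝ (TangentSpace (𝓡 n) x)).reindex
    (finCongr (show finrank ℝ (Model n) = n by simp))

/-- The norm of the value of a form at a point (it does not depend on the orientation used). -/
def pointNorm {s : ℤˣ} {k : ℕ} (w : Form n M s k) (x : M) : ℝ :=
  ‖w.1 x (frame x).toBasis.orientation‖

variable [MeasurableSpace M]

/-- The `L²` norm of a form, possibly infinite. -/
def eL2 {s : ℤˣ} {k : ℕ} (w : Form n M s k) : ℝ≥0∞ :=
  (∫⁻ x, ENNReal.ofReal (pointNorm w x) ^ 2 ∂(vol n M)) ^ (1 / 2 : ℝ)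

/-- The `L²` norm of a square integrable form. -/
def l2Norm {s : ℤˣ} {k : ℕ} (w : Form n M s k) : ℝ := (eL2 w).toReal

/-- `L²Λᵏ`: measurable and square integrable forms. -/
def MemL2 {s : ℤˣ} {k : ℕ} (w : Form n M s k) : Prop :=
  (∀ x₀ : M, AEStronglyMeasurable (inChart w x₀)
    (volume.restrict (chartAt (Model n) x₀).target)) ∧ eL2 w < ⊤

/-- `HΛᵏ`: square integrable forms with a square integrable exterior derivative. -/
def MemH {s : ℤˣ} {k : ℕ} (w : Form n M s k) : Prop :=
  MemL2 w ∧ (∃ θ : Form n M s (k + 1), IsExtDeriv w θ) ∧ MemL2 (extD w)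

/-- The norm of `HΛᵏ`. -/
def hNorm {s : ℤˣ} {k : ℕ} (w : Form n M s k) : ℝ :=
  Real.sqrt (l2Norm w ^ 2 + l2Norm (extD w) ^ 2)

/-- Homogeneous (or periodic) boundary conditions: the closure in `HΛᵏ` of the smooth forms with
compact support. If `M` is the interior of a domain with boundary these are the forms with
vanishing trace on the boundary; if `M` is a closed manifold, such as the torus of the periodic
boundary conditions, the condition is void. -/
def MemH0 {s : ℤˣ} {k : ℕ} (w : Form n M s k) : Prop :=
  MemH w ∧ ∃ η : ℕ → Form n M s k, (∀ j, IsTestForm (η j)) ∧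
    Filter.Tendsto (fun j => eL2 (η j - w)) Filter.atTop (𝓝 0) ∧
    Filter.Tendsto (fun j => eL2 (extD (η j) - extD w)) Filter.atTop (𝓝 0)

/-- Equality almost everywhere of forms. -/
def AEEq {s : ℤˣ} {k : ℕ} (w η : Form n M s k) : Prop := ∀ᵐ x ∂(vol n M), w.1 x = η.1 x

/-- A form is exact if it is the exterior derivative of a form in `HΛˡ`. -/
def IsExact {s : ℤˣ} {l : ℕ} (ξ : Form n M s (l + 1)) : Prop :=
  ∃ φ : Form n M s l, MemH φ ∧ AEEq ξ (extD φ)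

/-- The Poincaré duality pairing `⟨w, τ⟩ = ∫ w ∧ τ` of a `k`-form and an `(n-k)`-form of opposite
parities. The integrand is the twisted `n`-form `w ∧ τ` divided by the Riemannian volume form: its
value on an orthonormal basis, for the orientation defined by that basis. -/
def pairing {s t : ℤˣ} {k l : ℕ} (h : k + l = n) (w : Form n M s k) (τ : Form n M t l) : ℝ :=
  ∫ x, wedge (w.1 x (frame x).toBasis.orientation) (τ.1 x (frame x).toBasis.orientation)
    (fun i => frame x (Fin.cast h i)) ∂(vol n M)

/-- A normed space of `k`-forms on which functionals are defined: a linear space `V` with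
`C_c^∞Λᵏ ⊆ V ⊆ HΛᵏ` and a seminorm on it which dominates the norm of `HΛᵏ`
(for instance `H¹Λᵏ`, its subspace of forms with vanishing trace, or `HΛᵏ`). -/
structure FormSpace (n : ℕ) (M : Type*) [TopologicalSpace M] [ChartedSpace (Model n) M]
    [IsManifold (𝓡 n) ∞ M] [RiemannianBundle (fun x : M => TangentSpace (𝓡 n) x)]
    [MeasurableSpace M] (s : ℤˣ) (k : ℕ) where
  /-- the underlying linear space of forms -/
  carrier : Submodule ℝ (Form n M s k)
  /-- the seminorm (its values outside of the space do not matter) -/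
  norm : Form n M s k → ℝ
  norm_add_le : ∀ η ∈ carrier, ∀ ζ ∈ carrier, norm (η + ζ) ≤ norm η + norm ζ
  norm_smul : ∀ (a : ℝ), ∀ η ∈ carrier, norm (a • η) = |a| * norm η
  test_mem : ∀ η, IsTestForm η → η ∈ carrier
  memH : ∀ η ∈ carrier, MemH η
  bound : ∃ C : ℝ, 0 < C ∧ ∀ η ∈ carrier, hNorm η ≤ C * norm η

/-! ### Functional derivatives -/

/-- `ξ` represents, through the pairing `P`, the Fréchet derivative at `w` of the functional `K`,
for variations in `V` measured by `N`. -/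
def Represents {s t : ℤˣ} {k l : ℕ} (P : Form n M s k → Form n M t l → ℝ)
    (V : Form n M s k → Prop) (N : Form n M s k → ℝ) (K : Form n M s k → ℝ)
    (w : Form n M s k) (ξ : Form n M t l) : Prop :=
  MemL2 ξ ∧ ∀ ε > 0, ∃ δ > 0, ∀ η, V η → N η < δ → |K (w + η) - K w - P η ξ| ≤ ε * N η

/-- `ξ` is the twisted functional derivative of `K` at `w`: `DK[w] η = ⟨η, ξ⟩ = ∫ η ∧ ξ`. -/
def HasTwistedDeriv {s t : ℤˣ} {k l : ℕ} (h : k + l = n)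
    (V : Form n M s k → Prop) (N : Form n M s k → ℝ) (K : Form n M s k → ℝ)
    (w : Form n M s k) (ξ : Form n M t l) : Prop :=
  Represents (fun η ξ => pairing h η ξ) V N K w ξ

/-- `ξ` is the twisted functional derivative of `K` at `w` for the pairing written in the opposite
order: `DK[w] η = ⟨ξ, η⟩ = ∫ ξ ∧ η`. -/
def HasTwistedDerivLeft {s t : ℤˣ} {k l : ℕ} (h : l + k = n)
    (V : Form n M s k → Prop) (N : Form n M s k → ℝ) (K : Form n M s k → ℝ)
    (w : Form n M s k) (ξ : Form n M t l) : Prop :=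
  Represents (fun η ξ => pairing h ξ η) V N K w ξ

/-! ### The Poisson bracket of Maxwell's equations, in dimension three -/

/-- `(fd, fb)` is the pair of partial twisted functional derivatives at `(d, b)` of a functional
`F[d, b]` of a twisted `2`-form `d` and a straight `2`-form `b`:
`DF[d, b] (η, ζ) = ⟨η, fd⟩ + ⟨ζ, fb⟩`. -/
def HasFieldDerivs (hn : 2 + 1 = n) (Vd : FormSpace n M (-1) 2) (Vb : FormSpace n M 1 2)
    (F : Twisted n M 2 → Straight n M 2 → ℝ) (d : Twisted n M 2) (b : Straight n M 2)
    (fd : Straight n M 1) (fb : Twisted n M 1) : Prop :=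
  MemL2 fd ∧ MemL2 fb ∧
  ∀ ε > 0, ∃ δ > 0, ∀ η ∈ Vd.carrier, ∀ ζ ∈ Vb.carrier, Vd.norm η < δ → Vb.norm ζ < δ →
    |F (d + η) (b + ζ) - F d b - (pairing hn η fd + pairing hn ζ fb)|
      ≤ ε * (Vd.norm η + Vb.norm ζ)

/-- The Poisson bracket `{F, G} = 4πc (⟨δF/δd, d δG/δb⟩ - ⟨δG/δd, d δF/δb⟩)`, in terms of the
functional derivatives `(fd, fb)` of `F` and `(gd, gb)` of `G`. -/
def bracket (hn : 1 + (1 + 1) = n) (c : ℝ) (fd : Straight n M 1) (fb : Twisted n M 1)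
    (gd : Straight n M 1) (gb : Twisted n M 1) : ℝ :=
  4 * Real.pi * c * (pairing hn fd (extD gb) - pairing hn gd (extD fb))

/-- `C` is a Casimir invariant: its bracket with every functional `G` vanishes, at every field
`(d, b)` where the bracket makes sense, that is, where `C` and `G` have functional derivatives
which have exterior derivatives, and homogeneous (or periodic) boundary conditions hold for the
functional derivatives with respect to `d`, or for those with respect to `b`. -/
def IsCasimir (hn : n = 3) (c : ℝ) (Vd : FormSpace n M (-1) 2) (Vb : FormSpace n M 1 2)
    (C : Twisted n M 2 → Straight n M 2 → ℝ) : Prop :=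
  ∀ (G : Twisted n M 2 → Straight n M 2 → ℝ), ∀ d ∈ Vd.carrier, ∀ b ∈ Vb.carrier,
  ∀ (fd : Straight n M 1) (fb : Twisted n M 1) (gd : Straight n M 1) (gb : Twisted n M 1),
    HasFieldDerivs (by omega) Vd Vb C d b fd fb →
    HasFieldDerivs (by omega) Vd Vb G d b gd gb →
    MemH fd → MemH fb → MemH gd → MemH gb →
    ((MemH0 fd ∧ MemH0 gd) ∨ (MemH0 fb ∧ MemH0 gb)) →
    bracket (by omega) c fd fb gd gb = 0

end Metric

end DoubleDeRham

end

open DoubleDeRham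

/-! The heart of the matter is Stokes' theorem in `HΛ`: for forms of opposite parities, `⟨dw, τ⟩ =
(-1)^(k+1) ⟨w, dτ⟩` as soon as one of the two is a limit of test forms (`MemH.pairing_extD`). The
chain rule gives `DK[ω] η = ⟨dη, ψ⟩`, because the seminorm of `V` dominates the norm of `dη`, so
that a remainder `o(‖dη‖)` is also `o(‖η‖_V)` (`Represents.comp_extD`). Stokes then moves `d` onto
`ψ` and produces the representative `(-1)^(k+1) dψ`. With the pairing reversed, `ψ` stands in the
first slot and its degree `l` governs the sign `(-1)^(l+1) = (-1)^(n-k)`; for odd `n` the two signs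
agree.

Uniqueness: two representatives have equal pairings with all of `V`, since their difference is
homogeneous and `o(‖η‖)` on each line. As `V` contains the test forms, the fundamental lemma
`aeEq_zero_of_pairing_test` makes the representatives equal almost everywhere. Pointwise it rests on
the nondegeneracy of the wedge pairing.

Stokes itself starts on open sets of `ℝⁿ` from the distributional definition of `d`. The smooth
factor is expanded in constant forms, and `covecWedge_wedge` carries `dχ` across the wedge product
(`WeakD.integral_wedgeBilin`). Charts transport this to the manifold: coordinate expressions are
pulled back up to a locally constant orientation sign, and opposite parities make the integrand of
the pairing independent of orientation. A partition of unity gives the case of a test form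
(`IsExtDeriv.pairing_test`), and an `L²` limit gives the case of `MemH0`.

For the Casimir invariants no differentiability of `F` is needed. If `C = F[d b]` has derivatives
`(fd, fb)`, then `fd = 0`, because `C` does not depend on the other field. Moreover `fb` annihilates
all closed variations, in particular `dφ` for every test form `φ`, so `d fb = 0`. For `F[d d]` the
roles are exchanged, and the remaining term `⟨fd, d gb⟩` needs Stokes. Since `F` need not respect
equality almost everywhere, it matters that adding a closed form leaves the chosen representative
`extD` literally unchanged (`extD_add_of_isExtDeriv_zero`). -/

noncomputable section

set_option linter.unusedSectionVars false

namespace DoubleDeRham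

/-! ### Algebra of the wedge product -/

section Wedge

variable {T : Type*} [AddCommGroup T] [Module ℝ T] [TopologicalSpace T]

/-- The wedge product is, up to the factor `k! l!`, the antisymmetrization of the tensor
product. -/
theorem factorial_mul_wedge {k l N : ℕ} (h : k + l = N) (α : T [⋀^Fin k]→L[ℝ] ℝ)
    (β : T [⋀^Fin l]→L[ℝ] ℝ) (v : Fin N → T) :
    ((k.factorial * l.factorial : ℕ) : ℝ) * wedge α β (fun i => v (Fin.cast h i)) =
      ∑ σ : Equiv.Perm (Fin N), ((Equiv.Perm.sign σ : ℤ) : ℝ) *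
        (α (fun i => v (σ (Fin.cast h (Fin.castAdd l i)))) *
          β (fun j => v (σ (Fin.cast h (Fin.natAdd k j))))) := by
  subst h
  have H := congrArg (fun f => LinearMap.mul' ℝ ℝ (f (fun i => v (finSumFinEquiv i))))
    (MultilinearMap.domCoprod_alternization_eq α.toAlternatingMap β.toAlternatingMap)
  simp only [Fintype.card_fin, AlternatingMap.smul_apply] at H
  rw [map_nsmul, nsmul_eq_mul] at H
  have H2 : wedge α β (fun i => v (Fin.cast rfl i)) = LinearMap.mul' ℝ ℝ
      ((α.toAlternatingMap.domCoprod β.toAlternatingMap) fun i => v (finSumFinEquiv i)) := rfl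
  rw [H2, ← H, MultilinearMap.alternatization_apply, map_sum]
  refine Fintype.sum_equiv finSumFinEquiv.permCongr _ _ fun σ => ?_
  rw [Equiv.Perm.sign_permCongr, Units.smul_def, map_zsmul, zsmul_eq_mul,
    MultilinearMap.domDomCongr_apply, MultilinearMap.domCoprod_apply]
  simp [Equiv.permCongr_apply]

/-- After multiplication by `k! l!` the shuffle sum becomes a sum over all permutations, whose terms
are visibly additive in `α`. The other algebraic rules are obtained in the same way. -/
theorem wedge_add_left {k l : ℕ} (α α' : T [⋀^Fin k]→L[ℝ] ℝ) (β : T [⋀^Fin l]→L[ℝ] ℝ)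
    [ContinuousAdd T] (v : Fin (k + l) → T) :
    wedge (α + α') β v = wedge α β v + wedge α' β v := by
  have h0 : ((k.factorial * l.factorial : ℕ) : ℝ) ≠ 0 := by positivity
  have := fun a : T [⋀^Fin k]→L[ℝ] ℝ => factorial_mul_wedge rfl a β v
  simp only [Fin.cast_eq_self] at this
  apply mul_left_cancel₀ h0
  rw [mul_add, this, this, this, ← Finset.sum_add_distrib]
  refine Finset.sum_congr rfl fun σ _ => ?_
  simp; ring

theorem wedge_smul_left {k l : ℕ} (c : ℝ) (α : T [⋀^Fin k]→L[ℝ] ℝ) (β : T [⋀^Fin l]→L[ℝ] ℝ)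
    (v : Fin (k + l) → T) :
    wedge (c • α) β v = c * wedge α β v := by
  have h0 : ((k.factorial * l.factorial : ℕ) : ℝ) ≠ 0 := by positivity
  have := fun a : T [⋀^Fin k]→L[ℝ] ℝ => factorial_mul_wedge rfl a β v
  simp only [Fin.cast_eq_self] at this
  apply mul_left_cancel₀ h0
  rw [mul_left_comm, this, this, Finset.mul_sum]
  refine Finset.sum_congr rfl fun σ _ => ?_
  simp; ring

/-- The permutation which exchanges the blocks of sizes `l` and `k`. -/
theorem exists_blockSwap {k l N : ℕ} (h : k + l = N) (h' : l + k = N) :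
    ∃ ρ : Equiv.Perm (Fin N), (Equiv.Perm.sign ρ : ℤ) = (-1) ^ (k * l) ∧
      (∀ i : Fin k, ρ (Fin.cast h (Fin.castAdd l i)) = Fin.cast h' (Fin.natAdd l i)) ∧
      ∀ j : Fin l, ρ (Fin.cast h (Fin.natAdd k j)) = Fin.cast h' (Fin.castAdd k j) := by
  have key : ∀ (m : ℕ) (i : Fin N), (((finRotate N) ^ m) i).val = (i.val + m) % N := by
    intro m
    induction m with
    | zero => intro i; simp [Nat.mod_eq_of_lt i.isLt]
    | succ m ih =>
      intro i
      obtain ⟨M, rfl⟩ : ∃ M, N = M + 1 := ⟨N - 1, by have := i.isLt; omega⟩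
      rw [pow_succ', Equiv.Perm.mul_apply, finRotate_apply, Fin.val_add, ih]
      simp [Nat.add_assoc]
  -- The block exchange is the rotation by `l` places. Its sign is `(-1)^((N-1)l)`, and `(k+l-1)l =
  -- kl + l(l-1)` with `l(l-1)` even.
  refine ⟨(finRotate N) ^ l, ?_, fun i => ?_, fun j => ?_⟩
  · rw [map_pow, sign_finRotate]
    push_cast
    rw [← pow_mul]
    rcases Nat.eq_zero_or_pos l with rfl | hl
    · simp
    · have : Even (l * (l - 1)) := Nat.even_mul_pred_self l
      have e : (N - 1) * l = k * l + l * (l - 1) := by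
        obtain ⟨l', rfl⟩ : ∃ l', l = l' + 1 := ⟨l - 1, by omega⟩
        subst h
        simp only [Nat.add_sub_cancel, ← Nat.add_assoc]; ring
      rw [e, pow_add, this.neg_one_pow, mul_one]
  · ext
    rw [key]
    have := i.isLt
    simp only [Fin.val_cast, Fin.val_castAdd, Fin.val_natAdd]
    rw [Nat.mod_eq_of_lt (by omega), Nat.add_comm]
  · ext
    rw [key]
    have := j.isLt
    simp only [Fin.val_cast, Fin.val_castAdd, Fin.val_natAdd]
    rw [show k + j.val + l = j.val + N by omega, Nat.add_mod_right, Nat.mod_eq_of_lt (by omega)]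

/-- Graded commutativity of the wedge product. -/
theorem wedge_comm {k l N : ℕ} (h : k + l = N) (h' : l + k = N) (α : T [⋀^Fin k]→L[ℝ] ℝ)
    (β : T [⋀^Fin l]→L[ℝ] ℝ) (v : Fin N → T) :
    wedge α β (fun i => v (Fin.cast h i)) =
      (-1) ^ (k * l) * wedge β α (fun i => v (Fin.cast h' i)) := by
  have h0 : ((k.factorial * l.factorial : ℕ) : ℝ) ≠ 0 := by positivity
  obtain ⟨ρ, hs, h1, h2⟩ := exists_blockSwap h h'
  apply mul_left_cancel₀ h0
  rw [factorial_mul_wedge, mul_left_comm, Nat.mul_comm k.factorial,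
    factorial_mul_wedge, Finset.mul_sum]
  symm
  -- Reindexing by `σ ↦ σρ` exchanges the two blocks of arguments and costs the sign of `ρ`.
  refine Fintype.sum_equiv (Equiv.mulRight ρ) _ _ fun σ => ?_
  simp only [Equiv.coe_mulRight, Equiv.Perm.mul_apply, h1, h2, map_mul, Units.val_mul, hs]
  push_cast
  ring

/-- Graded commutativity reduces this to the first factor. -/
theorem wedge_add_right {k l : ℕ} (α : T [⋀^Fin k]→L[ℝ] ℝ) (β β' : T [⋀^Fin l]→L[ℝ] ℝ)
    [ContinuousAdd T] (v : Fin (k + l) → T) :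
    wedge α (β + β') v = wedge α β v + wedge α β' v := by
  have := fun b => wedge_comm rfl (Nat.add_comm l k) α b v
  simp only [Fin.cast_eq_self] at this
  rw [this, this, this, wedge_add_left, mul_add]

theorem wedge_smul_right {k l : ℕ} (c : ℝ) (α : T [⋀^Fin k]→L[ℝ] ℝ) (β : T [⋀^Fin l]→L[ℝ] ℝ)
    (v : Fin (k + l) → T) :
    wedge α (c • β) v = c * wedge α β v := by
  have := fun b => wedge_comm rfl (Nat.add_comm l k) α b v
  simp only [Fin.cast_eq_self] at this
  rw [this, this, wedge_smul_left, mul_left_comm]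

/-- Naturality of the wedge product. -/
theorem wedge_compContinuousLinearMap {T' : Type*} [AddCommGroup T'] [Module ℝ T']
    [TopologicalSpace T'] {k l : ℕ} (α : T [⋀^Fin k]→L[ℝ] ℝ) (β : T [⋀^Fin l]→L[ℝ] ℝ)
    (f : T' →L[ℝ] T) (v : Fin (k + l) → T') :
    wedge (α.compContinuousLinearMap f) (β.compContinuousLinearMap f) v =
      wedge α β (fun i => f (v i)) := by
  have h0 : ((k.factorial * l.factorial : ℕ) : ℝ) ≠ 0 := by positivity
  apply mul_left_cancel₀ h0
  have h1 := factorial_mul_wedge rfl (α.compContinuousLinearMap f) (β.compContinuousLinearMap f) v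
  have h2 := factorial_mul_wedge rfl α β (fun i => f (v i))
  simp only [Fin.cast_eq_self] at h1 h2
  rw [h1, h2]
  rfl

/-- An `n`-covector is determined by its value on a basis. -/
theorem wedge_basis_change {k l N : ℕ} (h : k + l = N) (α : T [⋀^Fin k]→L[ℝ] ℝ)
    (β : T [⋀^Fin l]→L[ℝ] ℝ) (b : Basis (Fin N) ℝ T) (v : Fin N → T) :
    wedge α β (fun i => v (Fin.cast h i)) = b.det v * wedge α β (fun i => b (Fin.cast h i)) := by
  subst h
  have := congrArg (fun f => f v) ((wedge α β).eq_smul_basis_det b)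
  simp only [AlternatingMap.smul_apply, smul_eq_mul] at this
  simp only [Fin.cast_eq_self]
  rw [this, mul_comm]

end Wedge

/-- The antisymmetrization of `g ⊗ α` for a covector `g`, in terms of the first slot. -/
theorem sum_sign_mul_removeNth {T : Type*} {N : ℕ} (g : T → ℝ) (H : (Fin N → T) → ℝ) (v : Fin (N + 1) → T)
    (j : Fin (N + 1)) :
    ∑ σ : Equiv.Perm (Fin (N + 1)), ((Equiv.Perm.sign σ : ℤ) : ℝ) *
        (g (v (σ j)) * H (j.removeNth (v ∘ σ))) =
      (-1) ^ (j : ℕ) * ∑ σ : Equiv.Perm (Fin (N + 1)), ((Equiv.Perm.sign σ : ℤ) : ℝ) *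
        (g (v (σ 0)) * H (Fin.removeNth 0 (v ∘ σ))) := by
  rw [Finset.mul_sum]
  -- The inverse of `j.cycleRange` brings slot `j` to the front and keeps the order of the other
  -- slots; its sign is `(-1)^j`.
  refine Fintype.sum_equiv (Equiv.mulRight j.cycleRange.symm) _ _ fun σ => ?_
  have e : v ∘ σ ∘ j.cycleRange.symm = Fin.cons (v (σ j)) (j.removeNth (v ∘ σ)) := by
    rw [← Function.comp_assoc, Equiv.comp_symm_eq, Fin.cons_comp_cycleRange]
    exact (Fin.insertNth_self_removeNth j (v ∘ σ)).symm
  have e0 : v ((σ * j.cycleRange.symm) 0) = v (σ j) := by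
    simp [Fin.cycleRange_symm_zero]
  have e1 : Fin.removeNth 0 (v ∘ ⇑(σ * j.cycleRange.symm)) = j.removeNth (v ∘ σ) := by
    rw [Equiv.Perm.coe_mul, e]
    rfl
  have es : ((Equiv.Perm.sign (σ * j.cycleRange.symm) : ℤ) : ℝ) =
      (-1) ^ (j : ℕ) * ((Equiv.Perm.sign σ : ℤ) : ℝ) := by
    rw [map_mul, Equiv.Perm.sign_symm, Fin.sign_cycleRange]
    push_cast
    ring
  simp only [Equiv.coe_mulRight, e0, e1, es]
  rw [mul_assoc, ← mul_assoc, ← mul_assoc, ← pow_add, Even.neg_one_pow ⟨_, rfl⟩, one_mul]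

/-! ### Bounds, covector factors and nondegeneracy of the wedge product -/

section Norm

variable {T : Type*} [NormedAddCommGroup T] [NormedSpace ℝ T]

/-- The wedge product is bounded. -/
theorem abs_wedge_le {k l N : ℕ} (h : k + l = N) (α : T [⋀^Fin k]→L[ℝ] ℝ)
    (β : T [⋀^Fin l]→L[ℝ] ℝ) (v : Fin N → T) (hv : ∀ i, ‖v i‖ ≤ 1) :
    |wedge α β (fun i => v (Fin.cast h i))| ≤ N.factorial * (‖α‖ * ‖β‖) := by
  have h0 : (1 : ℝ) ≤ ((k.factorial * l.factorial : ℕ) : ℝ) := by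
    exact_mod_cast Nat.mul_pos k.factorial_pos l.factorial_pos
  have bd : ∀ {m : ℕ} (γ : T [⋀^Fin m]→L[ℝ] ℝ) (u : Fin m → T), (∀ i, ‖u i‖ ≤ 1) →
      |γ u| ≤ ‖γ‖ := by
    intro m γ u hu
    refine (γ.le_opNorm u).trans ?_
    exact mul_le_of_le_one_right (norm_nonneg _)
      (Finset.prod_le_one (fun i _ => norm_nonneg _) fun i _ => hu i)
  -- The factor `k! l!` is at least `1`, so it may be inserted; each of the `N!` permutation terms
  -- is then at most `‖α‖ ‖β‖`.
  calc |wedge α β (fun i => v (Fin.cast h i))|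
      ≤ |((k.factorial * l.factorial : ℕ) : ℝ) * wedge α β (fun i => v (Fin.cast h i))| := by
        rw [abs_mul, abs_of_pos (lt_of_lt_of_le one_pos h0)]
        exact le_mul_of_one_le_left (abs_nonneg _) h0
    _ ≤ ∑ _σ : Equiv.Perm (Fin N), ‖α‖ * ‖β‖ := by
        rw [factorial_mul_wedge]
        refine (Finset.abs_sum_le_sum_abs _ _).trans (Finset.sum_le_sum fun σ _ => ?_)
        rw [abs_mul, abs_mul]
        have : |((Equiv.Perm.sign σ : ℤ) : ℝ)| = 1 := by
          rcases Int.units_eq_one_or (Equiv.Perm.sign σ) with h | h <;> simp [h]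
        rw [this, one_mul]
        exact mul_le_mul (bd _ _ fun _ => hv _) (bd _ _ fun _ => hv _) (abs_nonneg _)
          (norm_nonneg _)
    _ = N.factorial * (‖α‖ * ‖β‖) := by
        simp [Fintype.card_perm]

/-- The value of `α ⊗ β` on a family of vectors. -/
def tensorEval {k l N : ℕ} (h : k + l = N) (α : T [⋀^Fin k]→L[ℝ] ℝ) (β : T [⋀^Fin l]→L[ℝ] ℝ)
    (u : Fin N → T) : ℝ :=
  α (fun i => u (Fin.cast h (Fin.castAdd l i))) * β (fun j => u (Fin.cast h (Fin.natAdd k j)))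

/-- The exterior product `g ∧ α` with a covector. -/
abbrev covecWedge {k : ℕ} (g : T →L[ℝ] ℝ) (α : T [⋀^Fin k]→L[ℝ] ℝ) : T [⋀^Fin (k + 1)]→L[ℝ] ℝ :=
  ContinuousAlternatingMap.alternatizeUncurryFin (g.smulRight α)

theorem covecWedge_apply {k : ℕ} (g : T →L[ℝ] ℝ) (α : T [⋀^Fin k]→L[ℝ] ℝ) (v : Fin (k + 1) → T) :
    covecWedge g α v = ∑ i : Fin (k + 1), (-1) ^ (i : ℕ) * (g (v i) * α (i.removeNth v)) := by
  simp [covecWedge, ContinuousAlternatingMap.alternatizeUncurryFin_apply]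

/-- Expanding `g ∧ α` over the `k + 1` positions of `g` gives `k + 1` equal sums: moving slot `i` to
the front costs `(-1)^i`, which cancels the sign in the expansion. The factor `k + 1` turns `(k+1)!`
into `k!`. -/
theorem factorial_mul_covecWedge_wedge {k l N : ℕ} (h : k + 1 + l = N + 1) (hN : k + l = N)
    (g : T →L[ℝ] ℝ) (α : T [⋀^Fin k]→L[ℝ] ℝ) (β : T [⋀^Fin l]→L[ℝ] ℝ) (v : Fin (N + 1) → T) :
    ((k.factorial * l.factorial : ℕ) : ℝ) *
        wedge (covecWedge g α) β (fun i => v (Fin.cast h i)) =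
      ∑ σ : Equiv.Perm (Fin (N + 1)), ((Equiv.Perm.sign σ : ℤ) : ℝ) *
        (g (v (σ 0)) * tensorEval hN α β (Fin.removeNth 0 (v ∘ σ))) := by
  have h0 : ((k + 1 : ℕ) : ℝ) ≠ 0 := by positivity
  apply mul_left_cancel₀ h0
  rw [← mul_assoc, ← Nat.cast_mul, ← mul_assoc, ← Nat.factorial_succ, factorial_mul_wedge]
  set S := ∑ σ : Equiv.Perm (Fin (N + 1)), ((Equiv.Perm.sign σ : ℤ) : ℝ) *
        (g (v (σ 0)) * tensorEval hN α β (Fin.removeNth 0 (v ∘ σ))) with hS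
  have : ∀ i : Fin (k + 1), (-1 : ℝ) ^ (i : ℕ) * ∑ σ : Equiv.Perm (Fin (N + 1)),
      ((Equiv.Perm.sign σ : ℤ) : ℝ) * (g (v (σ (Fin.cast h (Fin.castAdd l i)))) *
        tensorEval hN α β
            ((Fin.cast h (Fin.castAdd l i)).removeNth (v ∘ σ))) = S := by
    intro i
    rw [sum_sign_mul_removeNth, ← hS, ← mul_assoc, ← pow_add,
      Even.neg_one_pow ⟨i, by simp⟩, one_mul]
  calc _ = ∑ i : Fin (k + 1), (-1 : ℝ) ^ (i : ℕ) * ∑ σ : Equiv.Perm (Fin (N + 1)),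
      ((Equiv.Perm.sign σ : ℤ) : ℝ) * (g (v (σ (Fin.cast h (Fin.castAdd l i)))) *
        tensorEval hN α β
            ((Fin.cast h (Fin.castAdd l i)).removeNth (v ∘ σ))) := by
        simp only [Finset.mul_sum]
        rw [Finset.sum_comm]
        refine Finset.sum_congr rfl fun σ _ => ?_
        rw [covecWedge_apply, Finset.sum_mul, Finset.mul_sum]
        refine Finset.sum_congr rfl fun i _ => ?_
        -- Deleting an index inside the first block agrees with deleting it from the whole list,
        -- once the remaining positions are split as `k + l`.
        have e1 : ∀ a : Fin k, Fin.cast h (Fin.castAdd l (i.succAbove a)) =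
            (Fin.cast h (Fin.castAdd l i)).succAbove (Fin.cast hN (Fin.castAdd l a)) := by
          intro a
          ext
          simp only [Fin.succAbove, Fin.lt_def, Fin.val_cast, Fin.val_castAdd, Fin.val_castSucc]
          split_ifs <;> simp
        have e2 : ∀ b : Fin l, Fin.cast h (Fin.natAdd (k + 1) b) =
            (Fin.cast h (Fin.castAdd l i)).succAbove (Fin.cast hN (Fin.natAdd k b)) := by
          intro b
          ext
          have := i.isLt
          simp only [Fin.succAbove, Fin.lt_def, Fin.val_cast, Fin.val_castAdd, Fin.val_castSucc,
            Fin.val_natAdd]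
          split_ifs <;> simp <;> omega
        have e3 : i.removeNth (fun i => v (σ (Fin.cast h (Fin.castAdd l i)))) = fun a =>
            v (σ ((Fin.cast h (Fin.castAdd l i)).succAbove (Fin.cast hN (Fin.castAdd l a)))) :=
          funext fun a => congrArg (v ∘ σ) (e1 a)
        simp only [tensorEval, Fin.removeNth_apply, Function.comp_apply, e2, e3]
        ring
    _ = ((k + 1 : ℕ) : ℝ) * S := by
        rw [Finset.sum_congr rfl fun i _ => this i]
        simp

/-- Here `g` occupies slot `k + i` of the whole list. Moving it to the front costs `(-1)^(k+i)`, and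
after cancellation with the sign of the expansion `(-1)^k` remains in front of the same sum as for
`g ∧ α`. -/
theorem factorial_mul_wedge_covecWedge {k l N : ℕ} (h : k + (l + 1) = N + 1) (hN : k + l = N)
    (g : T →L[ℝ] ℝ) (α : T [⋀^Fin k]→L[ℝ] ℝ) (β : T [⋀^Fin l]→L[ℝ] ℝ) (v : Fin (N + 1) → T) :
    ((k.factorial * l.factorial : ℕ) : ℝ) *
        wedge α (covecWedge g β) (fun i => v (Fin.cast h i)) =
      (-1) ^ k * ∑ σ : Equiv.Perm (Fin (N + 1)), ((Equiv.Perm.sign σ : ℤ) : ℝ) *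
        (g (v (σ 0)) * tensorEval hN α β (Fin.removeNth 0 (v ∘ σ))) := by
  have h0 : ((l + 1 : ℕ) : ℝ) ≠ 0 := by positivity
  apply mul_left_cancel₀ h0
  rw [← mul_assoc, ← Nat.cast_mul, Nat.mul_left_comm, ← Nat.factorial_succ, factorial_mul_wedge]
  set S := ∑ σ : Equiv.Perm (Fin (N + 1)), ((Equiv.Perm.sign σ : ℤ) : ℝ) *
        (g (v (σ 0)) * tensorEval hN α β (Fin.removeNth 0 (v ∘ σ))) with hS
  have : ∀ i : Fin (l + 1), (-1 : ℝ) ^ (i : ℕ) * ∑ σ : Equiv.Perm (Fin (N + 1)),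
      ((Equiv.Perm.sign σ : ℤ) : ℝ) * (g (v (σ (Fin.cast h (Fin.natAdd k i)))) *
        tensorEval hN α β
            ((Fin.cast h (Fin.natAdd k i)).removeNth (v ∘ σ))) = (-1) ^ k * S := by
    intro i
    rw [sum_sign_mul_removeNth, ← hS, ← mul_assoc, ← pow_add]
    simp only [Fin.val_cast, Fin.val_natAdd]
    rw [Nat.add_left_comm, pow_add, Even.neg_one_pow ⟨i, rfl⟩, mul_one]
  calc _ = ∑ i : Fin (l + 1), (-1 : ℝ) ^ (i : ℕ) * ∑ σ : Equiv.Perm (Fin (N + 1)),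
      ((Equiv.Perm.sign σ : ℤ) : ℝ) * (g (v (σ (Fin.cast h (Fin.natAdd k i)))) *
        tensorEval hN α β
            ((Fin.cast h (Fin.natAdd k i)).removeNth (v ∘ σ))) := by
        simp only [Finset.mul_sum]
        rw [Finset.sum_comm]
        refine Finset.sum_congr rfl fun σ _ => ?_
        rw [covecWedge_apply, Finset.mul_sum, Finset.mul_sum]
        refine Finset.sum_congr rfl fun i _ => ?_
        have e1 : ∀ b : Fin l, Fin.cast h (Fin.natAdd k (i.succAbove b)) =
            (Fin.cast h (Fin.natAdd k i)).succAbove (Fin.cast hN (Fin.natAdd k b)) := by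
          intro a
          ext
          simp only [Fin.succAbove, Fin.lt_def, Fin.val_cast, Fin.val_natAdd, Fin.val_castSucc]
          split_ifs <;> simp <;> omega
        have e2 : ∀ a : Fin k, Fin.cast h (Fin.castAdd (l + 1) a) =
            (Fin.cast h (Fin.natAdd k i)).succAbove (Fin.cast hN (Fin.castAdd l a)) := by
          intro a
          ext
          have := a.isLt
          simp only [Fin.succAbove, Fin.lt_def, Fin.val_cast, Fin.val_castAdd, Fin.val_castSucc,
            Fin.val_natAdd]
          split_ifs <;> simp <;> omega
        have e3 : i.removeNth (fun j => v (σ (Fin.cast h (Fin.natAdd k j)))) = fun b =>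
            v (σ ((Fin.cast h (Fin.natAdd k i)).succAbove (Fin.cast hN (Fin.natAdd k b)))) :=
          funext fun b => congrArg (v ∘ σ) (e1 b)
        simp only [tensorEval, Fin.removeNth_apply, Function.comp_apply, e2, e3]
        ring
    _ = ((l + 1 : ℕ) : ℝ) * ((-1) ^ k * S) := by
        rw [Finset.sum_congr rfl fun i _ => this i]
        simp

/-- Moving a covector from the first to the second factor of a wedge product. -/
theorem covecWedge_wedge {k l N : ℕ} (h : k + 1 + l = N) (h' : k + (l + 1) = N)
    (g : T →L[ℝ] ℝ) (α : T [⋀^Fin k]→L[ℝ] ℝ) (β : T [⋀^Fin l]→L[ℝ] ℝ) (v : Fin N → T) :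
    wedge (covecWedge g α) β (fun i => v (Fin.cast h i)) =
      (-1) ^ k * wedge α (covecWedge g β) (fun i => v (Fin.cast h' i)) := by
  obtain ⟨M, rfl⟩ : ∃ M, N = M + 1 := ⟨N - 1, by omega⟩
  have hM : k + l = M := by omega
  have h0 : ((k.factorial * l.factorial : ℕ) : ℝ) ≠ 0 := by positivity
  apply mul_left_cancel₀ h0
  rw [mul_left_comm, factorial_mul_covecWedge_wedge h hM, factorial_mul_wedge_covecWedge h' hM,
    ← mul_assoc, ← pow_add, Even.neg_one_pow ⟨k, rfl⟩, one_mul]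

/-- If `g ∧ β = 0` for all covectors `g`, and the degree of `β` is less than the dimension, then
`β = 0`. -/
theorem eq_zero_of_covecWedge_eq_zero {l N : ℕ} (hl : l < N) (b : Basis (Fin N) ℝ T)
    [FiniteDimensional ℝ T] (β : T [⋀^Fin l]→L[ℝ] ℝ)
    (hβ : ∀ g : T →L[ℝ] ℝ, covecWedge g β = 0) : β = 0 := by
  apply ContinuousAlternatingMap.toAlternatingMap_injective
  refine b.ext_alternating fun J _ => ?_
  -- Since `l < N`, the basis vectors in `J` omit some index `m`. Evaluating the product of the
  -- coordinate covector of `m` with `β` on `(b m, b ∘ J)` leaves only the term `β (b ∘ J)`.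
  obtain ⟨m, hm⟩ : ∃ m, ∀ i, J i ≠ m := by
    by_contra! hcon
    have : Fintype.card (Fin N) ≤ Fintype.card (Fin l) :=
      Fintype.card_le_of_surjective J fun m => hcon m
    simp at this
    omega
  have := congrArg (fun f => f (Fin.cons (b m) fun i => b (J i) : Fin (l + 1) → T))
    (hβ (LinearMap.toContinuousLinearMap (b.coord m)))
  simp only [covecWedge_apply, Fin.sum_univ_succ, Fin.cons_zero, Fin.cons_succ,
    LinearMap.coe_toContinuousLinearMap', Basis.coord_apply, Basis.repr_self] at this
  simpa [Finsupp.single_apply, hm] using this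

/-- The wedge pairing between forms of complementary degrees is nondegenerate. -/
theorem eq_zero_of_wedge_eq_zero [FiniteDimensional ℝ T] {k : ℕ} : ∀ {l N : ℕ} (h : k + l = N)
    (b : Basis (Fin N) ℝ T) (β : T [⋀^Fin l]→L[ℝ] ℝ),
    (∀ α : T [⋀^Fin k]→L[ℝ] ℝ, wedge α β (fun i => b (Fin.cast h i)) = 0) → β = 0 := by
  induction k with
  | zero =>
    intro l N h b β H
    obtain rfl : l = N := by omega
    -- In degree zero the test form `1` suffices: every permutation contributes `β b`, so a nonzero
    -- multiple of `β b` vanishes.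
    have h1 := fun v : Fin l → T => factorial_mul_wedge h
      (ContinuousAlternatingMap.constOfIsEmpty ℝ T (Fin 0) (1 : ℝ)) β v
    have key : ∀ σ : Equiv.Perm (Fin l), ((Equiv.Perm.sign σ : ℤ) : ℝ) *
        β (fun j => b (σ j)) = β b := by
      intro σ
      have := β.toAlternatingMap.map_perm b σ
      simp only [ContinuousAlternatingMap.coe_toAlternatingMap, Units.smul_def, zsmul_eq_mul] at this
      change _ * β (b ∘ σ) = _
      rw [this, ← mul_assoc, ← Int.cast_mul, ← Units.val_mul, Int.units_mul_self]
      simp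
    have h2 : β b = 0 := by
      have h3 := h1 b
      rw [H, mul_zero] at h3
      have e : ∀ j : Fin l, Fin.cast h (Fin.natAdd 0 j) = j := fun j => by ext; simp
      simp only [e, ContinuousAlternatingMap.constOfIsEmpty_apply, one_mul, key, Finset.sum_const,
        nsmul_eq_mul] at h3
      rcases mul_eq_zero.1 h3.symm with h4 | h4
      · simp at h4
      · exact h4
    apply ContinuousAlternatingMap.toAlternatingMap_injective
    refine b.ext_alternating fun J hJ => ?_
    have h5 := key (Equiv.ofBijective J (Finite.injective_iff_bijective.1 hJ))
    rw [h2] at h5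
    rcases mul_eq_zero.1 h5 with h6 | h6
    · simp at h6
    · exact h6
  | succ k ih =>
    intro l N h b β H
    -- Testing `β` against `g ∧ α` amounts to testing `g ∧ β` against `α`. The induction hypothesis
    -- kills `g ∧ β` for every covector `g`.
    refine eq_zero_of_covecWedge_eq_zero (by omega) b β fun g => ?_
    refine ih (by omega) b _ fun α => ?_
    have h1 := covecWedge_wedge h (by omega) g α β b
    rw [H] at h1
    simpa using h1.symm

end Norm

instance finiteDimensional_continuousAlternatingMap {T : Type*} [NormedAddCommGroup T]
    [NormedSpace ℝ T] [FiniteDimensional ℝ T] {k : ℕ} :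
    FiniteDimensional ℝ (T [⋀^Fin k]→L[ℝ] ℝ) := by
  let b := Module.finBasis ℝ T
  let f : (T [⋀^Fin k]→L[ℝ] ℝ) →ₗ[ℝ] ((Fin k → Fin (finrank ℝ T)) → ℝ) :=
    { toFun := fun α J => α (fun i => b (J i))
      map_add' := fun _ _ => rfl
      map_smul' := fun _ _ => rfl }
  refine FiniteDimensional.of_injective f fun α β hαβ => ?_
  apply ContinuousAlternatingMap.toAlternatingMap_injective
  exact b.ext_alternating fun J _ => congrFun hαβ J

/-! ### Changes of charts -/

section Charts

variable {n : ℕ} {M : Type*} [TopologicalSpace M] [ChartedSpace (Model n) M]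

instance finiteDimensional_tangentSpace (p : M) : FiniteDimensional ℝ (TangentSpace (𝓡 n) p) :=
  inferInstanceAs (FiniteDimensional ℝ (Model n))

theorem card_fin_eq_finrank_tangentSpace (p : M) :
    Fintype.card (Fin n) = finrank ℝ (TangentSpace (𝓡 n) p) :=
  show Fintype.card (Fin n) = finrank ℝ (Model n) by simp

/-- A form which takes the value `A p` on the orientation `o p`. -/
def signedForm (s : ℤˣ) {k : ℕ} (o : (p : M) → Orientation ℝ (TangentSpace (𝓡 n) p) (Fin n))
    (A : (p : M) → TangentSpace (𝓡 n) p [⋀^Fin k]→L[ℝ] ℝ) : Form n M s k :=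
  ⟨fun p o' => open Classical in if o' = o p then A p else ((s : ℤ) : ℝ) • A p, by
    intro p o'
    have hn : (-o' : Orientation ℝ (TangentSpace (𝓡 n) p) (Fin n)) ≠ o' :=
      (Module.Ray.ne_neg_self _).symm
    have hor : o' = o p ∨ o' = -o p :=
      Orientation.eq_or_eq_neg _ _ (card_fin_eq_finrank_tangentSpace p)
    rcases hor with h | h
    · subst h
      simp [hn]
    · have h' : -o' = o p := by rw [h]; exact neg_neg (o p)
      have h'' : o' ≠ o p := by rw [← h']; exact hn.symm
      simp only [h', h'', if_true, if_false, smul_smul]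
      rw [← Int.cast_mul, ← Units.val_mul, Int.units_mul_self]
      simp⟩

theorem signedForm_apply_self (s : ℤˣ) {k : ℕ}
    (o : (p : M) → Orientation ℝ (TangentSpace (𝓡 n) p) (Fin n))
    (A : (p : M) → TangentSpace (𝓡 n) p [⋀^Fin k]→L[ℝ] ℝ) (p : M) :
    (signedForm s o A).1 p (o p) = A p := if_pos rfl

theorem signedForm_apply_eq_zero (s : ℤˣ) {k : ℕ}
    (o : (p : M) → Orientation ℝ (TangentSpace (𝓡 n) p) (Fin n))
    (A : (p : M) → TangentSpace (𝓡 n) p [⋀^Fin k]→L[ℝ] ℝ) (p : M) (h : A p = 0) :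
    (signedForm s o A).1 p = 0 := by
  funext o'
  simp [signedForm, h]

variable [IsManifold (𝓡 n) ∞ M]

theorem coordEquiv_eq {x₀ p : M} (h : p ∈ (chartAt (Model n) x₀).source) :
    coordEquiv (n := n) x₀ p =
      (trivializationAt (Model n) (TangentSpace (𝓡 n) : M → Type) x₀).continuousLinearEquivAt ℝ p
      (by simpa using h) := by
  exact dif_pos h

/-- The differential at `p` of the transition map between two charts. -/
def transD (x₀ x₁ p : M) : Model n ≃L[ℝ] Model n :=
  (coordEquiv x₀ p).symm.trans (coordEquiv x₁ p)

/-- This identifies the comparison of trivializations with the coordinate change of the tangent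
bundle, which is known to be the derivative of the transition map. -/
theorem transD_eq {x₀ x₁ p : M} (h₀ : p ∈ (chartAt (Model n) x₀).source)
    (h₁ : p ∈ (chartAt (Model n) x₁).source) :
    (transD (n := n) x₀ x₁ p : Model n →L[ℝ] Model n) = tangentCoordChange (𝓡 n) x₀ x₁ p := by
  ext1 v
  have e0 : (coordEquiv (n := n) x₀ p).symm v = tangentCoordChange (𝓡 n) x₀ p p v := by
    rw [coordEquiv_eq h₀]
    refine (congrFun (Trivialization.symm_continuousLinearEquivAt_eq (R := ℝ) _
      (by simpa using h₀)) v).trans ?_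
    exact congrArg (fun f => f v) (TangentBundle.symmL_trivializationAt_eq_core (I := 𝓡 n) h₀)
  have e1 : ∀ u, coordEquiv (n := n) x₁ p u = tangentCoordChange (𝓡 n) p x₁ p u := by
    intro u
    rw [coordEquiv_eq h₁]
    refine (congrFun (Trivialization.coe_continuousLinearEquivAt_eq (R := ℝ) _
      (by simpa using h₁)) u).trans ?_
    exact congrArg (fun f => f u)
      (TangentBundle.continuousLinearMapAt_trivializationAt_eq_core (I := 𝓡 n) h₁)
  change coordEquiv (n := n) x₁ p ((coordEquiv (n := n) x₀ p).symm v) = _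
  rw [e1, e0]
  apply tangentCoordChange_comp
  simp [h₀, h₁]

theorem hasFDerivAt_transition {x₀ x₁ p : M} (h₀ : p ∈ (chartAt (Model n) x₀).source)
    (h₁ : p ∈ (chartAt (Model n) x₁).source) :
    HasFDerivAt (chartAt (Model n) x₁ ∘ (chartAt (Model n) x₀).symm)
      (transD (n := n) x₀ x₁ p : Model n →L[ℝ] Model n) (chartAt (Model n) x₀ p) := by
  have := hasFDerivWithinAt_tangentCoordChange (I := 𝓡 n) (x := x₀) (y := x₁) (z := p)
    (by simp [h₀, h₁])
  rw [transD_eq h₀ h₁]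
  simpa [mfld_simps] using this

theorem contDiffAt_transition {x₀ x₁ p : M} (h₀ : p ∈ (chartAt (Model n) x₀).source)
    (h₁ : p ∈ (chartAt (Model n) x₁).source) :
    ContDiffAt ℝ ∞ (chartAt (Model n) x₁ ∘ (chartAt (Model n) x₀).symm)
      (chartAt (Model n) x₀ p) := by
  have := contDiffWithinAt_ext_coord_change (I := 𝓡 n) (n := ∞) (M := M) x₁ x₀
    (y := chartAt (Model n) x₀ p) (by simp [h₀, h₁, mfld_simps])
  simpa [mfld_simps, contDiffWithinAt_univ] using this

/-- The sign by which the coordinate expressions of a form of parity `s` differ. -/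
def transSign (s : ℤˣ) (d : ℝ) : ℝ := if 0 < d then 1 else ((s : ℤ) : ℝ)

/-- Transporting both orientations to `ℝⁿ` by the second chart turns the comparison into the
question whether the Jacobian preserves the standard orientation. This is decided by the sign of its
determinant. -/
theorem coordOrientation_eq_or (x₀ x₁ p : M) :
    (0 < (transD (n := n) x₀ x₁ p : Model n →L[ℝ] Model n).det ∧
      coordOrientation (n := n) x₁ p = coordOrientation x₀ p) ∨
    (¬ 0 < (transD (n := n) x₀ x₁ p : Model n →L[ℝ] Model n).det ∧
      coordOrientation (n := n) x₁ p = -coordOrientation x₀ p) := by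
  set o := (EuclideanSpace.basisFun (Fin n) ℝ).toBasis.orientation
  have hc : Fintype.card (Fin n) = finrank ℝ (Model n) := by simp
  have key := Orientation.map_eq_iff_det_pos o (transD (n := n) x₀ x₁ p).toLinearEquiv hc
  have e : coordOrientation (n := n) x₁ p = coordOrientation x₀ p ↔
      Orientation.map (Fin n) (transD (n := n) x₀ x₁ p).toLinearEquiv o = o := by
    have e1 : Orientation.map (Fin n) (coordEquiv (n := n) x₁ p).toLinearEquiv
        (coordOrientation (n := n) x₁ p) = o :=
      (Orientation.map (Fin n) (coordEquiv (n := n) x₁ p).toLinearEquiv).apply_symm_apply o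
    have e0 : Orientation.map (Fin n) (coordEquiv (n := n) x₁ p).toLinearEquiv
        (coordOrientation (n := n) x₀ p) =
        Orientation.map (Fin n) (transD (n := n) x₀ x₁ p).toLinearEquiv o := by
      change Orientation.map (Fin n) (coordEquiv (n := n) x₁ p).toLinearEquiv
        (Orientation.map (Fin n) (coordEquiv (n := n) x₀ p).symm.toLinearEquiv o) = _
      induction o using Module.Ray.ind with
      | h v hv => rfl
    rw [← (Orientation.map (Fin n) (coordEquiv (n := n) x₁ p).toLinearEquiv).injective.eq_iff,
      e1, e0, eq_comm]
  by_cases h : 0 < (transD (n := n) x₀ x₁ p : Model n →L[ℝ] Model n).det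
  · exact Or.inl ⟨h, e.2 (key.2 h)⟩
  · refine Or.inr ⟨h, (Orientation.eq_or_eq_neg _ _
      (card_fin_eq_finrank_tangentSpace p)).resolve_left fun h' => h (key.1 (e.1 h'))⟩

theorem apply_coordOrientation {s : ℤˣ} {k : ℕ} (w : Form n M s k) (x₀ x₁ p : M) :
    w.1 p (coordOrientation x₀ p) =
      transSign s (transD (n := n) x₀ x₁ p : Model n →L[ℝ] Model n).det •
        w.1 p (coordOrientation x₁ p) := by
  rcases coordOrientation_eq_or (n := n) x₀ x₁ p with ⟨h, e⟩ | ⟨h, e⟩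
  · rw [transSign, if_pos h, e, one_smul]
  · rw [transSign, if_neg h, e, w.2, smul_smul, ← Int.cast_mul, ← Units.val_mul,
      Int.units_mul_self]
    simp

/-- The coordinate expression of a form in a chart at a point of its domain. -/
theorem inChart_chart {s : ℤˣ} {k : ℕ} (w : Form n M s k) {x₀ p : M}
    (h : p ∈ (chartAt (Model n) x₀).source) :
    inChart w x₀ (chartAt (Model n) x₀ p) =
      (w.1 p (coordOrientation x₀ p)).compContinuousLinearMap
        ((coordEquiv (n := n) x₀ p).symm : Model n →L[ℝ] TangentSpace (𝓡 n) p) := by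
  -- The point `chart.symm (chart p)` is equal to `p` only propositionally, and the tangent space
  -- depends on it; so the point is generalized before it is substituted.
  have key : ∀ q, q = p → (w.1 q (coordOrientation x₀ q)).compContinuousLinearMap
        ((coordEquiv (n := n) x₀ q).symm : Model n →L[ℝ] TangentSpace (𝓡 n) q) =
      (w.1 p (coordOrientation x₀ p)).compContinuousLinearMap
        ((coordEquiv (n := n) x₀ p).symm : Model n →L[ℝ] TangentSpace (𝓡 n) p) := by
    rintro q rfl; rfl
  exact key _ ((chartAt (Model n) x₀).left_inv h)

/-- The transformation law: pullback by the Jacobian, with the extra factor `s` wherever the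
transition reverses the orientation. -/
theorem inChart_transition {s : ℤˣ} {k : ℕ} (w : Form n M s k) {x₀ x₁ p : M}
    (h₀ : p ∈ (chartAt (Model n) x₀).source) (h₁ : p ∈ (chartAt (Model n) x₁).source) :
    inChart w x₀ (chartAt (Model n) x₀ p) =
      transSign s (transD (n := n) x₀ x₁ p : Model n →L[ℝ] Model n).det •
        (inChart w x₁ (chartAt (Model n) x₁ p)).compContinuousLinearMap
          (transD (n := n) x₀ x₁ p : Model n →L[ℝ] Model n) := by
  rw [inChart_chart w h₀, inChart_chart w h₁, apply_coordOrientation w x₀ x₁ p]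
  ext v
  simp [transD, Function.comp_def]

/-- Two forms with the same coordinate expression at a point agree there. -/
theorem eq_of_inChart_eq {s : ℤˣ} {k : ℕ} {w η : Form n M s k} {x₀ p : M}
    (h₀ : p ∈ (chartAt (Model n) x₀).source)
    (h : inChart w x₀ (chartAt (Model n) x₀ p) = inChart η x₀ (chartAt (Model n) x₀ p)) :
    w.1 p = η.1 p := by
  rw [inChart_chart w h₀, inChart_chart η h₀] at h
  have h1 : w.1 p (coordOrientation x₀ p) = η.1 p (coordOrientation x₀ p) := by
    ext v
    have := congrArg (fun f => f fun i => coordEquiv x₀ p (v i)) h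
    simpa [Function.comp_def] using this
  funext o
  have hor : o = coordOrientation x₀ p ∨ o = -coordOrientation x₀ p :=
    Orientation.eq_or_eq_neg _ _ (card_fin_eq_finrank_tangentSpace p)
  rcases hor with rfl | rfl
  · exact h1
  · rw [w.2, η.2, h1]

theorem inChart_congr {s : ℤˣ} {k : ℕ} {w η : Form n M s k} {x₀ : M} {y : Model n}
    (h : w.1 ((chartAt (Model n) x₀).symm y) = η.1 ((chartAt (Model n) x₀).symm y)) :
    inChart w x₀ y = inChart η x₀ y := by
  simp only [inChart, h]

@[simp] theorem inChart_add {s : ℤˣ} {k : ℕ} (w η : Form n M s k) (x₀ : M) (y : Model n) :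
    inChart (w + η) x₀ y = inChart w x₀ y + inChart η x₀ y := rfl

@[simp] theorem inChart_zero {s : ℤˣ} {k : ℕ} (x₀ : M) (y : Model n) :
    inChart (0 : Form n M s k) x₀ y = 0 := rfl

/-- In a neighbourhood of a point, the coordinate expressions in two charts are related by pullback
along the transition map, up to a constant sign. -/
theorem eventually_inChart_transition (s : ℤˣ) {x₀ x₁ p : M}
    (h₀ : p ∈ (chartAt (Model n) x₀).source) (h₁ : p ∈ (chartAt (Model n) x₁).source) :
    ∀ᶠ y in 𝓝 (chartAt (Model n) x₀ p), ∀ (k : ℕ) (w : Form n M s k),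
      inChart w x₀ y = transSign s (transD (n := n) x₀ x₁ p : Model n →L[ℝ] Model n).det •
        (inChart w x₁ ((chartAt (Model n) x₁ ∘ (chartAt (Model n) x₀).symm) y)
          ).compContinuousLinearMap
            (fderiv ℝ (chartAt (Model n) x₁ ∘ (chartAt (Model n) x₀).symm) y) := by
  set T := chartAt (Model n) x₁ ∘ (chartAt (Model n) x₀).symm with hT
  have ht : ∀ᶠ y in 𝓝 (chartAt (Model n) x₀ p), y ∈ (chartAt (Model n) x₀).target :=
    (chartAt (Model n) x₀).open_target.mem_nhds ((chartAt (Model n) x₀).map_source h₀)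
  have hs : ∀ᶠ y in 𝓝 (chartAt (Model n) x₀ p),
      (chartAt (Model n) x₀).symm y ∈ (chartAt (Model n) x₁).source := by
    apply ((chartAt (Model n) x₀).continuousAt_symm ((chartAt (Model n) x₀).map_source h₀))
    rw [(chartAt (Model n) x₀).left_inv h₀]
    exact (chartAt (Model n) x₁).open_source.mem_nhds h₁
  have hd : fderiv ℝ T (chartAt (Model n) x₀ p) = transD (n := n) x₀ x₁ p :=
    (hasFDerivAt_transition h₀ h₁).fderiv
  have hcont : ContinuousAt (fun y => (fderiv ℝ T y).det) (chartAt (Model n) x₀ p) :=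
    ContinuousLinearMap.continuous_det.continuousAt.comp
      ((contDiffAt_transition h₀ h₁).fderiv_right (m := 0) (by simp)).continuousAt
  have hne : (fderiv ℝ T (chartAt (Model n) x₀ p)).det ≠ 0 := by
    rw [hd]
    exact (transD (n := n) x₀ x₁ p).toLinearEquiv.isUnit_det'.ne_zero
  -- The Jacobian determinant is continuous and nonzero, hence of constant sign nearby. This is what
  -- allows the factor to be taken out of derivatives.
  have hsg : ∀ᶠ y in 𝓝 (chartAt (Model n) x₀ p), transSign s (fderiv ℝ T y).det =
      transSign s (transD (n := n) x₀ x₁ p : Model n →L[ℝ] Model n).det := by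
    rw [← hd]
    rcases lt_or_gt_of_ne hne with h | h
    · filter_upwards [hcont.eventually_lt_const h] with y hy
      rw [transSign, transSign, if_neg (not_lt.2 hy.le), if_neg (not_lt.2 h.le)]
    · filter_upwards [hcont.eventually_const_lt h] with y hy
      rw [transSign, transSign, if_pos hy, if_pos h]
  filter_upwards [ht, hs, hsg] with y hy0 hy1 hy2 k w
  set q := (chartAt (Model n) x₀).symm y
  have hq : q ∈ (chartAt (Model n) x₀).source := (chartAt (Model n) x₀).map_target hy0
  have hyq : chartAt (Model n) x₀ q = y := (chartAt (Model n) x₀).right_inv hy0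
  have h2 := inChart_transition w hq hy1
  rw [← (hasFDerivAt_transition hq hy1).fderiv, hyq, hy2] at h2
  exact h2

end Charts

/-! ### Families of alternating maps on a finite-dimensional space -/

section Families

variable {E T : Type*} [NormedAddCommGroup E] [NormedSpace ℝ E] [NormedAddCommGroup T]
  [NormedSpace ℝ T] [FiniteDimensional ℝ T] {k : ℕ}

/-- An alternating map can be recovered, by a continuous linear map, from finitely many of its
values. -/
theorem exists_clm_eval_eq (T : Type*) [NormedAddCommGroup T] [NormedSpace ℝ T]
    [FiniteDimensional ℝ T] (k : ℕ) :
    ∃ (m : ℕ) (b : (Fin k → Fin m) → Fin k → T)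
      (g : ((Fin k → Fin m) → ℝ) →L[ℝ] (T [⋀^Fin k]→L[ℝ] ℝ)),
      ∀ α : T [⋀^Fin k]→L[ℝ] ℝ, g (fun J => α (b J)) = α := by
  let b := Module.finBasis ℝ T
  let f : (T [⋀^Fin k]→L[ℝ] ℝ) →ₗ[ℝ] ((Fin k → Fin (finrank ℝ T)) → ℝ) :=
    { toFun := fun α J => α (fun i => b (J i))
      map_add' := fun _ _ => rfl
      map_smul' := fun _ _ => rfl }
  have hf : Function.Injective f := fun α β hαβ => by
    apply ContinuousAlternatingMap.toAlternatingMap_injective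
    exact b.ext_alternating fun J _ => congrFun hαβ J
  obtain ⟨g, hg⟩ := f.exists_leftInverse_of_injective (LinearMap.ker_eq_bot.2 hf)
  exact ⟨_, fun J i => b (J i), LinearMap.toContinuousLinearMap g,
    fun α => congrArg (fun h => h α) hg⟩

theorem contDiffAt_alternating_of_eval {r : ℕ∞ω} {f : E → T [⋀^Fin k]→L[ℝ] ℝ} {x : E}
    (h : ∀ v, ContDiffAt ℝ r (fun y => f y v) x) : ContDiffAt ℝ r f x := by
  obtain ⟨m, b, g, hg⟩ := exists_clm_eval_eq T k
  have : f = fun y => g fun J => f y (b J) := funext fun y => (hg _).symm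
  rw [this]
  exact g.contDiff.contDiffAt.comp x (contDiffAt_pi.2 fun J => h (b J))

/-- Both the form and the linear map vary. Expanding the form in a fixed basis leaves scalar
coefficients times constant multilinear maps applied to `D y (v i)`, and all of these are smooth. -/
theorem contDiffAt_compContinuousLinearMap {r : ℕ∞ω} {T' : Type*} [NormedAddCommGroup T']
    [NormedSpace ℝ T'] [FiniteDimensional ℝ T'] {f : E → T [⋀^Fin k]→L[ℝ] ℝ}
    {D : E → T' →L[ℝ] T} {x : E} (hf : ContDiffAt ℝ r f x) (hD : ContDiffAt ℝ r D x) :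
    ContDiffAt ℝ r (fun y => (f y).compContinuousLinearMap (D y)) x := by
  refine contDiffAt_alternating_of_eval fun v => ?_
  let B := Module.finBasis ℝ (T [⋀^Fin k]→L[ℝ] ℝ)
  have e : (fun y => (f y).compContinuousLinearMap (D y) v) = fun y =>
      ∑ j, LinearMap.toContinuousLinearMap (B.coord j) (f y) *
        (B j).toContinuousMultilinearMap (fun i => D y (v i)) := by
    funext y
    have := congrArg (fun a => a fun i => D y (v i)) (B.sum_repr (f y)).symm
    simp only [ContinuousAlternatingMap.sum_apply, ContinuousAlternatingMap.smul_apply,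
      smul_eq_mul] at this
    exact this
  rw [e]
  refine ContDiffAt.sum fun j _ => ContDiffAt.mul ?_ ?_
  · exact (ContinuousLinearMap.contDiff _).contDiffAt.comp x hf
  · exact (ContinuousMultilinearMap.contDiff _).contDiffAt.comp x
      (contDiffAt_pi.2 fun i => hD.clm_apply contDiffAt_const)

end Families

theorem contDiffAt_extDeriv {T : Type*} [NormedAddCommGroup T] [NormedSpace ℝ T] {k : ℕ}
    {f : T → T [⋀^Fin k]→L[ℝ] ℝ} {x : T} (hf : ContDiffAt ℝ ∞ f x) :
    ContDiffAt ℝ ∞ (extDeriv f) x :=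
  ContDiffAt.comp (g := ContinuousAlternatingMap.alternatizeUncurryFinCLM ℝ T ℝ) x
    (ContinuousLinearMap.contDiff _).contDiffAt (hf.fderiv_right (m := ∞) (by simp))

/-! ### Test forms and the classical exterior derivative -/

section Smooth

variable {n : ℕ} {M : Type*} [TopologicalSpace M] [ChartedSpace (Model n) M]
  [IsManifold (𝓡 n) ∞ M]

/-- The form with coordinate expression `α` in the chart `chartAt x₀`, and zero outside of the
domain of that chart. -/
def ofChart (s : ℤˣ) {k : ℕ} (x₀ : M) (α : Model n → Model n [⋀^Fin k]→L[ℝ] ℝ) : Form n M s k :=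
  open Classical in
  signedForm s (coordOrientation x₀) fun p => if p ∈ (chartAt (Model n) x₀).source then
    (α (chartAt (Model n) x₀ p)).compContinuousLinearMap
      (coordEquiv (n := n) x₀ p : TangentSpace (𝓡 n) p →L[ℝ] Model n) else 0

theorem inChart_ofChart (s : ℤˣ) {k : ℕ} (x₀ : M) (α : Model n → Model n [⋀^Fin k]→L[ℝ] ℝ)
    {y : Model n} (hy : y ∈ (chartAt (Model n) x₀).target) :
    inChart (ofChart s x₀ α) x₀ y = α y := by
  have hp := (chartAt (Model n) x₀).map_target hy
  have h := inChart_chart (ofChart s x₀ α) hp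
  rw [(chartAt (Model n) x₀).right_inv hy] at h
  rw [h, ofChart, signedForm_apply_self, if_pos hp, (chartAt (Model n) x₀).right_inv hy]
  ext v
  simp [Function.comp_def]

theorem ofChart_apply_eq_zero (s : ℤˣ) {k : ℕ} (x₀ : M)
    (α : Model n → Model n [⋀^Fin k]→L[ℝ] ℝ) {p : M}
    (hp : p ∉ (chartAt (Model n) x₀).symm '' tsupport α) :
    (ofChart s x₀ α).1 p = 0 := by
  apply signedForm_apply_eq_zero
  split_ifs with h
  · have : chartAt (Model n) x₀ p ∉ tsupport α := fun h' =>
      hp ⟨_, h', (chartAt (Model n) x₀).left_inv h⟩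
    rw [image_eq_zero_of_notMem_tsupport this]
    ext v
    simp
  · rfl

/-- Transport of smoothness at a point from one chart to another. -/
theorem contDiffAt_inChart_of_chart {s : ℤˣ} {k : ℕ} (w : Form n M s k) {x₀ x₁ p : M}
    (h₀ : p ∈ (chartAt (Model n) x₀).source) (h₁ : p ∈ (chartAt (Model n) x₁).source)
    (hw : ContDiffAt ℝ ∞ (inChart w x₁) (chartAt (Model n) x₁ p)) :
    ContDiffAt ℝ ∞ (inChart w x₀) (chartAt (Model n) x₀ p) := by
  have ht := contDiffAt_transition (n := n) h₀ h₁
  have hT : (chartAt (Model n) x₁ ∘ (chartAt (Model n) x₀).symm) (chartAt (Model n) x₀ p) =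
      chartAt (Model n) x₁ p := by
    simp [(chartAt (Model n) x₀).left_inv h₀]
  have h1 : ContDiffAt ℝ ∞ (fun y => inChart w x₁
      ((chartAt (Model n) x₁ ∘ (chartAt (Model n) x₀).symm) y)) (chartAt (Model n) x₀ p) :=
    ContDiffAt.comp (g := inChart w x₁) _ (by rw [hT]; exact hw) ht
  have h2 : ContDiffAt ℝ ∞ (fderiv ℝ (chartAt (Model n) x₁ ∘ (chartAt (Model n) x₀).symm))
      (chartAt (Model n) x₀ p) := ht.fderiv_right (m := ∞) (by simp)
  refine ContDiffAt.congr_of_eventuallyEq ?_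
    ((eventually_inChart_transition s h₀ h₁).mono fun y hy => hy k w)
  exact (contDiffAt_compContinuousLinearMap h1 h2).const_smul _

theorem isTestForm_ofChart [T2Space M] (s : ℤˣ) {k : ℕ} (x₀ : M)
    {α : Model n → Model n [⋀^Fin k]→L[ℝ] ℝ} (hα : ContDiff ℝ ∞ α) (hc : HasCompactSupport α)
    (ht : tsupport α ⊆ (chartAt (Model n) x₀).target) : IsTestForm (ofChart s x₀ α) := by
  have hC : IsCompact ((chartAt (Model n) x₀).symm '' tsupport α) :=
    hc.isCompact.image_of_continuousOn ((chartAt (Model n) x₀).continuousOn_symm.mono ht)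
  refine ⟨fun x₁ y hy => ContDiffAt.contDiffWithinAt ?_, _, hC,
    fun p hp => ofChart_apply_eq_zero s x₀ α hp⟩
  set p := (chartAt (Model n) x₁).symm y
  have hp : p ∈ (chartAt (Model n) x₁).source := (chartAt (Model n) x₁).map_target hy
  have hyp : chartAt (Model n) x₁ p = y := (chartAt (Model n) x₁).right_inv hy
  by_cases h : p ∈ (chartAt (Model n) x₀).source
  · rw [← hyp]
    refine contDiffAt_inChart_of_chart _ hp h ?_
    refine hα.contDiffAt.congr_of_eventuallyEq ?_
    filter_upwards [(chartAt (Model n) x₀).open_target.mem_nhds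
      ((chartAt (Model n) x₀).map_source h)] with z hz
    exact inChart_ofChart s x₀ α hz
  -- Outside the domain of the first chart the form vanishes near `p`, because its support is
  -- compact, hence closed in the Hausdorff space `M`.
  · have hpC : p ∉ (chartAt (Model n) x₀).symm '' tsupport α := by
      rintro ⟨z, hz, hzp⟩
      exact h (hzp ▸ (chartAt (Model n) x₀).map_target (ht hz))
    have hev : ∀ᶠ z in 𝓝 y, inChart (ofChart s x₀ α) x₁ z = 0 := by
      have : ∀ᶠ z in 𝓝 y, (chartAt (Model n) x₁).symm z ∉
          (chartAt (Model n) x₀).symm '' tsupport α :=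
        (chartAt (Model n) x₁).continuousAt_symm hy (hC.isClosed.isOpen_compl.mem_nhds hpC)
      filter_upwards [this] with z hz
      rw [inChart_congr (η := 0) (ofChart_apply_eq_zero s x₀ α hz), inChart_zero]
    exact contDiffAt_const.congr_of_eventuallyEq hev

/-- Smooth forms. -/
def IsSmooth {s : ℤˣ} {k : ℕ} (w : Form n M s k) : Prop :=
  ∀ x₀ : M, ContDiffOn ℝ ∞ (inChart w x₀) (chartAt (Model n) x₀).target

theorem IsSmooth.contDiffAt {s : ℤˣ} {k : ℕ} {w : Form n M s k} (hw : IsSmooth w) (x₀ : M)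
    {y : Model n} (hy : y ∈ (chartAt (Model n) x₀).target) : ContDiffAt ℝ ∞ (inChart w x₀) y :=
  (hw x₀).contDiffAt ((chartAt (Model n) x₀).open_target.mem_nhds hy)

/-- The classical exterior derivative, computed at each point in the preferred chart. -/
def smoothD {s : ℤˣ} {k : ℕ} (w : Form n M s k) : Form n M s (k + 1) :=
  signedForm s (fun p => coordOrientation p p) fun p =>
    (extDeriv (inChart w p) (chartAt (Model n) p p)).compContinuousLinearMap
      (coordEquiv (n := n) p p : TangentSpace (𝓡 n) p →L[ℝ] Model n)

/-- Naturality of `d` under pullback, combined with the local constancy of the orientation sign. It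
makes the classical derivative independent of the chart for twisted forms as well. -/
theorem extDeriv_inChart_transition {s : ℤˣ} {k : ℕ} {w : Form n M s k} (hw : IsSmooth w)
    {x₀ x₁ p : M} (h₀ : p ∈ (chartAt (Model n) x₀).source)
    (h₁ : p ∈ (chartAt (Model n) x₁).source) :
    extDeriv (inChart w x₀) (chartAt (Model n) x₀ p) =
      transSign s (transD (n := n) x₀ x₁ p : Model n →L[ℝ] Model n).det •
        (extDeriv (inChart w x₁) (chartAt (Model n) x₁ p)).compContinuousLinearMap
          (transD (n := n) x₀ x₁ p : Model n →L[ℝ] Model n) := by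
  have ht := contDiffAt_transition (n := n) h₀ h₁
  have hT : (chartAt (Model n) x₁ ∘ (chartAt (Model n) x₀).symm) (chartAt (Model n) x₀ p) =
      chartAt (Model n) x₁ p := by
    simp [(chartAt (Model n) x₀).left_inv h₀]
  have hev := (eventually_inChart_transition s h₀ h₁).mono fun y hy => hy k w
  have hd := hw.contDiffAt x₁ ((chartAt (Model n) x₁).map_source h₁)
  rw [Filter.EventuallyEq.extDeriv_eq hev]
  have h1 := extDeriv_pullback (r := ∞)
    (by rw [hT]; exact hd.differentiableAt (by simp)) ht (by simp; norm_cast)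
  rw [(hasFDerivAt_transition h₀ h₁).fderiv, hT] at h1
  rw [← h1]
  exact extDeriv_smul _ _

/-- `smoothD` is defined at `p` through the chart centred at `p`; since the derivative obeys the
transformation law of forms, every other chart gives the same value. -/
theorem inChart_smoothD {s : ℤˣ} {k : ℕ} {w : Form n M s k} (hw : IsSmooth w) (x₀ : M)
    {y : Model n} (hy : y ∈ (chartAt (Model n) x₀).target) :
    inChart (smoothD w) x₀ y = extDeriv (inChart w x₀) y := by
  set p := (chartAt (Model n) x₀).symm y
  have hp : p ∈ (chartAt (Model n) x₀).source := (chartAt (Model n) x₀).map_target hy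
  have hyp : chartAt (Model n) x₀ p = y := (chartAt (Model n) x₀).right_inv hy
  have hpp : p ∈ (chartAt (Model n) p).source := mem_chart_source _ p
  rw [← hyp, inChart_transition _ hp hpp, extDeriv_inChart_transition hw hp hpp,
    inChart_chart _ hpp, smoothD, signedForm_apply_self]
  congr 2
  ext v
  simp [Function.comp_def]

theorem IsSmooth.smoothD {s : ℤˣ} {k : ℕ} {w : Form n M s k} (hw : IsSmooth w) :
    IsSmooth (smoothD w) := by
  intro x₀ y hy
  refine ContDiffAt.contDiffWithinAt ?_
  refine (contDiffAt_extDeriv (hw.contDiffAt x₀ hy)).congr_of_eventuallyEq ?_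
  filter_upwards [(chartAt (Model n) x₀).open_target.mem_nhds hy] with z hz
  exact inChart_smoothD hw x₀ hz

theorem smoothD_apply_eq_zero [T2Space M] {s : ℤˣ} {k : ℕ} {φ : Form n M s k} {K : Set M} (hK : IsCompact K)
    (h0 : ∀ x ∉ K, φ.1 x = 0) {x : M} (hx : x ∉ K) : (smoothD φ).1 x = 0 := by
  refine signedForm_apply_eq_zero _ _ _ _ ?_
  have hpp := mem_chart_source (Model n) x
  have hy := (chartAt (Model n) x).map_source hpp
  have hev : inChart φ x =ᶠ[𝓝 (chartAt (Model n) x x)] fun _ => 0 := by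
    have : ∀ᶠ z in 𝓝 (chartAt (Model n) x x), (chartAt (Model n) x).symm z ∉ K := by
      refine (chartAt (Model n) x).continuousAt_symm hy (hK.isClosed.isOpen_compl.mem_nhds ?_)
      rwa [(chartAt (Model n) x).left_inv hpp]
    filter_upwards [this] with z hz
    rw [inChart_congr (η := 0) (h0 _ hz), inChart_zero]
  rw [hev.extDeriv_eq]
  have : extDeriv (fun _ : Model n => (0 : Model n [⋀^Fin k]→L[ℝ] ℝ)) (chartAt (Model n) x x) = 0 := by
    rw [extDeriv, fderiv_const_apply]
    exact map_zero (ContinuousAlternatingMap.alternatizeUncurryFinCLM ℝ (Model n) ℝ)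
  rw [this]
  rfl

theorem IsTestForm.smoothD [T2Space M] {s : ℤˣ} {k : ℕ} {w : Form n M s k} (hw : IsTestForm w) :
    IsTestForm (smoothD w) := by
  obtain ⟨hs, C, hC, h0⟩ := hw
  exact ⟨IsSmooth.smoothD hs, C, hC, fun _ hp => smoothD_apply_eq_zero hC h0 hp⟩

theorem smoothD_smoothD {s : ℤˣ} {k : ℕ} {w : Form n M s k} (hw : IsSmooth w) (x₀ : M)
    {y : Model n} (hy : y ∈ (chartAt (Model n) x₀).target) :
    inChart (DoubleDeRham.smoothD (DoubleDeRham.smoothD w)) x₀ y = 0 := by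
  rw [inChart_smoothD hw.smoothD x₀ hy]
  have : inChart (DoubleDeRham.smoothD w) x₀ =ᶠ[𝓝 y] extDeriv (inChart w x₀) := by
    filter_upwards [(chartAt (Model n) x₀).open_target.mem_nhds hy] with z hz
    exact inChart_smoothD hw x₀ hz
  rw [this.extDeriv_eq]
  exact extDeriv_extDeriv_apply (hw.contDiffAt x₀ hy) (by simp; norm_cast)

end Smooth

/-! ### The Riemannian volume in charts -/

section Volume

variable {n : ℕ} {M : Type*} [TopologicalSpace M] [ChartedSpace (Model n) M]
  [IsManifold (𝓡 n) ∞ M] [RiemannianBundle (fun x : M => TangentSpace (𝓡 n) x)]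

theorem isContinuousRiemannianBundle_of_smooth
    [h : IsContMDiffRiemannianBundle (𝓡 n) ∞ (Model n) (fun x : M => TangentSpace (𝓡 n) x)] :
    IsContinuousRiemannianBundle (Model n) (fun x : M => TangentSpace (𝓡 n) x) := by
  obtain ⟨g, hg, hg'⟩ := h.exists_contMDiff
  exact ⟨g, hg.continuous, hg'⟩

/-- The coordinate frame of a chart. -/
def coordBasis (x₀ p : M) : Basis (Fin n) ℝ (TangentSpace (𝓡 n) p) :=
  (EuclideanSpace.basisFun (Fin n) ℝ).toBasis.map (coordEquiv (n := n) x₀ p).symm.toLinearEquiv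

omit [RiemannianBundle (fun x : M => TangentSpace (𝓡 n) x)] in
theorem coordBasis_apply (x₀ p : M) (i : Fin n) :
    coordBasis (n := n) x₀ p i = (coordEquiv (n := n) x₀ p).symm (EuclideanSpace.single i 1) := by
  simp [coordBasis]

/-- The density of the volume measure with respect to the coordinates. -/
def volDensity (x₀ p : M) : ℝ := |(frame (n := n) p).toBasis.det (coordBasis x₀ p)|

theorem volDensity_pos (x₀ p : M) : 0 < volDensity (n := n) x₀ p :=
  abs_pos.2 ((frame (n := n) p).toBasis.isUnit_det (coordBasis x₀ p)).ne_zero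

/-- The Gram matrix is `AᵀA`, where `A` expresses the coordinate frame in an orthonormal frame, so
the root of its determinant is `|det A|`. -/
theorem sqrt_det_gram (x₀ : M) (y : Model n) :
    Real.sqrt (gram x₀ y).det = volDensity (n := n) x₀ ((chartAt (Model n) x₀).symm y) := by
  set p := (chartAt (Model n) x₀).symm y
  have : gram x₀ y = ((frame (n := n) p).toBasis.toMatrix (coordBasis x₀ p)).transpose *
      ((frame (n := n) p).toBasis.toMatrix (coordBasis x₀ p)) := by
    ext i j
    rw [Matrix.mul_apply]
    have h1 := (frame (n := n) p).sum_inner_mul_inner (coordBasis x₀ p i) (coordBasis x₀ p j)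
    simp only [gram, Matrix.of_apply, Matrix.transpose_apply, Basis.toMatrix_apply]
    rw [← coordBasis_apply, ← coordBasis_apply, ← h1]
    refine Finset.sum_congr rfl fun l _ => ?_
    rw [real_inner_comm]
    simp [OrthonormalBasis.repr_apply_apply]
  rw [this, Matrix.det_mul, Matrix.det_transpose, ← Basis.det_apply, Real.sqrt_mul_self_eq_abs]
  rfl

/-- The endomorphism `F` of the tangent space takes the coordinate frame of `x₁` to that of `x₀`. It
is conjugate to the Jacobian and so has the same determinant. -/
theorem volDensity_transition (x₀ x₁ p : M) :
    volDensity (n := n) x₀ p =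
      |(transD (n := n) x₀ x₁ p : Model n →L[ℝ] Model n).det| * volDensity (n := n) x₁ p := by
  set F : TangentSpace (𝓡 n) p →ₗ[ℝ] TangentSpace (𝓡 n) p :=
    ((coordEquiv (n := n) x₁ p).symm.toLinearEquiv : Model n →ₗ[ℝ] TangentSpace (𝓡 n) p) ∘ₗ
      ((transD (n := n) x₀ x₁ p).toLinearEquiv : Model n →ₗ[ℝ] Model n) ∘ₗ
      ((coordEquiv (n := n) x₁ p).symm.toLinearEquiv.symm : TangentSpace (𝓡 n) p →ₗ[ℝ] Model n)
    with hF
  have hdet : LinearMap.det F = (transD (n := n) x₀ x₁ p : Model n →L[ℝ] Model n).det :=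
    LinearMap.det_conj _ (coordEquiv (n := n) x₁ p).symm.toLinearEquiv
  have hc : (coordBasis (n := n) x₀ p : Fin n → TangentSpace (𝓡 n) p) =
      F ∘ coordBasis (n := n) x₁ p := by
    funext i
    simp [hF, coordBasis, transD]
  rw [volDensity, hc, Basis.det_comp, abs_mul, hdet]
  rfl

variable [MeasurableSpace M] [BorelSpace M]
  [IsContinuousRiemannianBundle (Model n) (fun x : M => TangentSpace (𝓡 n) x)]

omit [MeasurableSpace M] [BorelSpace M] in
theorem continuousOn_inner_coordEquiv_symm (x₀ : M) (u v : Model n) :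
    ContinuousOn (fun y => inner ℝ
      ((coordEquiv (n := n) x₀ ((chartAt (Model n) x₀).symm y)).symm u)
      ((coordEquiv (n := n) x₀ ((chartAt (Model n) x₀).symm y)).symm v))
      (chartAt (Model n) x₀).target := by
  have key : ∀ u : Model n, ContinuousOn (fun y => (⟨(chartAt (Model n) x₀).symm y,
      (coordEquiv (n := n) x₀ ((chartAt (Model n) x₀).symm y)).symm u⟩ :
        TotalSpace (Model n) (fun x : M => TangentSpace (𝓡 n) x))) (chartAt (Model n) x₀).target := by
    intro u
    set e := trivializationAt (Model n) (TangentSpace (𝓡 n) : M → Type) x₀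
    have h1 := e.continuousOn_symm
    have h2 : ContinuousOn (fun y => ((chartAt (Model n) x₀).symm y, u))
        (chartAt (Model n) x₀).target :=
      (chartAt (Model n) x₀).continuousOn_symm.prodMk continuousOn_const
    have hm : Set.MapsTo (fun y => ((chartAt (Model n) x₀).symm y, u))
        (chartAt (Model n) x₀).target (e.baseSet ×ˢ Set.univ) := fun y hy =>
      ⟨(chartAt (Model n) x₀).map_target hy, Set.mem_univ _⟩
    refine (h1.comp h2 hm).congr fun y hy => ?_
    have hp := (chartAt (Model n) x₀).map_target hy
    rw [coordEquiv_eq hp]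
    rfl
  exact (key u).inner_bundle (key v)

omit [MeasurableSpace M] [BorelSpace M] in
theorem continuousOn_volDensity (x₀ : M) :
    ContinuousOn (fun y => volDensity (n := n) x₀ ((chartAt (Model n) x₀).symm y))
      (chartAt (Model n) x₀).target := by
  simp only [← sqrt_det_gram]
  refine Real.continuous_sqrt.comp_continuousOn ?_
  have : ContinuousOn (fun y => gram (n := n) x₀ y) (chartAt (Model n) x₀).target := by
    refine continuousOn_pi.2 fun i => continuousOn_pi.2 fun j => ?_
    exact continuousOn_inner_coordEquiv_symm x₀ _ _
  exact (continuous_id.matrix_det).comp_continuousOn this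

/-- The measure `√(det g) dy¹ ⋯ dyⁿ` carried by the domain of a chart. -/
def chartVol (x₀ : M) : Measure M :=
  Measure.map (chartAt (Model n) x₀).symm
    ((volume.restrict (chartAt (Model n) x₀).target).withDensity
      fun y => ENNReal.ofReal (volDensity (n := n) x₀ ((chartAt (Model n) x₀).symm y)))

omit [BorelSpace M] [IsContinuousRiemannianBundle (Model n) (fun x : M => TangentSpace (𝓡 n) x)] in
theorem vol_eq_iSup : vol n M = ⨆ x₀ : M, chartVol (n := n) x₀ := by
  simp only [vol, chartVol, sqrt_det_gram]

omit [MeasurableSpace M] [BorelSpace M] in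
theorem aemeasurable_volDensity (x₀ : M) :
    AEMeasurable (fun y => ENNReal.ofReal (volDensity (n := n) x₀ ((chartAt (Model n) x₀).symm y)))
      (volume.restrict (chartAt (Model n) x₀).target) :=
  ((continuousOn_volDensity x₀).aemeasurable
    (chartAt (Model n) x₀).open_target.measurableSet).ennreal_ofReal

omit [IsContinuousRiemannianBundle (Model n) (fun x : M => TangentSpace (𝓡 n) x)] in
theorem aemeasurable_chart_symm (x₀ : M) :
    AEMeasurable (chartAt (Model n) x₀).symm
      ((volume.restrict (chartAt (Model n) x₀).target).withDensity
      fun y => ENNReal.ofReal (volDensity (n := n) x₀ ((chartAt (Model n) x₀).symm y))) :=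
  ((chartAt (Model n) x₀).continuousOn_symm.aemeasurable
    (chartAt (Model n) x₀).open_target.measurableSet).mono_ac (withDensity_absolutelyContinuous _ _)

omit [IsManifold (𝓡 n) ∞ M] [RiemannianBundle (fun x : M => TangentSpace (𝓡 n) x)]
  [IsContinuousRiemannianBundle (Model n) (fun x : M => TangentSpace (𝓡 n) x)] in
theorem measurableSet_target_inter_preimage (x₀ : M) {A : Set M} (hA : MeasurableSet A) :
    MeasurableSet ((chartAt (Model n) x₀).target ∩ (chartAt (Model n) x₀).symm ⁻¹' A) := by
  have h1 : Measurable ((chartAt (Model n) x₀).target.domRestrict (chartAt (Model n) x₀).symm) :=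
    (continuousOn_iff_continuous_domRestrict.1 (chartAt (Model n) x₀).continuousOn_symm).measurable
  have h2 := (chartAt (Model n) x₀).open_target.measurableSet.subtype_image (h1 hA)
  convert h2 using 1
  ext y
  simp [Set.domRestrict, and_comm]

omit [IsContinuousRiemannianBundle (Model n) (fun x : M => TangentSpace (𝓡 n) x)] in
theorem chartVol_apply (x₀ : M) {A : Set M} (hA : MeasurableSet A) :
    chartVol (n := n) x₀ A =
      ∫⁻ y in (chartAt (Model n) x₀).target ∩ (chartAt (Model n) x₀).symm ⁻¹' A,
        ENNReal.ofReal (volDensity (n := n) x₀ ((chartAt (Model n) x₀).symm y)) := by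
  have hm := measurableSet_target_inter_preimage (n := n) x₀ hA
  have ht := (chartAt (Model n) x₀).open_target.measurableSet
  rw [chartVol, Measure.map_apply_of_aemeasurable (aemeasurable_chart_symm x₀) hA]
  have : ((volume.restrict (chartAt (Model n) x₀).target).withDensity
      fun y => ENNReal.ofReal (volDensity (n := n) x₀ ((chartAt (Model n) x₀).symm y)))
        ((chartAt (Model n) x₀).symm ⁻¹' A) =
      ((volume.restrict (chartAt (Model n) x₀).target).withDensity
      fun y => ENNReal.ofReal (volDensity (n := n) x₀ ((chartAt (Model n) x₀).symm y)))
        ((chartAt (Model n) x₀).target ∩ (chartAt (Model n) x₀).symm ⁻¹' A) := by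
    refine (measure_inter_conull' ?_).symm.trans (congrArg _ (Set.inter_comm _ _))
    refine withDensity_absolutelyContinuous _ _ ?_
    exact measure_mono_null (Set.sdiff_subset_compl _ _)
      (by rw [Measure.restrict_apply ht.compl]; simp)
  rw [this, withDensity_apply _ hm, Measure.restrict_restrict hm,
    Set.inter_eq_left.2 Set.inter_subset_left]

omit [IsContinuousRiemannianBundle (Model n) (fun x : M => TangentSpace (𝓡 n) x)] in
theorem chartVol_compl_source (x₀ : M) :
    chartVol (n := n) x₀ (chartAt (Model n) x₀).sourceᶜ = 0 := by
  rw [chartVol_apply x₀ (chartAt (Model n) x₀).open_source.measurableSet.compl]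
  have : (chartAt (Model n) x₀).target ∩
      (chartAt (Model n) x₀).symm ⁻¹' (chartAt (Model n) x₀).sourceᶜ = ∅ := by
    ext y
    simp only [Set.mem_inter_iff, Set.mem_preimage, Set.mem_compl_iff, Set.mem_empty_iff_false,
      iff_false, not_and, not_not]
    exact fun hy => (chartAt (Model n) x₀).map_target hy
  rw [this, Measure.restrict_empty, lintegral_zero_measure]

omit [IsContinuousRiemannianBundle (Model n) (fun x : M => TangentSpace (𝓡 n) x)] in
/-- The measures defined by two charts agree on the overlap. -/
theorem chartVol_eq_of_subset {x₀ x₁ : M} {A : Set M} (hA : MeasurableSet A)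
    (h₀ : A ⊆ (chartAt (Model n) x₀).source) (h₁ : A ⊆ (chartAt (Model n) x₁).source) :
    chartVol (n := n) x₀ A = chartVol (n := n) x₁ A := by
  rw [chartVol_apply x₀ hA, chartVol_apply x₁ hA]
  set S := (chartAt (Model n) x₀).target ∩ (chartAt (Model n) x₀).symm ⁻¹' A with hS
  set T := chartAt (Model n) x₁ ∘ (chartAt (Model n) x₀).symm with hT
  have himg : (chartAt (Model n) x₁).target ∩ (chartAt (Model n) x₁).symm ⁻¹' A = T '' S := by
    ext z
    constructor
    · rintro ⟨hz, hzA⟩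
      refine ⟨chartAt (Model n) x₀ ((chartAt (Model n) x₁).symm z),
        ⟨(chartAt (Model n) x₀).map_source (h₀ hzA), ?_⟩, ?_⟩
      · simpa [(chartAt (Model n) x₀).left_inv (h₀ hzA)] using hzA
      · simp [hT, (chartAt (Model n) x₀).left_inv (h₀ hzA), (chartAt (Model n) x₁).right_inv hz]
    · rintro ⟨y, ⟨hy, hyA⟩, rfl⟩
      refine ⟨(chartAt (Model n) x₁).map_source (h₁ hyA), ?_⟩
      simpa [hT, (chartAt (Model n) x₁).left_inv (h₁ hyA)] using hyA
  have hinj : Set.InjOn T S := by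
    rintro y ⟨hy, hyA⟩ z ⟨hz, hzA⟩ hyz
    exact (chartAt (Model n) x₀).symm.injOn hy hz
      ((chartAt (Model n) x₁).injOn (h₁ hyA) (h₁ hzA) hyz)
  have hder : ∀ y ∈ S, HasFDerivWithinAt T
      (transD (n := n) x₀ x₁ ((chartAt (Model n) x₀).symm y) : Model n →L[ℝ] Model n) S y := by
    rintro y ⟨hy, hyA⟩
    have := hasFDerivAt_transition (h₀ hyA) (h₁ hyA)
    rw [(chartAt (Model n) x₀).right_inv hy] at this
    exact this.hasFDerivWithinAt
  have hSm : MeasurableSet S := measurableSet_target_inter_preimage x₀ hA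
  -- Change of variables along the transition map; its Jacobian is absorbed by the transformation
  -- law of the density.
  rw [himg, lintegral_image_eq_lintegral_abs_det_fderiv_mul volume hSm hder hinj]
  refine setLIntegral_congr_fun hSm fun y hy => ?_
  have hp : (chartAt (Model n) x₁).symm (T y) = (chartAt (Model n) x₀).symm y :=
    (chartAt (Model n) x₁).left_inv (h₁ hy.2)
  simp only [hp]
  rw [← ENNReal.ofReal_mul (abs_nonneg _), ← volDensity_transition]

omit [IsContinuousRiemannianBundle (Model n) (fun x : M => TangentSpace (𝓡 n) x)] in
/-- On the domain of a chart, the volume is the measure defined by that chart. -/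
theorem vol_restrict_source (x₀ : M) :
    (vol n M).restrict (chartAt (Model n) x₀).source = chartVol (n := n) x₀ := by
  set U := (chartAt (Model n) x₀).source with hU
  have hUm : MeasurableSet U := (chartAt (Model n) x₀).open_source.measurableSet
  have hres : (chartVol (n := n) x₀).restrict U = chartVol (n := n) x₀ :=
    Measure.restrict_eq_self_of_ae_mem (by
      rw [ae_iff]; exact chartVol_compl_source x₀)
  have hle : ∀ x₁ : M, chartVol (n := n) x₁ ≤ vol n M := fun x₁ => by
    rw [vol_eq_iSup]; exact le_iSup (fun x₀ : M => chartVol (n := n) x₀) x₁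
  apply le_antisymm
  -- The right side dominates every `chartVol x₁`: inside `U` by agreement on overlaps, outside `U`
  -- trivially. Hence it dominates the supremum, and restriction to `U` removes the second term.
  · have hub : vol n M ≤ chartVol (n := n) x₀ + (vol n M).restrict Uᶜ := by
      conv_lhs => rw [vol_eq_iSup]
      refine iSup_le fun x₁ => Measure.le_iff.2 fun A hA => ?_
      set U₁ := (chartAt (Model n) x₁).source
      have hU₁m : MeasurableSet U₁ := (chartAt (Model n) x₁).open_source.measurableSet
      rw [Measure.add_apply, ← measure_inter_add_sdiff A hUm]
      gcongr ?_ + ?_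
      · calc chartVol (n := n) x₁ (A ∩ U)
            ≤ chartVol (n := n) x₁ (A ∩ U ∩ U₁) + chartVol (n := n) x₁ U₁ᶜ :=
              (measure_mono (by intro x hx; by_cases h : x ∈ U₁ <;> simp_all)).trans
                (measure_union_le _ _)
          _ = chartVol (n := n) x₀ (A ∩ U ∩ U₁) := by
              rw [chartVol_compl_source, add_zero]
              exact chartVol_eq_of_subset ((hA.inter hUm).inter hU₁m) Set.inter_subset_right
                (Set.inter_subset_left.trans Set.inter_subset_right)
          _ ≤ chartVol (n := n) x₀ A := measure_mono fun x hx => hx.1.1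
      · rw [Measure.restrict_apply hA]
        exact hle x₁ _
    calc (vol n M).restrict U ≤ (chartVol (n := n) x₀ + (vol n M).restrict Uᶜ).restrict U :=
          Measure.restrict_mono_measure hub U
      _ = chartVol (n := n) x₀ := by
          rw [Measure.restrict_add, hres, Measure.restrict_restrict hUm]
          simp
  · rw [← hres]
    exact Measure.restrict_mono_measure (hle x₀) U

end Volume

/-! ### Transfer of almost everywhere statements and integrals between the manifold and charts -/

section Transfer

variable {n : ℕ} {M : Type*} [TopologicalSpace M] [ChartedSpace (Model n) M]
  [IsManifold (𝓡 n) ∞ M] [RiemannianBundle (fun x : M => TangentSpace (𝓡 n) x)]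
  [MeasurableSpace M] [BorelSpace M]

theorem ae_restrict_source {x₀ : M} {P : M → Prop}
    (h : ∀ᵐ y ∂volume.restrict (chartAt (Model n) x₀).target, P ((chartAt (Model n) x₀).symm y)) :
    ∀ᵐ x ∂(vol n M).restrict (chartAt (Model n) x₀).source, P x := by
  set e := chartAt (Model n) x₀
  rw [ae_restrict_iff' e.open_target.measurableSet, ae_iff] at h
  -- The property `P` is arbitrary, so its exceptional set is enlarged to a measurable null set
  -- before it is carried over to the manifold.
  set N := toMeasurable volume {y | ¬ (y ∈ e.target → P (e.symm y))}
  have hN : volume N = 0 := by rw [measure_toMeasurable]; exact h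
  have hNm : MeasurableSet N := measurableSet_toMeasurable _ _
  have hBm : MeasurableSet (e.source ∩ e ⁻¹' N) := by
    have h1 : Measurable (e.source.domRestrict e) :=
      (continuousOn_iff_continuous_domRestrict.1 e.continuousOn).measurable
    have h2 := e.open_source.measurableSet.subtype_image (h1 hNm)
    convert h2 using 1
    ext y
    simp [Set.domRestrict, and_comm]
  have hB : chartVol (n := n) x₀ (e.source ∩ e ⁻¹' N) = 0 := by
    rw [chartVol_apply x₀ hBm]
    refine setLIntegral_measure_zero _ _ (measure_mono_null ?_ hN)
    rintro y ⟨hy, -, hy'⟩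
    simpa [e, (chartAt (Model n) x₀).right_inv hy] using hy'
  rw [vol_restrict_source, ae_iff]
  refine measure_mono_null (t := (e.source ∩ e ⁻¹' N) ∪ e.sourceᶜ) ?_
    (measure_union_null hB (chartVol_compl_source x₀))
  intro x hx
  by_cases hxs : x ∈ e.source
  · refine Or.inl ⟨hxs, subset_toMeasurable _ _ ?_⟩
    simp only [Set.mem_ofPred_eq, e.left_inv hxs, Classical.not_imp] at hx ⊢
    exact ⟨e.map_source hxs, hx⟩
  · exact Or.inr hxs

/-- The density is strictly positive, so null sets for the volume are also null in coordinates. -/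
theorem ae_chart_of_ae_source
    [IsContinuousRiemannianBundle (Model n) (fun x : M => TangentSpace (𝓡 n) x)]
    {x₀ : M} {P : M → Prop}
    (h : ∀ᵐ x ∂(vol n M).restrict (chartAt (Model n) x₀).source, P x) :
    ∀ᵐ y ∂volume.restrict (chartAt (Model n) x₀).target, P ((chartAt (Model n) x₀).symm y) := by
  rw [vol_restrict_source] at h
  have h1 := ae_of_ae_map (aemeasurable_chart_symm x₀) h
  rw [ae_withDensity_iff' (aemeasurable_volDensity x₀)] at h1
  filter_upwards [h1] with y hy
  exact hy (by simpa using volDensity_pos x₀ _)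

variable (n M) in
omit [IsManifold (𝓡 n) ∞ M] [RiemannianBundle (fun x : M => TangentSpace (𝓡 n) x)]
  [MeasurableSpace M] [BorelSpace M] in
theorem exists_countable_charts [SecondCountableTopology M] :
    ∃ t : Set M, t.Countable ∧ ⋃ x₀ : t, (chartAt (Model n) (x₀ : M)).source = Set.univ := by
  obtain ⟨t, ht, hU⟩ := countable_cover_nhds fun x : M => chart_source_mem_nhds (Model n) x
  exact ⟨t, ht, by rw [← hU, Set.biUnion_eq_iUnion]⟩

theorem ae_of_charts [SecondCountableTopology M] {P : M → Prop}
    (h : ∀ x₀ : M, ∀ᵐ y ∂volume.restrict (chartAt (Model n) x₀).target,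
      P ((chartAt (Model n) x₀).symm y)) :
    ∀ᵐ x ∂vol n M, P x := by
  obtain ⟨t, ht, hU⟩ := exists_countable_charts n M
  have := ht.to_subtype
  rw [← Measure.restrict_univ (μ := vol n M), ← hU, ae_restrict_iUnion_iff]
  exact fun x₀ => ae_restrict_source (h x₀)

/-- On each of countably many chart domains, `f` agrees almost everywhere with a measurable function
of the coordinates. -/
theorem aemeasurable_of_charts [SecondCountableTopology M] {β : Type*} [MeasurableSpace β]
    {f : M → β}
    (h : ∀ x₀ : M, AEMeasurable (fun y => f ((chartAt (Model n) x₀).symm y))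
      (volume.restrict (chartAt (Model n) x₀).target)) :
    AEMeasurable f (vol n M) := by
  obtain ⟨t, ht, hU⟩ := exists_countable_charts n M
  have := ht.to_subtype
  rw [← Measure.restrict_univ (μ := vol n M), ← hU, aemeasurable_iUnion_iff]
  intro x₀
  obtain ⟨g, hg, hfg⟩ := h x₀
  have h1 : AEMeasurable (chartAt (Model n) (x₀ : M))
      ((vol n M).restrict (chartAt (Model n) (x₀ : M)).source) :=
    (chartAt (Model n) (x₀ : M)).continuousOn.aemeasurable
      (chartAt (Model n) (x₀ : M)).open_source.measurableSet
  refine (hg.comp_aemeasurable h1).congr ?_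
  have h2 := ae_restrict_source (x₀ := (x₀ : M))
    (P := fun x : M => f x = g (chartAt (Model n) (x₀ : M) x)) (by
    filter_upwards [hfg, ae_restrict_mem (chartAt (Model n) (x₀ : M)).open_target.measurableSet]
      with y hy hyt
    rw [hy, (chartAt (Model n) (x₀ : M)).right_inv hyt])
  filter_upwards [h2] with x hx
  exact hx.symm

variable [IsContinuousRiemannianBundle (Model n) (fun x : M => TangentSpace (𝓡 n) x)]

theorem setLIntegral_source (x₀ : M) {f : M → ℝ≥0∞} (hf : AEMeasurable f (vol n M)) :
    ∫⁻ x in (chartAt (Model n) x₀).source, f x ∂vol n M =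
      ∫⁻ y in (chartAt (Model n) x₀).target,
        ENNReal.ofReal (volDensity (n := n) x₀ ((chartAt (Model n) x₀).symm y)) *
          f ((chartAt (Model n) x₀).symm y) := by
  have hf' := hf.restrict (s := (chartAt (Model n) x₀).source)
  rw [vol_restrict_source] at hf' ⊢
  rw [chartVol, lintegral_map' hf' (aemeasurable_chart_symm x₀)]
  have hc : AEMeasurable (fun y => f ((chartAt (Model n) x₀).symm y))
      (volume.restrict (chartAt (Model n) x₀).target) := by
    obtain ⟨g, hg, hfg⟩ := hf
    have h1 : AEMeasurable (fun y => g ((chartAt (Model n) x₀).symm y))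
        (volume.restrict (chartAt (Model n) x₀).target) :=
      hg.comp_aemeasurable ((chartAt (Model n) x₀).continuousOn_symm.aemeasurable
        (chartAt (Model n) x₀).open_target.measurableSet)
    exact (h1.congr (by
      filter_upwards [ae_chart_of_ae_source (ae_restrict_of_ae hfg)] with y hy
      exact hy.symm))
  rw [lintegral_withDensity_eq_lintegral_mul₀ (aemeasurable_volDensity x₀) hc]
  rfl

theorem setIntegral_source (x₀ : M) {f : M → ℝ} (hf : AEStronglyMeasurable f (vol n M)) :
    ∫ x in (chartAt (Model n) x₀).source, f x ∂vol n M =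
      ∫ y in (chartAt (Model n) x₀).target,
        volDensity (n := n) x₀ ((chartAt (Model n) x₀).symm y) *
          f ((chartAt (Model n) x₀).symm y) := by
  have hf' := hf.restrict (s := (chartAt (Model n) x₀).source)
  rw [vol_restrict_source] at hf' ⊢
  rw [chartVol, integral_map (aemeasurable_chart_symm x₀) hf',
    integral_withDensity_eq_integral_toReal_smul₀ (aemeasurable_volDensity x₀)
      (Filter.Eventually.of_forall fun _ => ENNReal.ofReal_lt_top)]
  refine integral_congr_ae (Filter.Eventually.of_forall fun y => ?_)
  simp only [smul_eq_mul, ENNReal.toReal_ofReal (volDensity_pos x₀ _).le]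

theorem integrableOn_source_iff (x₀ : M) {f : M → ℝ} (hf : AEStronglyMeasurable f (vol n M)) :
    IntegrableOn f (chartAt (Model n) x₀).source (vol n M) ↔
      IntegrableOn (fun y => volDensity (n := n) x₀ ((chartAt (Model n) x₀).symm y) *
          f ((chartAt (Model n) x₀).symm y)) (chartAt (Model n) x₀).target := by
  have hf' := hf.restrict (s := (chartAt (Model n) x₀).source)
  rw [IntegrableOn, IntegrableOn]
  rw [vol_restrict_source] at hf' ⊢
  rw [chartVol, integrable_map_measure hf' (aemeasurable_chart_symm x₀),
    integrable_withDensity_iff_integrable_smul₀' (aemeasurable_volDensity x₀)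
      (Filter.Eventually.of_forall fun _ => ENNReal.ofReal_lt_top)]
  refine integrable_congr (Filter.Eventually.of_forall fun y => ?_)
  simp only [smul_eq_mul, ENNReal.toReal_ofReal (volDensity_pos x₀ _).le, Function.comp]

end Transfer

/-! ### The integrand of the pairing -/

section Pairing

/-- The wedge product of forms of complementary degrees on `ℝⁿ`, evaluated on the standard basis,
as a continuous bilinear map. -/
def wedgeBilin {n k l : ℕ} (h : k + l = n) :
    (Model n [⋀^Fin k]→L[ℝ] ℝ) →L[ℝ] (Model n [⋀^Fin l]→L[ℝ] ℝ) →L[ℝ] ℝ :=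
  LinearMap.mkContinuous₂ (LinearMap.mk₂ ℝ
    (fun α β => wedge α β fun i => EuclideanSpace.single (Fin.cast h i) (1 : ℝ))
    (fun _ _ _ => wedge_add_left _ _ _ _) (fun _ _ _ => wedge_smul_left _ _ _ _)
    (fun _ _ _ => wedge_add_right _ _ _ _) (fun _ _ _ => wedge_smul_right _ _ _ _))
    n.factorial fun α β => by
      rw [Real.norm_eq_abs, mul_assoc]
      exact abs_wedge_le h α β (fun i => EuclideanSpace.single i (1 : ℝ)) (by simp)

theorem wedgeBilin_apply {n k l : ℕ} (h : k + l = n) (α : Model n [⋀^Fin k]→L[ℝ] ℝ)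
    (β : Model n [⋀^Fin l]→L[ℝ] ℝ) :
    wedgeBilin h α β = wedge α β fun i => EuclideanSpace.single (Fin.cast h i) (1 : ℝ) := rfl

variable {n : ℕ} {M : Type*} [TopologicalSpace M] [ChartedSpace (Model n) M]
  [IsManifold (𝓡 n) ∞ M] [RiemannianBundle (fun x : M => TangentSpace (𝓡 n) x)]

/-- The integrand of the pairing. -/
def pairFun {s t : ℤˣ} {k l : ℕ} (h : k + l = n) (w : Form n M s k) (τ : Form n M t l) (x : M) : ℝ :=
  wedge (w.1 x (frame x).toBasis.orientation) (τ.1 x (frame x).toBasis.orientation)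
    (fun i => frame x (Fin.cast h i))

theorem coordOrientation_eq_orientation (x₀ p : M) :
    coordOrientation (n := n) x₀ p = (coordBasis x₀ p).orientation :=
  (Basis.orientation_map _ _).symm

/-- The integrand of the pairing of forms of opposite parities in coordinates. -/
theorem volDensity_mul_pairFun {s t : ℤˣ} (ht : t = -s) {k l : ℕ} (h : k + l = n)
    (w : Form n M s k) (τ : Form n M t l) {x₀ p : M} (hp : p ∈ (chartAt (Model n) x₀).source) :
    volDensity (n := n) x₀ p * pairFun h w τ p =
      wedgeBilin h (inChart w x₀ (chartAt (Model n) x₀ p))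
        (inChart τ x₀ (chartAt (Model n) x₀ p)) := by
  subst ht
  rw [inChart_chart w hp, inChart_chart τ hp, wedgeBilin_apply, wedge_compContinuousLinearMap]
  have e : (fun i : Fin (k + l) => ((coordEquiv (n := n) x₀ p).symm : Model n →L[ℝ] _)
      (EuclideanSpace.single (Fin.cast h i) (1 : ℝ))) =
      fun i => coordBasis (n := n) x₀ p (Fin.cast h i) :=
    funext fun i => (coordBasis_apply x₀ p _).symm
  rw [e, wedge_basis_change h _ _ (frame (n := n) p).toBasis]
  simp only [OrthonormalBasis.coe_toBasis]
  rw [pairFun, volDensity]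
  have hne := ((frame (n := n) p).toBasis.isUnit_det (coordBasis x₀ p)).ne_zero
  have hor : coordOrientation (n := n) x₀ p = (frame (n := n) p).toBasis.orientation ∨
      coordOrientation (n := n) x₀ p = -(frame (n := n) p).toBasis.orientation :=
    Orientation.eq_or_eq_neg _ _ (card_fin_eq_finrank_tangentSpace p)
  have hiff := (frame (n := n) p).toBasis.orientation_eq_iff_det_pos (coordBasis x₀ p)
  rw [← coordOrientation_eq_orientation] at hiff
  -- If the coordinate frame is negatively oriented relative to the orthonormal one, the two forms
  -- contribute the factor `s * (-s) = -1`, which cancels the sign of the determinant. This is where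
  -- opposite parities enter.
  by_cases hd : 0 < (frame (n := n) p).toBasis.det (coordBasis x₀ p)
  · rw [abs_of_pos hd, ← hiff.2 hd]
  · have h1 := hor.resolve_left fun h' => hd (hiff.1 h'.symm)
    rw [abs_of_neg (lt_of_le_of_ne (not_lt.1 hd) hne), h1, w.2, τ.2, wedge_smul_left,
      wedge_smul_right]
    have hs : ((s : ℤ) : ℝ) * (((-s : ℤˣ) : ℤ) : ℝ) = -1 := by
      rcases Int.units_eq_one_or s with rfl | rfl <;> simp
    rw [← mul_assoc ((s : ℤ) : ℝ), hs]
    ring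

theorem pairFun_comm {s t : ℤˣ} {k l : ℕ} (h : k + l = n) (h' : l + k = n)
    (w : Form n M s k) (τ : Form n M t l) (x : M) :
    pairFun h w τ x = (-1) ^ (k * l) * pairFun h' τ w x :=
  wedge_comm h h' _ _ _

theorem pairing_comm [MeasurableSpace M] {s t : ℤˣ} {k l : ℕ} (h : k + l = n) (h' : l + k = n)
    (w : Form n M s k) (τ : Form n M t l) :
    pairing h w τ = (-1) ^ (k * l) * pairing h' τ w := by
  change ∫ x, pairFun h w τ x ∂vol n M = _ * ∫ x, pairFun h' τ w x ∂vol n M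
  rw [← integral_const_mul]
  simp only [pairFun_comm h h']

theorem abs_pairFun_le {s t : ℤˣ} {k l : ℕ} (h : k + l = n) (w : Form n M s k) (τ : Form n M t l)
    (x : M) : |pairFun h w τ x| ≤ n.factorial * (pointNorm w x * pointNorm τ x) :=
  abs_wedge_le h _ _ _ fun i => ((frame (n := n) x).norm_eq_one i).le

theorem pairFun_smul_left {s t : ℤˣ} {k l : ℕ} (h : k + l = n) (c : ℝ) (w : Form n M s k)
    (τ : Form n M t l) (x : M) : pairFun h (c • w) τ x = c * pairFun h w τ x :=
  wedge_smul_left _ _ _ _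

theorem pairFun_add_right {s t : ℤˣ} {k l : ℕ} (h : k + l = n) (w : Form n M s k)
    (τ σ : Form n M t l) (x : M) : pairFun h w (τ + σ) x = pairFun h w τ x + pairFun h w σ x :=
  wedge_add_right _ _ _ _

theorem pairFun_smul_right {s t : ℤˣ} {k l : ℕ} (h : k + l = n) (c : ℝ) (w : Form n M s k)
    (τ : Form n M t l) (x : M) : pairFun h w (c • τ) x = c * pairFun h w τ x :=
  wedge_smul_right _ _ _ _

end Pairing

/-! ### Square integrable forms -/

section L2

variable {n : ℕ} {M : Type*} [TopologicalSpace M] [ChartedSpace (Model n) M]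
  [IsManifold (𝓡 n) ∞ M] [RiemannianBundle (fun x : M => TangentSpace (𝓡 n) x)]

/-- The norm of an alternating map is the supremum over a dense sequence of families of vectors. -/
theorem enorm_eq_iSup_denseRange {T : Type*} [NormedAddCommGroup T] [NormedSpace ℝ T] {k : ℕ}
    (α : T [⋀^Fin k]→L[ℝ] ℝ) (u : ℕ → Fin k → T) (hu : DenseRange u) :
    ENNReal.ofReal ‖α‖ = ⨆ j : ℕ, ENNReal.ofReal (|α (u j)| / ∏ i, ‖u j i‖) := by
  apply le_antisymm
  · set S := ⨆ j : ℕ, ENNReal.ofReal (|α (u j)| / ∏ i, ‖u j i‖) with hS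
    rcases eq_or_ne S ⊤ with h | h
    · rw [h]; exact le_top
    refine ENNReal.ofReal_le_of_le_toReal ?_
    refine α.opNorm_le_bound ENNReal.toReal_nonneg fun v => ?_
    -- The bound is a closed condition on the arguments, so it passes from the dense sequence to all
    -- of them.
    have hclosed : IsClosed {v : Fin k → T | ‖α v‖ ≤ S.toReal * ∏ i, ‖v i‖} := by
      refine isClosed_le (α.cont.norm) ?_
      fun_prop
    have hsub : Set.range u ⊆ {v : Fin k → T | ‖α v‖ ≤ S.toReal * ∏ i, ‖v i‖} := by
      rintro _ ⟨j, rfl⟩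
      rcases (Finset.prod_nonneg fun i _ => norm_nonneg (u j i) :
        0 ≤ ∏ i, ‖u j i‖).eq_or_lt with h0 | h0
      · obtain ⟨i, -, hi⟩ := Finset.prod_eq_zero_iff.1 h0.symm
        have : α (u j) = 0 := α.map_coord_zero i (norm_eq_zero.1 hi)
        simp [this, ← h0]
      · have h1 : ENNReal.ofReal (|α (u j)| / ∏ i, ‖u j i‖) ≤ S :=
          le_iSup (fun j => ENNReal.ofReal (|α (u j)| / ∏ i, ‖u j i‖)) j
        have h2 := (ENNReal.ofReal_le_iff_le_toReal h).1 h1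
        rwa [div_le_iff₀ h0] at h2
    exact hclosed.closure_subset_iff.2 hsub (hu v)
  · refine iSup_le fun j => ENNReal.ofReal_le_ofReal ?_
    exact div_le_of_le_mul₀ (Finset.prod_nonneg fun i _ => norm_nonneg _) (norm_nonneg _)
      (α.le_opNorm (u j))

theorem norm_smul_alternating {T : Type*} [NormedAddCommGroup T] [NormedSpace ℝ T] {k : ℕ} (c : ℝ)
    (α : T [⋀^Fin k]→L[ℝ] ℝ) : ‖c • α‖ = |c| * ‖α‖ := norm_smul c α

/-- Only the lengths of the images of the coordinate vectors appear in the bound. For the inverse of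
a chart differential these are square roots of diagonal metric coefficients, so they are continuous
in the base point. -/
theorem norm_compContinuousLinearMap_le_sum {T : Type*} [NormedAddCommGroup T] [NormedSpace ℝ T]
    {n k : ℕ} (α : T [⋀^Fin k]→L[ℝ] ℝ) (L : Model n →L[ℝ] T) :
    ‖α.compContinuousLinearMap L‖ ≤ ‖α‖ * (∑ i, ‖L (EuclideanSpace.single i 1)‖) ^ k := by
  refine ContinuousAlternatingMap.opNorm_le_bound _ (by positivity) fun v => ?_
  have h1 : ∀ v : Model n, ‖L v‖ ≤ (∑ i, ‖L (EuclideanSpace.single i 1)‖) * ‖v‖ := by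
    intro v
    have hv : v = ∑ i, v i • EuclideanSpace.single i (1 : ℝ) := by
      conv_lhs => rw [← (EuclideanSpace.basisFun (Fin n) ℝ).sum_repr v]
      simp
    calc ‖L v‖ = ‖∑ i, v i • L (EuclideanSpace.single i 1)‖ := by
          conv_lhs => rw [hv]
          simp [map_sum]
      _ ≤ ∑ i, ‖v i • L (EuclideanSpace.single i 1)‖ := norm_sum_le _ _
      _ ≤ ∑ i, ‖L (EuclideanSpace.single i 1)‖ * ‖v‖ := by
          refine Finset.sum_le_sum fun i _ => ?_
          rw [norm_smul, mul_comm]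
          gcongr
          exact PiLp.norm_apply_le v i
      _ = _ := by rw [Finset.sum_mul]
  calc ‖α.compContinuousLinearMap L v‖ ≤ ‖α‖ * ∏ i, ‖L (v i)‖ := α.le_opNorm _
    _ ≤ ‖α‖ * ∏ i, ((∑ i, ‖L (EuclideanSpace.single i 1)‖) * ‖v i‖) := by
        gcongr with i
        exact h1 _
    _ = _ := by
        rw [Finset.prod_mul_distrib, Finset.prod_const, Finset.card_univ, Fintype.card_fin, mul_assoc]

theorem norm_nonneg_alternating {T : Type*} [NormedAddCommGroup T] [NormedSpace ℝ T] {k : ℕ}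
    (α : T [⋀^Fin k]→L[ℝ] ℝ) : 0 ≤ ‖α‖ := norm_nonneg α

theorem pointNorm_nonneg {s : ℤˣ} {k : ℕ} (w : Form n M s k) (x : M) : 0 ≤ pointNorm w x :=
  norm_nonneg_alternating _

theorem norm_apply_orientation {s : ℤˣ} {k : ℕ} (w : Form n M s k) (x : M)
    (o : Orientation ℝ (TangentSpace (𝓡 n) x) (Fin n)) : ‖w.1 x o‖ = pointNorm w x := by
  rcases Orientation.eq_or_eq_neg o (frame (n := n) x).toBasis.orientation
    (card_fin_eq_finrank_tangentSpace x) with rfl | rfl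
  · rfl
  · rw [w.2]
    refine (norm_smul_alternating _ _).trans ?_
    rcases Int.units_eq_one_or s with rfl | rfl <;> simp [pointNorm]

/-- Measurability of the coordinate expressions. -/
def ChartMeasurable {s : ℤˣ} {k : ℕ} (w : Form n M s k) : Prop :=
  ∀ x₀ : M, AEStronglyMeasurable (inChart w x₀) (volume.restrict (chartAt (Model n) x₀).target)

theorem ChartMeasurable.sub {s : ℤˣ} {k : ℕ} {w η : Form n M s k} (hw : ChartMeasurable w)
    (hη : ChartMeasurable η) : ChartMeasurable (w - η) := fun x₀ => (hw x₀).sub (hη x₀)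

theorem ChartMeasurable.smul {s : ℤˣ} {k : ℕ} {w : Form n M s k} (hw : ChartMeasurable w) (c : ℝ) :
    ChartMeasurable (c • w) := fun x₀ => (hw x₀).const_smul c

variable [MeasurableSpace M] [BorelSpace M]
  [IsContinuousRiemannianBundle (Model n) (fun x : M => TangentSpace (𝓡 n) x)]

/-- The orthonormal frames are chosen pointwise without any regularity. The norm is therefore
written as a countable supremum of quotients of coordinate values by lengths of coordinate vectors,
and each of these is measurable. -/
theorem aemeasurable_pointNorm [SecondCountableTopology M] {s : ℤˣ} {k : ℕ} {w : Form n M s k}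
    (hw : ChartMeasurable w) : AEMeasurable (fun x => ENNReal.ofReal (pointNorm w x)) (vol n M) := by
  refine aemeasurable_of_charts fun x₀ => ?_
  set e := chartAt (Model n) x₀
  let u : ℕ → Fin k → Model n := TopologicalSpace.denseSeq (Fin k → Model n)
  have key : ∀ y ∈ e.target, ENNReal.ofReal (pointNorm w (e.symm y)) =
      ⨆ j : ℕ, ENNReal.ofReal (|inChart w x₀ y (u j)| /
        ∏ i, ‖(coordEquiv (n := n) x₀ (e.symm y)).symm (u j i)‖) := by
    intro y hy
    rw [← norm_apply_orientation w _ (coordOrientation x₀ _)]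
    refine enorm_eq_iSup_denseRange _
      (fun j i => (coordEquiv (n := n) x₀ (e.symm y)).symm (u j i)) ?_
    have h1 : DenseRange fun v : Fin k → Model n => fun i =>
        (coordEquiv (n := n) x₀ (e.symm y)).symm (v i) := by
      refine Function.Surjective.denseRange fun v =>
        ⟨fun i => coordEquiv (n := n) x₀ (e.symm y) (v i), ?_⟩
      simp
    refine h1.comp (TopologicalSpace.denseRange_denseSeq _) ?_
    fun_prop
  have hm : AEMeasurable (fun y => ⨆ j : ℕ, ENNReal.ofReal (|inChart w x₀ y (u j)| /
        ∏ i, ‖(coordEquiv (n := n) x₀ (e.symm y)).symm (u j i)‖)) (volume.restrict e.target) := by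
    refine AEMeasurable.iSup fun j => AEMeasurable.ennreal_ofReal ?_
    refine AEMeasurable.div ?_ ?_
    · have h1 : AEStronglyMeasurable (fun y => inChart w x₀ y (u j)) (volume.restrict e.target) :=
        (ContinuousAlternatingMap.apply ℝ (Model n) ℝ (u j)).continuous.comp_aestronglyMeasurable
          (hw x₀)
      exact h1.norm.aemeasurable
    · refine Finset.aemeasurable_fun_prod _ fun i _ => ?_
      have h2 : ContinuousOn (fun y => ‖(coordEquiv (n := n) x₀ (e.symm y)).symm (u j i)‖)
          e.target := by
        have h3 := Real.continuous_sqrt.comp_continuousOn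
          (continuousOn_inner_coordEquiv_symm x₀ (u j i) (u j i))
        refine h3.congr fun y _ => ?_
        simp only [Function.comp]
        exact norm_eq_sqrt_real_inner _
      exact h2.aemeasurable e.open_target.measurableSet
  refine hm.congr ?_
  filter_upwards [ae_restrict_mem e.open_target.measurableSet] with y hy
  exact (key y hy).symm

theorem ae_chart_symm_of_ae {P : M → Prop} (h : ∀ᵐ x ∂vol n M, P x) (x₀ : M) :
    ∀ᵐ y ∂volume.restrict (chartAt (Model n) x₀).target, P ((chartAt (Model n) x₀).symm y) :=
  ae_chart_of_ae_source (ae_restrict_of_ae h)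

theorem AEEq.inChart {s : ℤˣ} {k : ℕ} {w η : Form n M s k} (h : AEEq w η) (x₀ : M) :
    inChart w x₀ =ᵐ[volume.restrict (chartAt (Model n) x₀).target] inChart η x₀ := by
  filter_upwards [ae_chart_symm_of_ae h x₀] with y hy
  exact inChart_congr hy

theorem aeEq_of_inChart [SecondCountableTopology M] {s : ℤˣ} {k : ℕ} {w η : Form n M s k}
    (h : ∀ x₀ : M, DoubleDeRham.inChart w x₀ =ᵐ[volume.restrict (chartAt (Model n) x₀).target]
      DoubleDeRham.inChart η x₀) : AEEq w η := by
  refine ae_of_charts fun x₀ => ?_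
  filter_upwards [h x₀, ae_restrict_mem (chartAt (Model n) x₀).open_target.measurableSet]
    with y hy hyt
  refine eq_of_inChart_eq ((chartAt (Model n) x₀).map_target hyt) ?_
  rwa [(chartAt (Model n) x₀).right_inv hyt]

theorem AEEq.symm {s : ℤˣ} {k : ℕ} {w η : Form n M s k} (h : AEEq w η) : AEEq η w :=
  Filter.Eventually.mono h fun _ hx => hx.symm

theorem AEEq.trans {s : ℤˣ} {k : ℕ} {w η ζ : Form n M s k} (h : AEEq w η) (h' : AEEq η ζ) :
    AEEq w ζ := by
  filter_upwards [h, h'] with x hx hx'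
  exact hx.trans hx'

theorem AEEq.eL2_eq {s : ℤˣ} {k : ℕ} {w η : Form n M s k} (h : AEEq w η) : eL2 w = eL2 η := by
  unfold eL2
  congr 1
  refine lintegral_congr_ae ?_
  filter_upwards [h] with x hx
  simp only [pointNorm, hx]

theorem AEEq.l2Norm_eq {s : ℤˣ} {k : ℕ} {w η : Form n M s k} (h : AEEq w η) :
    l2Norm w = l2Norm η := congrArg ENNReal.toReal h.eL2_eq

theorem AEEq.pairing_left {s t : ℤˣ} {k l : ℕ} (h : k + l = n) {w η : Form n M s k}
    (hw : AEEq w η) (τ : Form n M t l) : pairing h w τ = pairing h η τ := by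
  refine integral_congr_ae ?_
  filter_upwards [hw] with x hx
  simp only [hx]

theorem AEEq.pairing_right {s t : ℤˣ} {k l : ℕ} (h : k + l = n) (w : Form n M s k)
    {τ σ : Form n M t l} (hτ : AEEq τ σ) : pairing h w τ = pairing h w σ := by
  refine integral_congr_ae ?_
  filter_upwards [hτ] with x hx
  simp only [hx]

theorem AEEq.chartMeasurable {s : ℤˣ} {k : ℕ} {w η : Form n M s k} (h : AEEq w η)
    (hw : ChartMeasurable w) : ChartMeasurable η := fun x₀ => (hw x₀).congr (h.inChart x₀)

theorem AEEq.memL2 {s : ℤˣ} {k : ℕ} {w η : Form n M s k} (h : AEEq w η) (hw : MemL2 w) : MemL2 η :=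
  ⟨h.chartMeasurable hw.1, by rw [← h.eL2_eq]; exact hw.2⟩

theorem eL2_smul {s : ℤˣ} {k : ℕ} (c : ℝ) (w : Form n M s k) :
    eL2 (c • w) = ENNReal.ofReal |c| * eL2 w := by
  have h1 : ∀ x, ENNReal.ofReal (pointNorm (c • w) x) ^ 2 =
      ENNReal.ofReal |c| ^ 2 * ENNReal.ofReal (pointNorm w x) ^ 2 := by
    intro x
    rw [← mul_pow, ← ENNReal.ofReal_mul (abs_nonneg c)]
    congr 2
    exact norm_smul_alternating c _
  unfold eL2
  simp only [h1]
  rw [lintegral_const_mul' _ _ (by finiteness), ENNReal.mul_rpow_of_nonneg _ _ (by norm_num)]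
  congr 1
  rw [← ENNReal.rpow_natCast, ← ENNReal.rpow_mul]
  norm_num

theorem MemL2.smul {s : ℤˣ} {k : ℕ} {w : Form n M s k} (hw : MemL2 w) (c : ℝ) :
    MemL2 (c • w) :=
  ⟨ChartMeasurable.smul hw.1 c, by
    rw [eL2_smul]; exact ENNReal.mul_lt_top ENNReal.ofReal_lt_top hw.2⟩

/-- In coordinates the integrand is a bilinear expression in the two forms divided by the density.
This avoids the frame, whose choice need not be measurable. -/
theorem aestronglyMeasurable_pairFun [SecondCountableTopology M] {s t : ℤˣ} (ht : t = -s) {k l : ℕ}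
    (h : k + l = n) {w : Form n M s k} {τ : Form n M t l} (hw : ChartMeasurable w)
    (hτ : ChartMeasurable τ) : AEStronglyMeasurable (pairFun h w τ) (vol n M) := by
  refine AEMeasurable.aestronglyMeasurable (aemeasurable_of_charts fun x₀ => ?_)
  have h1 : AEStronglyMeasurable (fun y => wedgeBilin h (inChart w x₀ y) (inChart τ x₀ y))
      (volume.restrict (chartAt (Model n) x₀).target) :=
    (wedgeBilin h).aestronglyMeasurable_comp₂ (hw x₀) (hτ x₀)
  have h2 := (continuousOn_volDensity (n := n) x₀).aemeasurable (μ := volume)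
    (chartAt (Model n) x₀).open_target.measurableSet
  refine (h1.aemeasurable.div h2).congr ?_
  filter_upwards [ae_restrict_mem (chartAt (Model n) x₀).open_target.measurableSet] with y hy
  have h3 := volDensity_mul_pairFun ht h w τ ((chartAt (Model n) x₀).map_target hy)
  rw [(chartAt (Model n) x₀).right_inv hy] at h3
  simp only [Pi.div_apply, ← h3]
  rw [mul_div_cancel_left₀ _ (volDensity_pos x₀ _).ne']

/-- The pointwise bound on the wedge product followed by the Cauchy–Schwarz inequality. -/
theorem lintegral_pairFun_le [SecondCountableTopology M] {s t : ℤˣ} {k l : ℕ}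
    (h : k + l = n) {w : Form n M s k} {τ : Form n M t l} (hw : ChartMeasurable w)
    (hτ : ChartMeasurable τ) :
    ∫⁻ x, ‖pairFun h w τ x‖ₑ ∂vol n M ≤ n.factorial * (eL2 w * eL2 τ) := by
  have h1 := aemeasurable_pointNorm hw
  have h2 := aemeasurable_pointNorm hτ
  calc ∫⁻ x, ‖pairFun h w τ x‖ₑ ∂vol n M
      ≤ ∫⁻ x, (n.factorial : ℝ≥0∞) *
          (ENNReal.ofReal (pointNorm w x) * ENNReal.ofReal (pointNorm τ x)) ∂vol n M := by
        refine lintegral_mono fun x => ?_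
        rw [Real.enorm_eq_ofReal_abs, ← ENNReal.ofReal_mul (pointNorm_nonneg w x),
          ← ENNReal.ofReal_natCast,
          ← ENNReal.ofReal_mul (by positivity)]
        exact ENNReal.ofReal_le_ofReal (abs_pairFun_le h w τ x)
    _ = n.factorial * ∫⁻ x,
          ENNReal.ofReal (pointNorm w x) * ENNReal.ofReal (pointNorm τ x) ∂vol n M :=
        lintegral_const_mul' _ _ (by finiteness)
    _ ≤ n.factorial * (eL2 w * eL2 τ) := by
        gcongr
        have := ENNReal.lintegral_mul_le_Lp_mul_Lq (vol n M) Real.HolderConjugate.two_two h1 h2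
        simpa [eL2] using this

theorem integrable_pairFun [SecondCountableTopology M] {s t : ℤˣ} (ht : t = -s) {k l : ℕ}
    (h : k + l = n) {w : Form n M s k} {τ : Form n M t l} (hw : MemL2 w) (hτ : MemL2 τ) :
    Integrable (pairFun h w τ) (vol n M) :=
  ⟨aestronglyMeasurable_pairFun ht h hw.1 hτ.1,
    (lintegral_pairFun_le h hw.1 hτ.1).trans_lt
      (ENNReal.mul_lt_top (by finiteness) (ENNReal.mul_lt_top hw.2 hτ.2))⟩

theorem abs_pairing_le [SecondCountableTopology M] {s t : ℤˣ} {k l : ℕ}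
    (h : k + l = n) {w : Form n M s k} {τ : Form n M t l} (hw : MemL2 w) (hτ : MemL2 τ) :
    |pairing h w τ| ≤ n.factorial * (l2Norm w * l2Norm τ) := by
  have h1 := (enorm_integral_le_lintegral_enorm (μ := vol n M) (pairFun h w τ)).trans
    (lintegral_pairFun_le h hw.1 hτ.1)
  have h2 := ENNReal.toReal_mono
    (ENNReal.mul_lt_top (by finiteness) (ENNReal.mul_lt_top hw.2 hτ.2)).ne h1
  change |∫ x, pairFun h w τ x ∂vol n M| ≤ n.factorial * ((eL2 w).toReal * (eL2 τ).toReal)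
  simpa [ENNReal.toReal_mul] using h2

theorem pairing_smul_left {s t : ℤˣ} {k l : ℕ} (h : k + l = n) (c : ℝ) (w : Form n M s k)
    (τ : Form n M t l) : pairing h (c • w) τ = c * pairing h w τ := by
  rw [pairing, pairing, ← integral_const_mul]
  exact integral_congr_ae (Filter.Eventually.of_forall fun x => pairFun_smul_left h c w τ x)

theorem pairing_smul_right {s t : ℤˣ} {k l : ℕ} (h : k + l = n) (c : ℝ) (w : Form n M s k)
    (τ : Form n M t l) : pairing h w (c • τ) = c * pairing h w τ := by
  rw [pairing, pairing, ← integral_const_mul]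
  exact integral_congr_ae (Filter.Eventually.of_forall fun x => pairFun_smul_right h c w τ x)

theorem pairing_zero_left {s t : ℤˣ} {k l : ℕ} (h : k + l = n) (τ : Form n M t l) :
    pairing h (0 : Form n M s k) τ = 0 := by
  have := pairing_smul_left h 0 (0 : Form n M s k) τ
  simpa using this

theorem pairing_zero_right {s t : ℤˣ} {k l : ℕ} (h : k + l = n) (w : Form n M s k) :
    pairing h w (0 : Form n M t l) = 0 := by
  have := pairing_smul_right h 0 w (0 : Form n M t l)
  simpa using this

/-- Square integrable forms have locally integrable coordinate expressions. -/
theorem MemL2.locallyIntegrableOn [SecondCountableTopology M] {s : ℤˣ} {k : ℕ} {w : Form n M s k}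
    (hw : MemL2 w) (x₀ : M) :
    LocallyIntegrableOn (DoubleDeRham.inChart w x₀) (chartAt (Model n) x₀).target := by
  set e := chartAt (Model n) x₀
  rw [locallyIntegrableOn_iff e.open_target.isLocallyClosed]
  intro K hKt hK
  have hw2 : ∫⁻ x, ENNReal.ofReal (pointNorm w x) ^ 2 ∂vol n M < ⊤ := by
    have := hw.2
    rwa [eL2, ENNReal.rpow_lt_top_iff_of_pos (by norm_num)] at this
  let C : Model n → ℝ := fun y =>
    ∑ i, ‖(coordEquiv (n := n) x₀ (e.symm y)).symm (EuclideanSpace.single i 1)‖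
  have hC : ContinuousOn C e.target := by
    refine continuousOn_finsetSum _ fun i _ => ?_
    refine (Real.continuous_sqrt.comp_continuousOn (continuousOn_inner_coordEquiv_symm x₀
      (EuclideanSpace.single i 1) (EuclideanSpace.single i 1))).congr fun y _ => ?_
    simp only [Function.comp]
    exact norm_eq_sqrt_real_inner _
  obtain ⟨c, hc⟩ := hK.exists_bound_of_continuousOn (hC.mono hKt)
  obtain ⟨d, hd⟩ := hK.exists_bound_of_continuousOn (f := fun y => (volDensity (n := n) x₀ (e.symm y))⁻¹)
    (((continuousOn_volDensity x₀).inv₀ fun y _ => (volDensity_pos x₀ _).ne').mono hKt)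
  -- On the compact set `K`, `c` bounds the summed lengths of the coordinate vectors and `d` bounds
  -- the inverse density. The inequality `t ≤ 1 + t²` then replaces the pointwise norm by its
  -- integrable square.
  have hle : ∀ y ∈ K, ‖inChart w x₀ y‖ₑ ≤ ENNReal.ofReal (|c| ^ k) * (1 + ENNReal.ofReal |d| *
      (ENNReal.ofReal (volDensity (n := n) x₀ (e.symm y)) *
        ENNReal.ofReal (pointNorm w (e.symm y)) ^ 2)) := by
    intro y hy
    have hp : 0 ≤ pointNorm w (e.symm y) := pointNorm_nonneg w _
    have hv := volDensity_pos (n := n) x₀ (e.symm y)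
    have h1 : ‖inChart w x₀ y‖ ≤ pointNorm w (e.symm y) * C y ^ k := by
      rw [← norm_apply_orientation w _ (coordOrientation x₀ _)]
      exact norm_compContinuousLinearMap_le_sum _ _
    have h2 : C y ^ k ≤ |c| ^ k := by
      have h0 : 0 ≤ C y := Finset.sum_nonneg fun i _ => norm_nonneg _
      gcongr
      exact (le_abs_self _).trans ((hc y hy).trans (le_abs_self _))
    have h3 : 1 ≤ |d| * volDensity (n := n) x₀ (e.symm y) := by
      have := (le_abs_self _).trans ((hd y hy).trans (le_abs_self _))
      rwa [inv_le_iff_one_le_mul₀ hv] at this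
    rw [← ofReal_norm, ← ENNReal.ofReal_pow hp, ← ENNReal.ofReal_mul hv.le,
      ← ENNReal.ofReal_mul (abs_nonneg d), ← ENNReal.ofReal_one,
      ← ENNReal.ofReal_add zero_le_one (by positivity), ← ENNReal.ofReal_mul (by positivity)]
    refine ENNReal.ofReal_le_ofReal (h1.trans ?_)
    rw [mul_comm]
    refine mul_le_mul h2 ?_ hp (by positivity)
    nlinarith [sq_nonneg (pointNorm w (e.symm y) - 1), sq_nonneg (pointNorm w (e.symm y))]
  refine ⟨(hw.1 x₀).mono_measure (Measure.restrict_mono hKt le_rfl), ?_⟩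
  refine (setLIntegral_mono' hK.measurableSet hle).trans_lt ?_
  rw [lintegral_const_mul' _ _ (by finiteness), lintegral_add_left measurable_const,
    lintegral_const_mul' _ _ (by finiteness)]
  refine ENNReal.mul_lt_top (by finiteness) (ENNReal.add_lt_top.2 ⟨?_, ?_⟩)
  · simpa using hK.measure_lt_top
  refine ENNReal.mul_lt_top (by finiteness) ?_
  calc _ ≤ ∫⁻ y in e.target, ENNReal.ofReal (volDensity (n := n) x₀ (e.symm y)) *
        ENNReal.ofReal (pointNorm w (e.symm y)) ^ 2 := lintegral_mono_set hKt
    _ = ∫⁻ x in e.source, ENNReal.ofReal (pointNorm w x) ^ 2 ∂vol n M :=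
        (setLIntegral_source x₀ ((aemeasurable_pointNorm hw.1).pow_const 2)).symm
    _ ≤ _ := setLIntegral_le_lintegral _ _
    _ < ⊤ := hw2

end L2

/-! ### Weak exterior derivatives on open subsets of `ℝⁿ` -/

section Euclidean

/-- The continuous factor is bounded on its compact support, and the other factor is integrable
there. This supplies the integrability needed in the integrations by parts. -/
theorem integrable_bilin_of_hasCompactSupport {E F G W : Type*} [NormedAddCommGroup E]
    [MeasurableSpace E] [BorelSpace E] [NormedAddCommGroup F] [NormedSpace ℝ F]
    [NormedAddCommGroup G] [NormedSpace ℝ G] [NormedAddCommGroup W] [NormedSpace ℝ W]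
    [SecondCountableTopology E] {μ : Measure E}
    (B : F →L[ℝ] G →L[ℝ] W) {U : Set E} {g : E → F} {f : E → G} (hg : Continuous g)
    (hc : HasCompactSupport g) (ht : tsupport g ⊆ U) (hf : LocallyIntegrableOn f U μ) :
    Integrable (fun y => B (g y) (f y)) μ := by
  have hK : IsCompact (tsupport g) := hc
  have hfK : IntegrableOn f (tsupport g) μ := hf.integrableOn_compact_subset ht hK
  have hsupp : Function.support (fun y => B (g y) (f y)) ⊆ tsupport g := by
    intro y hy
    by_contra h
    exact hy (by simp [image_eq_zero_of_notMem_tsupport h])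
  rw [← integrableOn_iff_integrable_of_support_subset hsupp]
  obtain ⟨c, hc'⟩ := hK.exists_bound_of_continuousOn hg.continuousOn
  refine Integrable.mono' (hfK.norm.const_mul (‖B‖ * c))
    (B.aestronglyMeasurable_comp₂ hg.aestronglyMeasurable hfK.aestronglyMeasurable) ?_
  filter_upwards [ae_restrict_mem hK.measurableSet] with y hy
  refine (B.le_opNorm₂ _ _).trans ?_
  gcongr
  exact hc' y hy

variable {n k l : ℕ} {U : Set (Model n)}

theorem integrable_smul_of_hasCompactSupport {G : Type*} [NormedAddCommGroup G] [NormedSpace ℝ G]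
    {χ : Model n → ℝ} {f : Model n → G} (hχ : Continuous χ) (hc : HasCompactSupport χ)
    (ht : tsupport χ ⊆ U) (hf : LocallyIntegrableOn f U) : Integrable fun y => χ y • f y :=
  integrable_bilin_of_hasCompactSupport (ContinuousLinearMap.lsmul ℝ ℝ) hχ hc ht hf

theorem integrable_smulRight_fderiv {G : Type*} [NormedAddCommGroup G] [NormedSpace ℝ G]
    {χ : Model n → ℝ} {f : Model n → G} (hχ : ContDiff ℝ ∞ χ) (hc : HasCompactSupport χ)
    (ht : tsupport χ ⊆ U) (hf : LocallyIntegrableOn f U) :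
    Integrable fun y => (fderiv ℝ χ y).smulRight (f y) :=
  integrable_bilin_of_hasCompactSupport (ContinuousLinearMap.smulRightL ℝ (Model n) G)
    (hχ.continuous_fderiv (by simp)) (hc.fderiv ℝ) ((tsupport_fderiv_subset ℝ).trans ht) hf

/-- `b` is the weak exterior derivative of `a` on `U`. -/
def WeakD (U : Set (Model n)) (a : Model n → Model n [⋀^Fin k]→L[ℝ] ℝ)
    (b : Model n → Model n [⋀^Fin (k + 1)]→L[ℝ] ℝ) : Prop :=
  LocallyIntegrableOn a U ∧ LocallyIntegrableOn b U ∧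
    ∀ χ : Model n → ℝ, ContDiff ℝ ∞ χ → HasCompactSupport χ → tsupport χ ⊆ U →
      ∫ y, χ y • b y = - ∫ y, covecWedge (fderiv ℝ χ y) (a y)

theorem integrable_covecWedge {χ : Model n → ℝ} {a : Model n → Model n [⋀^Fin k]→L[ℝ] ℝ}
    (hχ : ContDiff ℝ ∞ χ) (hc : HasCompactSupport χ) (ht : tsupport χ ⊆ U)
    (ha : LocallyIntegrableOn a U) : Integrable fun y => covecWedge (fderiv ℝ χ y) (a y) :=
  (ContinuousAlternatingMap.alternatizeUncurryFinCLM ℝ (Model n) ℝ).integrable_comp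
    (integrable_smulRight_fderiv hχ hc ht ha)

variable {a a' : Model n → Model n [⋀^Fin k]→L[ℝ] ℝ}
  {b b' : Model n → Model n [⋀^Fin (k + 1)]→L[ℝ] ℝ}

theorem WeakD.add (h : WeakD U a b) (h' : WeakD U a' b') :
    WeakD U (fun y => a y + a' y) (fun y => b y + b' y) := by
  refine ⟨LocallyIntegrableOn.add (f := a) (g := a') h.1 h'.1,
    LocallyIntegrableOn.add (f := b) (g := b') h.2.1 h'.2.1, fun χ hχ hc ht => ?_⟩
  have e : ∀ y, covecWedge (fderiv ℝ χ y) (a y + a' y) =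
      covecWedge (fderiv ℝ χ y) (a y) + covecWedge (fderiv ℝ χ y) (a' y) := by
    intro y
    ext v
    simp [covecWedge_apply, mul_add, Finset.sum_add_distrib]
  simp only [smul_add, e]
  rw [integral_add (integrable_smul_of_hasCompactSupport hχ.continuous hc ht h.2.1)
    (integrable_smul_of_hasCompactSupport hχ.continuous hc ht h'.2.1),
    integral_add (integrable_covecWedge hχ hc ht h.1) (integrable_covecWedge hχ hc ht h'.1),
    h.2.2 χ hχ hc ht, h'.2.2 χ hχ hc ht]
  abel

theorem WeakD.smul (h : WeakD U a b) (c : ℝ) : WeakD U (fun y => c • a y) (fun y => c • b y) := by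
  refine ⟨h.1.smul c, h.2.1.smul c, fun χ hχ hc ht => ?_⟩
  have e : ∀ y, covecWedge (fderiv ℝ χ y) (c • a y) = c • covecWedge (fderiv ℝ χ y) (a y) := by
    intro y
    ext v
    simp only [covecWedge_apply, ContinuousAlternatingMap.smul_apply, smul_eq_mul, Finset.mul_sum]
    refine Finset.sum_congr rfl fun i _ => ?_
    ring
  simp only [e]
  rw [integral_smul, ← smul_neg, ← h.2.2 χ hχ hc ht, ← integral_smul]
  exact integral_congr_ae (ae_of_all _ fun y => smul_comm _ _ _)

/-- The difference of two weak derivatives integrates to zero against every scalar test function. -/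
theorem WeakD.ae_eq (hU : IsOpen U) (h : WeakD U a b) (h' : WeakD U a b') :
    b =ᵐ[volume.restrict U] b' := by
  have := hU.ae_eq_zero_of_integral_contDiff_smul_eq_zero (μ := volume) (f := fun y => b y - b' y)
    (h.2.1.sub h'.2.1) fun χ hχ hc ht => by
      simp only [smul_sub]
      rw [integral_sub (integrable_smul_of_hasCompactSupport hχ.continuous hc ht h.2.1)
        (integrable_smul_of_hasCompactSupport hχ.continuous hc ht h'.2.1),
        h.2.2 χ hχ hc ht, h'.2.2 χ hχ hc ht, sub_self]
  rw [Filter.EventuallyEq, ae_restrict_iff' hU.measurableSet]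
  exact this.mono fun y hy hyU => sub_eq_zero.1 (hy hyU)

/-- Integration by parts in each fixed direction, assembled into an identity of linear maps to which
`L` is then applied. With `L` the antisymmetrization it becomes the defining identity of the weak
exterior derivative. -/
theorem integral_clm_smul_fderiv {G W : Type*} [NormedAddCommGroup G] [NormedSpace ℝ G]
    [CompleteSpace G] [NormedAddCommGroup W] [NormedSpace ℝ W] [CompleteSpace W]
    (hU : IsOpen U) {f : Model n → G} (hf : ContDiffOn ℝ ∞ f U) (L : (Model n →L[ℝ] G) →L[ℝ] W)
    {χ : Model n → ℝ} (hχ : ContDiff ℝ ∞ χ) (hc : HasCompactSupport χ) (ht : tsupport χ ⊆ U) :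
    ∫ y, χ y • L (fderiv ℝ f y) = - ∫ y, L ((fderiv ℝ χ y).smulRight (f y)) := by
  have hfc : ContinuousOn (fderiv ℝ f) U := hf.continuousOn_fderiv_of_isOpen hU (by simp)
  have hfl := hf.continuousOn.locallyIntegrableOn (μ := volume) hU.measurableSet
  have h1 := integrable_smul_of_hasCompactSupport hχ.continuous hc ht
    (hfc.locallyIntegrableOn (μ := volume) hU.measurableSet)
  have h2 := integrable_smulRight_fderiv hχ hc ht hfl
  have h3 : ∫ y, χ y • fderiv ℝ f y = - ∫ y, (fderiv ℝ χ y).smulRight (f y) := by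
    ext1 v
    rw [neg_apply, ContinuousLinearMap.integral_apply h1,
      ContinuousLinearMap.integral_apply h2]
    refine integral_smul_fderiv_eq_neg_fderiv_smul_of_integrable ?_ ?_ ?_ ?_ ?_
    · exact h2.apply_continuousLinearMap v
    · exact h1.apply_continuousLinearMap v
    · exact integrable_smul_of_hasCompactSupport hχ.continuous hc ht hfl
    · exact fun x _ => hχ.differentiable (by simp) x
    · exact fun x hx => (hf.contDiffAt (hU.mem_nhds (ht hx))).differentiableAt (by simp)
  simp only [← map_smul]
  rw [L.integral_comp_comm h1, L.integral_comp_comm h2, h3, map_neg]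

theorem ContDiffOn.weakD (hU : IsOpen U) (ha : ContDiffOn ℝ ∞ a U) (hb : Set.EqOn b (extDeriv a) U) :
    WeakD U a b := by
  have hbc : ContinuousOn b U := by
    refine ContinuousOn.congr (fun y hy => ?_) hb
    exact (contDiffAt_extDeriv (ha.contDiffAt (hU.mem_nhds hy))).continuousAt.continuousWithinAt
  refine ⟨ha.continuousOn.locallyIntegrableOn hU.measurableSet,
    hbc.locallyIntegrableOn hU.measurableSet, fun χ hχ hc ht => ?_⟩
  refine Eq.trans (integral_congr_ae (ae_of_all _ fun y => ?_)) (integral_clm_smul_fderiv hU ha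
    (ContinuousAlternatingMap.alternatizeUncurryFinCLM ℝ (Model n) ℝ) hχ hc ht)
  by_cases hy : y ∈ U
  · exact congrArg (χ y • ·) (hb hy)
  · simp [image_eq_zero_of_notMem_tsupport fun h => hy (ht h)]

/-- Integration by parts on an open subset of `ℝⁿ`. -/
theorem WeakD.integral_wedgeBilin (h : k + 1 + l = n) (h' : k + (l + 1) = n) (hab : WeakD U a b)
    {β : Model n → Model n [⋀^Fin l]→L[ℝ] ℝ} (hβ : ContDiff ℝ ∞ β) (hc : HasCompactSupport β)
    (ht : tsupport β ⊆ U) :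
    ∫ y, wedgeBilin h (b y) (β y) = (-1) ^ (k + 1) * ∫ y, wedgeBilin h' (a y) (extDeriv β y) := by
  -- In terms of constant forms `A j`, `β` has scalar test functions `χ j` as coefficients and `dβ =
  -- ∑ dχ_j ∧ A_j`. The definition of the weak derivative applies to each term, once `dχ_j` has been
  -- moved to the first factor at the cost of `(-1)^k`.
  let A := Module.finBasis ℝ (Model n [⋀^Fin l]→L[ℝ] ℝ)
  let χ : Fin (finrank ℝ (Model n [⋀^Fin l]→L[ℝ] ℝ)) → Model n → ℝ := fun j y =>
    LinearMap.toContinuousLinearMap (A.coord j) (β y)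
  have hχ : ∀ j, ContDiff ℝ ∞ (χ j) := fun j => (ContinuousLinearMap.contDiff _).comp hβ
  have hχc : ∀ j, HasCompactSupport (χ j) := fun j =>
    hc.comp_left (g := LinearMap.toContinuousLinearMap (A.coord j)) (map_zero _)
  have hχt : ∀ j, tsupport (χ j) ⊆ U := fun j => (closure_mono (fun y hy => by
    intro h0
    exact hy (by simp [χ, h0]))).trans ht
  have hsum : β = fun y => ∑ j, χ j y • A j := funext fun y => (A.sum_repr (β y)).symm
  have hext : ∀ y, extDeriv β y = ∑ j, covecWedge (fderiv ℝ (χ j) y) (A j) := by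
    intro y
    have : fderiv ℝ β y = ∑ j, (fderiv ℝ (χ j) y).smulRight (A j) := by
      rw [hsum, fderiv_fun_sum fun j _ =>
        ((hχ j).differentiable (by simp) y).smul_const (A j)]
      exact Finset.sum_congr rfl fun j _ => fderiv_smul_const ((hχ j).differentiable (by simp) y) _
    rw [extDeriv, this]
    exact map_sum (ContinuousAlternatingMap.alternatizeUncurryFinCLM ℝ (Model n) ℝ) _ _
  have h1 : ∀ y, wedgeBilin h (b y) (β y) = ∑ j, (wedgeBilin h).flip (A j) (χ j y • b y) := by
    intro y
    conv_lhs => rw [hsum]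
    simp
  have h2 : ∀ y, wedgeBilin h' (a y) (extDeriv β y) =
      ∑ j, (-1) ^ k * (wedgeBilin h).flip (A j) (covecWedge (fderiv ℝ (χ j) y) (a y)) := by
    intro y
    rw [hext, map_sum]
    refine Finset.sum_congr rfl fun j _ => ?_
    rw [ContinuousLinearMap.flip_apply, wedgeBilin_apply, wedgeBilin_apply]
    have := covecWedge_wedge h h' (fderiv ℝ (χ j) y) (a y) (A j)
      (fun i => EuclideanSpace.single i (1 : ℝ))
    rw [this, ← mul_assoc, ← mul_pow]
    simp
  have i1 : ∀ j, Integrable fun y => χ j y • b y := fun j =>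
    integrable_smul_of_hasCompactSupport (hχ j).continuous (hχc j) (hχt j) hab.2.1
  have i2 : ∀ j, Integrable fun y => covecWedge (fderiv ℝ (χ j) y) (a y) := fun j =>
    integrable_covecWedge (hχ j) (hχc j) (hχt j) hab.1
  simp only [h1, h2]
  rw [integral_finsetSum _ fun j _ => ContinuousLinearMap.integrable_comp _ (i1 j),
    integral_finsetSum _ fun j _ => (ContinuousLinearMap.integrable_comp _ (i2 j)).const_mul _,
    Finset.mul_sum]
  refine Finset.sum_congr rfl fun j _ => ?_
  rw [ContinuousLinearMap.integral_comp_comm _ (i1 j), integral_const_mul,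
    ContinuousLinearMap.integral_comp_comm _ (i2 j), hab.2.2 _ (hχ j) (hχc j) (hχt j), map_neg,
    ← mul_assoc, ← pow_add]
  have : (-1 : ℝ) ^ (k + 1 + k) = -1 := by
    rw [show k + 1 + k = 2 * k + 1 by ring, pow_succ, pow_mul]; simp
  rw [this]
  ring

/-- The fundamental lemma of the calculus of variations on an open subset of `ℝⁿ`. -/
theorem ae_eq_zero_of_integral_wedgeBilin (hU : IsOpen U) (h : k + l = n)
    {ζ : Model n → Model n [⋀^Fin l]→L[ℝ] ℝ} (hζ : LocallyIntegrableOn ζ U)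
    (H : ∀ χ : Model n → ℝ, ContDiff ℝ ∞ χ → HasCompactSupport χ → tsupport χ ⊆ U →
      ∀ A : Model n [⋀^Fin k]→L[ℝ] ℝ, ∫ y, wedgeBilin h (χ y • A) (ζ y) = 0) :
    ζ =ᵐ[volume.restrict U] 0 := by
  -- Finitely many constant forms suffice as tests: a common null set is removed, linearity gives
  -- all `α`, and nondegeneracy applies pointwise.
  let A := Module.finBasis ℝ (Model n [⋀^Fin k]→L[ℝ] ℝ)
  have h1 : ∀ j, ∀ᵐ y, y ∈ U → wedgeBilin h (A j) (ζ y) = 0 := by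
    intro j
    refine hU.ae_eq_zero_of_integral_contDiff_smul_eq_zero (μ := volume) ?_ fun χ hχ hc ht => ?_
    · intro y hy
      obtain ⟨s, hs, hi⟩ := hζ y hy
      exact ⟨s, hs, ContinuousLinearMap.integrable_comp _ hi⟩
    · rw [← H χ hχ hc ht (A j)]
      simp
  rw [Filter.EventuallyEq, ae_restrict_iff' hU.measurableSet]
  filter_upwards [ae_all_iff.2 h1] with y hy hyU
  refine eq_zero_of_wedge_eq_zero h (EuclideanSpace.basisFun (Fin n) ℝ).toBasis _ fun α => ?_
  have h2 : (wedgeBilin h).flip (ζ y) α = 0 := by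
    rw [← A.sum_repr α, map_sum]
    refine Finset.sum_eq_zero fun j _ => ?_
    rw [map_smul, ContinuousLinearMap.flip_apply, hy j hyU, smul_zero]
  rw [ContinuousLinearMap.flip_apply, wedgeBilin_apply] at h2
  simpa using h2

end Euclidean

/-! ### Weak exterior derivatives of forms -/

section Weak

variable {n : ℕ} {M : Type*} [TopologicalSpace M] [ChartedSpace (Model n) M]
  [IsManifold (𝓡 n) ∞ M] {s t : ℤˣ} {k l : ℕ}

theorem IsExtDeriv.weakD {w : Form n M s k} {θ : Form n M s (k + 1)} (h : IsExtDeriv w θ) (x₀ : M) :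
    WeakD (chartAt (Model n) x₀).target (inChart w x₀) (inChart θ x₀) := h x₀

theorem IsExtDeriv.add {w w' : Form n M s k} {θ θ' : Form n M s (k + 1)} (h : IsExtDeriv w θ)
    (h' : IsExtDeriv w' θ') : IsExtDeriv (w + w') (θ + θ') :=
  fun x₀ => (h.weakD x₀).add (h'.weakD x₀)

theorem IsExtDeriv.smul {w : Form n M s k} {θ : Form n M s (k + 1)} (h : IsExtDeriv w θ) (c : ℝ) :
    IsExtDeriv (c • w) (c • θ) :=
  fun x₀ => (h.weakD x₀).smul c

theorem IsSmooth.isExtDeriv {w : Form n M s k} (hw : IsSmooth w) :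
    IsExtDeriv w (DoubleDeRham.smoothD w) :=
  fun x₀ => ContDiffOn.weakD (chartAt (Model n) x₀).open_target (hw x₀)
    fun _ hy => inChart_smoothD hw x₀ hy

/-- The identity `d ∘ d = 0`, in the form that makes `dφ`, for a test form `φ`, an admissible closed
variation in the Casimir argument. -/
theorem IsSmooth.smoothD_isExtDeriv_zero {w : Form n M s k} (hw : IsSmooth w) :
    IsExtDeriv (DoubleDeRham.smoothD w) 0 :=
  fun x₀ => ContDiffOn.weakD (chartAt (Model n) x₀).open_target (hw.smoothD x₀) fun y hy => by
    rw [← inChart_smoothD hw.smoothD x₀ hy, smoothD_smoothD hw x₀ hy, inChart_zero]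

theorem isExtDeriv_extD {w : Form n M s k} (h : ∃ θ, IsExtDeriv w θ) : IsExtDeriv w (extD w) := by
  rw [extD, dif_pos h]
  exact h.choose_spec

/-- The exterior derivative does not change when a closed form is added. -/
theorem extD_add_of_isExtDeriv_zero (b : Form n M s k) {ζ : Form n M s k} (hζ : IsExtDeriv ζ 0) :
    extD (b + ζ) = extD b := by
  have h : ∀ θ, IsExtDeriv (b + ζ) θ ↔ IsExtDeriv b θ := fun θ =>
    ⟨fun h => by
      have e1 : b + ζ + (-1 : ℝ) • ζ = b :=
        (congrArg (b + ζ + ·) (neg_one_smul ℝ ζ)).trans (add_neg_cancel_right b ζ)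
      have e2 : θ + (-1 : ℝ) • (0 : Form n M s (k + 1)) = θ :=
        (congrArg (θ + ·) (smul_zero (-1 : ℝ))).trans (add_zero θ)
      have := h.add (hζ.smul (-1))
      rwa [e1, e2] at this,
    fun h => by
      have := h.add hζ
      rwa [show θ + 0 = θ from add_zero θ] at this⟩
  -- Equal sets of weak derivatives lead to the same choice, so the conclusion is a genuine equality
  -- and not merely one almost everywhere.
  have key : ∀ P Q : Form n M s (k + 1) → Prop, P = Q →
      (open Classical in if h : ∃ θ, P θ then h.choose else 0) =
        (open Classical in if h : ∃ θ, Q θ then h.choose else 0) := by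
    rintro P _ rfl
    rfl
  exact key _ _ (funext fun θ => propext (h θ))

theorem IsSmooth.add {w w' : Form n M s k} (h : IsSmooth w) (h' : IsSmooth w') : IsSmooth (w + w') :=
  fun x₀ => (h x₀).add (h' x₀)

theorem smoothD_add {w w' : Form n M s k} (h : IsSmooth w) (h' : IsSmooth w') :
    smoothD (w + w') = smoothD w + smoothD w' := by
  refine Subtype.ext (funext fun p => ?_)
  have hp := mem_chart_source (Model n) p
  have hy := (chartAt (Model n) p).map_source hp
  refine eq_of_inChart_eq hp ?_
  rw [inChart_smoothD (h.add h') p hy, inChart_add, inChart_smoothD h p hy, inChart_smoothD h' p hy]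
  exact extDeriv_fun_add ((h.contDiffAt p hy).differentiableAt (by simp))
    ((h'.contDiffAt p hy).differentiableAt (by simp))

theorem IsSmooth.zero : IsSmooth (0 : Form n M s k) := fun _ =>
  (contDiffOn_const (c := 0) : ContDiffOn ℝ ∞ (fun _ : Model n => (0 : Model n [⋀^Fin k]→L[ℝ] ℝ)) _)

/-- Multiplication of a form by a function. -/
def funMul (f : M → ℝ) (w : Form n M s k) : Form n M s k :=
  ⟨fun x o => f x • w.1 x o, fun x o => by
    change f x • w.1 x (-o) = _ • f x • w.1 x o
    rw [w.2 x o, smul_comm]⟩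

theorem IsSmooth.funMul {f : M → ℝ} (hf : ContMDiff (𝓡 n) 𝓘(ℝ, ℝ) ∞ f) {w : Form n M s k}
    (hw : IsSmooth w) : IsSmooth (funMul f w) := by
  intro x₀
  have h1 : ContDiffOn ℝ ∞ (f ∘ (chartAt (Model n) x₀).symm) (chartAt (Model n) x₀).target := by
    rw [← contMDiffOn_iff_contDiffOn]
    exact hf.comp_contMDiffOn contMDiffOn_chart_symm
  exact h1.smul (hw x₀)

/-- The coordinate expression of a form in a chart, extended by zero. -/
def chartExtend (w : Form n M s k) (x₀ : M) : Model n → Model n [⋀^Fin k]→L[ℝ] ℝ :=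
  (chartAt (Model n) x₀).target.indicator (inChart w x₀)

theorem support_chartExtend_subset (w : Form n M s k) (x₀ : M) {K : Set M}
    (h0 : ∀ x ∉ K, w.1 x = 0) :
    Function.support (chartExtend w x₀) ⊆ chartAt (Model n) x₀ '' K := by
  intro y hy
  have hyt : y ∈ (chartAt (Model n) x₀).target := by
    by_contra h
    exact hy (Set.indicator_of_notMem h _)
  refine ⟨(chartAt (Model n) x₀).symm y, ?_, (chartAt (Model n) x₀).right_inv hyt⟩
  by_contra h
  refine hy ?_
  rw [chartExtend, Set.indicator_of_mem hyt, inChart_congr (η := 0) (h0 _ h), inChart_zero]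

theorem isCompact_chart_image (x₀ : M) {K : Set M} (hK : IsCompact K)
    (hKs : K ⊆ (chartAt (Model n) x₀).source) : IsCompact (chartAt (Model n) x₀ '' K) :=
  hK.image_of_continuousOn ((chartAt (Model n) x₀).continuousOn.mono hKs)

theorem tsupport_chartExtend_subset (w : Form n M s k) (x₀ : M) {K : Set M} (hK : IsCompact K)
    (hKs : K ⊆ (chartAt (Model n) x₀).source) (h0 : ∀ x ∉ K, w.1 x = 0) :
    tsupport (chartExtend w x₀) ⊆ chartAt (Model n) x₀ '' K :=
  closure_minimal (support_chartExtend_subset w x₀ h0) (isCompact_chart_image x₀ hK hKs).isClosed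

theorem image_chart_subset_target (x₀ : M) {K : Set M} (hKs : K ⊆ (chartAt (Model n) x₀).source) :
    chartAt (Model n) x₀ '' K ⊆ (chartAt (Model n) x₀).target := by
  rintro _ ⟨x, hx, rfl⟩
  exact (chartAt (Model n) x₀).map_source (hKs hx)

/-- Outside the target of the chart `inChart` has no meaning, so it is replaced by zero there. The
result stays smooth because the support is a compact subset of the target. -/
theorem contDiff_chartExtend {w : Form n M s k} (hw : IsSmooth w) (x₀ : M) {K : Set M}
    (hK : IsCompact K) (hKs : K ⊆ (chartAt (Model n) x₀).source) (h0 : ∀ x ∉ K, w.1 x = 0) :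
    ContDiff ℝ ∞ (chartExtend w x₀) := by
  rw [contDiff_iff_contDiffAt]
  intro y
  by_cases hy : y ∈ (chartAt (Model n) x₀).target
  · refine (hw.contDiffAt x₀ hy).congr_of_eventuallyEq ?_
    filter_upwards [(chartAt (Model n) x₀).open_target.mem_nhds hy] with z hz
    exact Set.indicator_of_mem hz _
  · have h1 : y ∉ tsupport (chartExtend w x₀) := fun h =>
      hy (image_chart_subset_target x₀ hKs (tsupport_chartExtend_subset w x₀ hK hKs h0 h))
    refine (contDiffAt_const (c := 0)).congr_of_eventuallyEq ?_
    exact notMem_tsupport_iff_eventuallyEq.1 h1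

end Weak

/-! ### Stokes' theorem against test forms and the fundamental lemma on the manifold -/

section Stokes

variable {n : ℕ} {M : Type*} [TopologicalSpace M] [ChartedSpace (Model n) M]
  [IsManifold (𝓡 n) ∞ M] [RiemannianBundle (fun x : M => TangentSpace (𝓡 n) x)]
  {s t : ℤˣ} {k l : ℕ}

theorem IsSmooth.chartMeasurable {w : Form n M s k} (hw : IsSmooth w) : ChartMeasurable w :=
  fun x₀ => (hw x₀).continuousOn.aestronglyMeasurable (chartAt (Model n) x₀).open_target.measurableSet

theorem IsExtDeriv.chartMeasurable_left {w : Form n M s k} {θ : Form n M s (k + 1)}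
    (h : IsExtDeriv w θ) : ChartMeasurable w := fun x₀ => (h x₀).1.aestronglyMeasurable

theorem IsExtDeriv.chartMeasurable_right {w : Form n M s k} {θ : Form n M s (k + 1)}
    (h : IsExtDeriv w θ) : ChartMeasurable θ := fun x₀ => (h x₀).2.1.aestronglyMeasurable

variable [MeasurableSpace M] [BorelSpace M] [SecondCountableTopology M]
  [IsContinuousRiemannianBundle (Model n) (fun x : M => TangentSpace (𝓡 n) x)]

theorem IsExtDeriv.aeEq {w : Form n M s k} {θ θ' : Form n M s (k + 1)} (h : IsExtDeriv w θ)
    (h' : IsExtDeriv w θ') : AEEq θ θ' :=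
  aeEq_of_inChart fun x₀ => (h.weakD x₀).ae_eq (chartAt (Model n) x₀).open_target (h'.weakD x₀)

theorem IsExtDeriv.extD_aeEq {w : Form n M s k} {θ : Form n M s (k + 1)} (h : IsExtDeriv w θ) :
    AEEq (extD w) θ := (isExtDeriv_extD ⟨θ, h⟩).aeEq h

theorem pairFun_eq_zero (h : k + l = n) {w : Form n M s k} {τ : Form n M t l} {x : M}
    (h0 : w.1 x = 0 ∨ τ.1 x = 0) : pairFun h w τ x = 0 := by
  rcases h0 with h0 | h0
  · have := pairFun_smul_left h 0 w τ x
    rw [zero_mul] at this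
    rw [← this]
    simp [pairFun, h0]
  · have := pairFun_smul_right h 0 w τ x
    rw [zero_mul] at this
    rw [← this]
    simp [pairFun, h0]

theorem ae_volDensity_mul_pairFun (ht : t = -s) (h : k + l = n) (w : Form n M s k)
    (τ : Form n M t l) (x₀ : M) :
    (fun y => volDensity (n := n) x₀ ((chartAt (Model n) x₀).symm y) *
      pairFun h w τ ((chartAt (Model n) x₀).symm y))
      =ᵐ[volume.restrict (chartAt (Model n) x₀).target]
        fun y => wedgeBilin h (inChart w x₀ y) (inChart τ x₀ y) := by
  filter_upwards [ae_restrict_mem (chartAt (Model n) x₀).open_target.measurableSet] with y hy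
  have := volDensity_mul_pairFun ht h w τ ((chartAt (Model n) x₀).map_target hy)
  rwa [(chartAt (Model n) x₀).right_inv hy] at this

/-- The pairing of forms, one of which is supported in the domain of a chart. -/
theorem pairing_eq_setIntegral (ht : t = -s) (h : k + l = n) {w : Form n M s k} {τ : Form n M t l}
    (hw : ChartMeasurable w) (hτ : ChartMeasurable τ) (x₀ : M)
    (h0 : ∀ x ∉ (chartAt (Model n) x₀).source, w.1 x = 0 ∨ τ.1 x = 0) :
    pairing h w τ =
      ∫ y in (chartAt (Model n) x₀).target, wedgeBilin h (inChart w x₀ y) (inChart τ x₀ y) := by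
  rw [← integral_congr_ae (ae_volDensity_mul_pairFun ht h w τ x₀),
    ← setIntegral_source x₀ (aestronglyMeasurable_pairFun ht h hw hτ)]
  exact (setIntegral_eq_integral_of_forall_compl_eq_zero fun x hx => pairFun_eq_zero h (h0 x hx)).symm

theorem integrable_pairFun_of_chart (ht : t = -s) (h : k + l = n) {w : Form n M s k}
    {τ : Form n M t l} (hw : ChartMeasurable w) (hτ : ChartMeasurable τ) (x₀ : M)
    (h0 : ∀ x ∉ (chartAt (Model n) x₀).source, w.1 x = 0 ∨ τ.1 x = 0)
    (hi : IntegrableOn (fun y => wedgeBilin h (inChart w x₀ y) (inChart τ x₀ y))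
      (chartAt (Model n) x₀).target) : Integrable (pairFun h w τ) (vol n M) := by
  rw [← integrableOn_iff_integrable_of_support_subset (s := (chartAt (Model n) x₀).source),
    integrableOn_source_iff x₀ (aestronglyMeasurable_pairFun ht h hw hτ)]
  · exact (integrable_congr (ae_volDensity_mul_pairFun ht h w τ x₀)).2 hi
  · intro x hx
    by_contra hxs
    exact hx (pairFun_eq_zero h (h0 x hxs))

/-- Stokes' theorem for a form with a weak exterior derivative and a smooth form which is compactly
supported in the domain of a chart. -/
theorem IsExtDeriv.pairing_chart [T2Space M] (ht : t = -s) (h : k + 1 + l = n)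
    (h' : k + (l + 1) = n) {w : Form n M s k} {θ : Form n M s (k + 1)} (hw : IsExtDeriv w θ)
    {φ : Form n M t l} (hφ : IsSmooth φ) (x₀ : M) {K : Set M} (hK : IsCompact K)
    (hKs : K ⊆ (chartAt (Model n) x₀).source) (h0 : ∀ x ∉ K, φ.1 x = 0) :
    Integrable (pairFun h θ φ) (vol n M) ∧ Integrable (pairFun h' w (smoothD φ)) (vol n M) ∧
      pairing h θ φ = (-1) ^ (k + 1) * pairing h' w (smoothD φ) := by
  set e := chartAt (Model n) x₀
  have hm := e.open_target.measurableSet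
  have hβ := contDiff_chartExtend hφ x₀ hK hKs h0
  have hsub := tsupport_chartExtend_subset φ x₀ hK hKs h0
  have hβc : HasCompactSupport (chartExtend φ x₀) :=
    (isCompact_chart_image x₀ hK hKs).of_isClosed_subset (isClosed_tsupport _) hsub
  have hβt : tsupport (chartExtend φ x₀) ⊆ e.target :=
    hsub.trans (image_chart_subset_target x₀ hKs)
  have hev : ∀ y ∈ e.target, extDeriv (chartExtend φ x₀) y = inChart (smoothD φ) x₀ y := by
    intro y hy
    rw [inChart_smoothD hφ x₀ hy]
    refine Filter.EventuallyEq.extDeriv_eq ?_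
    filter_upwards [e.open_target.mem_nhds hy] with z hz
    exact Set.indicator_of_mem hz _
  have hdc : HasCompactSupport (extDeriv (chartExtend φ x₀)) :=
    (hβc.fderiv ℝ).comp_left 
      (g := ContinuousAlternatingMap.alternatizeUncurryFin)
      (map_zero (ContinuousAlternatingMap.alternatizeUncurryFinCLM ℝ (Model n) ℝ))
  have hdt : tsupport (extDeriv (chartExtend φ x₀)) ⊆ tsupport (chartExtend φ x₀) := by
    refine closure_minimal (fun y hy => ?_) (isClosed_tsupport _)
    refine support_fderiv_subset ℝ fun h0 => hy ?_
    rw [extDeriv, h0]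
    exact map_zero (ContinuousAlternatingMap.alternatizeUncurryFinCLM ℝ (Model n) ℝ)
  have hdcont : Continuous (extDeriv (chartExtend φ x₀)) := by
    rw [continuous_iff_continuousAt]
    exact fun y => (contDiffAt_extDeriv hβ.contDiffAt).continuousAt
  have i1 : Integrable fun y => wedgeBilin h (inChart θ x₀ y) (chartExtend φ x₀ y) :=
    integrable_bilin_of_hasCompactSupport (wedgeBilin h).flip hβ.continuous hβc hβt (hw x₀).2.1
  have i2 : Integrable fun y => wedgeBilin h' (inChart w x₀ y) (extDeriv (chartExtend φ x₀) y) :=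
    integrable_bilin_of_hasCompactSupport (wedgeBilin h').flip hdcont hdc (hdt.trans hβt) (hw x₀).1
  have e1 : Set.EqOn (fun y => wedgeBilin h (inChart θ x₀ y) (inChart φ x₀ y))
      (fun y => wedgeBilin h (inChart θ x₀ y) (chartExtend φ x₀ y)) e.target := by
    intro y hy
    simp only [chartExtend]
    rw [Set.indicator_of_mem hy]
  have e2 : Set.EqOn (fun y => wedgeBilin h' (inChart w x₀ y) (inChart (smoothD φ) x₀ y))
      (fun y => wedgeBilin h' (inChart w x₀ y) (extDeriv (chartExtend φ x₀) y)) e.target := by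
    intro y hy
    simp only [hev y hy]
  have z1 : ∀ x ∉ e.source, θ.1 x = 0 ∨ φ.1 x = 0 := fun x hx => Or.inr (h0 x fun h => hx (hKs h))
  have z2 : ∀ x ∉ e.source, w.1 x = 0 ∨ (smoothD φ).1 x = 0 := fun x hx =>
    Or.inr (smoothD_apply_eq_zero hK h0 fun h => hx (hKs h))
  refine ⟨integrable_pairFun_of_chart ht h hw.chartMeasurable_right hφ.chartMeasurable x₀ z1
      (i1.integrableOn.congr_fun e1.symm hm),
    integrable_pairFun_of_chart ht h' hw.chartMeasurable_left hφ.smoothD.chartMeasurable x₀ z2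
      (i2.integrableOn.congr_fun e2.symm hm), ?_⟩
  rw [pairing_eq_setIntegral ht h hw.chartMeasurable_right hφ.chartMeasurable x₀ z1,
    pairing_eq_setIntegral ht h' hw.chartMeasurable_left hφ.smoothD.chartMeasurable x₀ z2,
    setIntegral_congr_fun hm e1, setIntegral_congr_fun hm e2,
    setIntegral_eq_integral_of_forall_compl_eq_zero fun y hy => ?_,
    setIntegral_eq_integral_of_forall_compl_eq_zero fun y hy => ?_]
  · exact (hw.weakD x₀).integral_wedgeBilin h h' hβ hβc hβt
  · rw [image_eq_zero_of_notMem_tsupport fun h => hy (hβt (hdt h)), map_zero]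
  · rw [image_eq_zero_of_notMem_tsupport fun h => hy (hβt h), map_zero]

/-- Stokes' theorem for a form with a weak exterior derivative and a test form. -/
theorem IsExtDeriv.pairing_test [T2Space M] (ht : t = -s) (h : k + 1 + l = n)
    (h' : k + (l + 1) = n) {w : Form n M s k} {θ : Form n M s (k + 1)} (hw : IsExtDeriv w θ)
    {φ : Form n M t l} (hφ : IsTestForm φ) :
    pairing h θ φ = (-1) ^ (k + 1) * pairing h' w (smoothD φ) := by
  obtain ⟨hs, C, hC, h0⟩ := hφ
  have : LocallyCompactSpace M := ChartedSpace.locallyCompactSpace (Model n) M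
  have : SigmaCompactSpace M := inferInstance
  -- Finitely many charts cover the support, so a partition of unity writes `φ` as a finite sum of
  -- forms, each compactly supported in one chart domain.
  obtain ⟨T, hT⟩ := hC.elim_finite_subcover (fun x : M => (chartAt (Model n) x).source)
    (fun x => (chartAt (Model n) x).open_source)
    fun x _ => Set.mem_iUnion.2 ⟨x, mem_chart_source (Model n) x⟩
  obtain ⟨f, hf⟩ := SmoothPartitionOfUnity.exists_isSubordinate (𝓡 n) hC.isClosed
    (fun i : T => (chartAt (Model n) (i : M)).source) (fun i => (chartAt (Model n) (i : M)).open_source)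
    (by simpa [Set.iUnion_subtype] using hT)
  have hsum : φ = ∑ i : T, funMul (f i) φ := by
    refine Subtype.ext (funext fun x => funext fun o => ?_)
    have e1 : (∑ i : T, funMul (f i) φ).1 x o = ∑ i : T, f i x • φ.1 x o := by
      rw [Submodule.coe_sum, Finset.sum_apply, Finset.sum_apply]
      rfl
    rw [e1, ← Finset.sum_smul]
    by_cases hx : x ∈ C
    · have := f.sum_eq_one hx
      rw [finsum_eq_sum_of_fintype] at this
      rw [this, one_smul]
    · rw [h0 x hx]
      simp
  -- Integrability is carried along with the identity: `w` and `θ` are only locally integrable here,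
  -- and additivity of the pairings requires it.
  let P : Form n M t l → Prop := fun φ => IsSmooth φ ∧ Integrable (pairFun h θ φ) (vol n M) ∧
    Integrable (pairFun h' w (smoothD φ)) (vol n M) ∧
      pairing h θ φ = (-1) ^ (k + 1) * pairing h' w (smoothD φ)
  have hP : P (∑ i : T, funMul (f i) φ) := by
    refine Finset.sum_induction _ P ?_ ?_ fun i _ => ?_
    · rintro a b ⟨a1, a2, a3, a4⟩ ⟨b1, b2, b3, b4⟩
      have c1 : ∀ x, pairFun h θ (a + b) x = pairFun h θ a x + pairFun h θ b x :=
        pairFun_add_right h θ a b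
      have c2 : ∀ x, pairFun h' w (smoothD (a + b)) x =
          pairFun h' w (smoothD a) x + pairFun h' w (smoothD b) x := by
        rw [smoothD_add a1 b1]
        exact pairFun_add_right h' w _ _
      refine ⟨a1.add b1, (integrable_congr (ae_of_all _ c1)).2 (a2.add b2),
        (integrable_congr (ae_of_all _ c2)).2 (a3.add b3), ?_⟩
      have d1 : pairing h θ (a + b) = pairing h θ a + pairing h θ b :=
        (integral_congr_ae (ae_of_all _ c1)).trans (integral_add a2 b2)
      have d2 : pairing h' w (smoothD (a + b)) =
          pairing h' w (smoothD a) + pairing h' w (smoothD b) :=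
        (integral_congr_ae (ae_of_all _ c2)).trans (integral_add a3 b3)
      rw [d1, d2, a4, b4, mul_add]
    · rcases isEmpty_or_nonempty M with hM | ⟨⟨x₀⟩⟩
      · refine ⟨IsSmooth.zero, ?_, ?_, ?_⟩
        · rw [Measure.eq_zero_of_isEmpty (vol n M)]; exact integrable_zero_measure
        · rw [Measure.eq_zero_of_isEmpty (vol n M)]; exact integrable_zero_measure
        · simp [pairing, Measure.eq_zero_of_isEmpty (vol n M)]
      · exact ⟨IsSmooth.zero, hw.pairing_chart ht h h' IsSmooth.zero x₀ isCompact_empty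
          (Set.empty_subset _) fun _ _ => rfl⟩
    · have hsm : IsSmooth (funMul (f i) φ) := IsSmooth.funMul (f i).contMDiff hs
      refine ⟨hsm, hw.pairing_chart ht h h' hsm i
        (hC.inter_right (isClosed_tsupport (f i))) (Set.inter_subset_right.trans (hf i)) ?_⟩
      intro x hx
      have : x ∉ C ∨ x ∉ tsupport (f i) := by
        by_contra hcon
        push Not at hcon
        exact hx hcon
      funext o
      change f i x • φ.1 x o = 0
      rcases this with hx | hx
      · rw [h0 x hx]; simp
      · rw [image_eq_zero_of_notMem_tsupport hx, zero_smul]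
  rw [← hsum] at hP
  exact hP.2.2.2

/-- The fundamental lemma of the calculus of variations. -/
theorem aeEq_zero_of_pairing_test [T2Space M] (ht : t = -s) (h : k + l = n) {ζ : Form n M t l}
    (hζ : ∀ x₀ : M, LocallyIntegrableOn (inChart ζ x₀) (chartAt (Model n) x₀).target)
    (H : ∀ η : Form n M s k, IsTestForm η → pairing h η ζ = 0) : AEEq ζ 0 := by
  refine aeEq_of_inChart fun x₀ => ?_
  refine ae_eq_zero_of_integral_wedgeBilin (chartAt (Model n) x₀).open_target h (hζ x₀)
    fun χ hχ hc hχt A => ?_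
  -- A test function times a constant form, transplanted to the manifold through the chart, is an
  -- admissible test form.
  have h1 : ContDiff ℝ ∞ fun y => χ y • A := hχ.smul contDiff_const
  have h2 : tsupport (fun y => χ y • A) ⊆ tsupport χ := closure_mono fun y hy h0 =>
    hy (by simp [h0])
  have hT := isTestForm_ofChart s x₀ h1 (hc.of_isClosed_subset (isClosed_tsupport _) h2)
    (h2.trans hχt)
  have h3 := H _ hT
  rw [pairing_eq_setIntegral ht h (IsSmooth.chartMeasurable hT.1)
    (fun x₀ => (hζ x₀).aestronglyMeasurable) x₀ fun x hx => Or.inl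
      (ofChart_apply_eq_zero s x₀ _ ?_)] at h3
  · rw [← h3, ← setIntegral_eq_integral_of_forall_compl_eq_zero
      (s := (chartAt (Model n) x₀).target) fun y hy => ?_]
    · refine setIntegral_congr_fun (chartAt (Model n) x₀).open_target.measurableSet fun y hy => ?_
      simp only [inChart_ofChart s x₀ _ hy]
    · rw [image_eq_zero_of_notMem_tsupport fun h => hy (hχt h)]
      simp
  · rintro ⟨y, hy, rfl⟩
    exact hx ((chartAt (Model n) x₀).map_target (hχt (h2 hy)))

/-- A form which is orthogonal to the derivatives of all test forms is closed. -/
theorem IsExtDeriv.aeEq_zero_of_pairing_smoothD [T2Space M] (ht : t = -s) (h' : k + (l + 1) = n)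
    {w : Form n M s k} {θ : Form n M s (k + 1)} (hw : IsExtDeriv w θ)
    (H : ∀ φ : Form n M t l, IsTestForm φ → pairing h' w (smoothD φ) = 0) : AEEq θ 0 := by
  refine aeEq_zero_of_pairing_test (s := t) (k := l) (by rw [ht, neg_neg]) (by omega)
    (fun x₀ => (hw x₀).2.1) fun φ hφ => ?_
  rw [pairing_comm (by omega) (by omega : k + 1 + l = n) φ θ, hw.pairing_test ht (by omega) h' hφ, H φ hφ]
  simp

end Stokes

/-! ### Stokes' theorem in `HΛᵏ` -/

section Sobolev

variable {n : ℕ} {M : Type*} [TopologicalSpace M] [ChartedSpace (Model n) M]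
  [IsManifold (𝓡 n) ∞ M] [RiemannianBundle (fun x : M => TangentSpace (𝓡 n) x)]
  [MeasurableSpace M] [BorelSpace M] [SecondCountableTopology M]
  [IsContinuousRiemannianBundle (Model n) (fun x : M => TangentSpace (𝓡 n) x)]
  {s t : ℤˣ} {k l : ℕ}

theorem pairing_add_right (ht : t = -s) (h : k + l = n) {w : Form n M s k} {τ σ : Form n M t l}
    (hw : MemL2 w) (hτ : MemL2 τ) (hσ : MemL2 σ) :
    pairing h w (τ + σ) = pairing h w τ + pairing h w σ := by
  change ∫ x, pairFun h w (τ + σ) x ∂vol n M =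
    ∫ x, pairFun h w τ x ∂vol n M + ∫ x, pairFun h w σ x ∂vol n M
  rw [← integral_add (integrable_pairFun ht h hw hτ) (integrable_pairFun ht h hw hσ)]
  exact integral_congr_ae (ae_of_all _ fun x => pairFun_add_right h w τ σ x)

theorem pairing_sub_right (ht : t = -s) (h : k + l = n) {w : Form n M s k} {τ σ : Form n M t l}
    (hw : MemL2 w) (hτ : MemL2 τ) (hσ : MemL2 σ) :
    pairing h w (τ - σ) = pairing h w τ - pairing h w σ := by
  have h1 := pairing_add_right ht h hw hτ (hσ.smul (-1))
  rw [pairing_smul_right, show τ + (-1 : ℝ) • σ = τ - σ from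
    (congrArg (τ + ·) (neg_one_smul ℝ σ)).trans (sub_eq_add_neg τ σ).symm] at h1
  rw [h1]
  ring

theorem Form.sub_add_cancel (w η : Form n M s k) : w - η + η = w :=
  Subtype.ext (funext fun _ => funext fun _ => _root_.sub_add_cancel _ _)

theorem Form.add_sub_cancel (w η : Form n M s k) : w + (η - w) = η :=
  Subtype.ext (funext fun _ => funext fun _ => _root_.add_sub_cancel _ _)

theorem tendsto_pairing_zero (h : k + l = n) {w : Form n M s k} (hw : MemL2 w)
    {η : ℕ → Form n M t l} (hm : ∀ j, ChartMeasurable (η j))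
    (hη : Filter.Tendsto (fun j => eL2 (η j)) Filter.atTop (𝓝 0)) :
    Filter.Tendsto (fun j => pairing h w (η j)) Filter.atTop (𝓝 0) := by
  have h1 : Filter.Tendsto (fun j => (n.factorial : ℝ) * (l2Norm w * l2Norm (η j))) Filter.atTop
      (𝓝 (n.factorial * (l2Norm w * 0))) :=
    (((ENNReal.tendsto_toReal ENNReal.zero_ne_top).comp hη).const_mul _).const_mul _
  rw [mul_zero, mul_zero] at h1
  refine squeeze_zero_norm' ?_ h1
  -- The bound on the pairing needs finite norms, and convergence provides them only for large `j`.
  filter_upwards [hη.eventually_lt_const ENNReal.zero_lt_top] with j hj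
  exact abs_pairing_le h hw ⟨hm j, hj⟩

theorem MemH.isExtDeriv {w : Form n M s k} (hw : MemH w) : IsExtDeriv w (extD w) :=
  isExtDeriv_extD hw.2.1

/-- For approximating test forms the identity is known. Both sides are continuous for the `L²`
convergence of `η j` and of `extD (η j)`, so it passes to the limit. -/
theorem MemH0.pairing_extD [T2Space M] (ht : t = -s) (h : k + 1 + l = n) (h' : k + (l + 1) = n)
    {w : Form n M s k} {τ : Form n M t l} (hw : MemH w) (hτ : MemH0 τ) :
    pairing h (extD w) τ = (-1) ^ (k + 1) * pairing h' w (extD τ) := by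
  obtain ⟨hτH, η, hη, h0, h1⟩ := hτ
  have hs : ∀ j, IsSmooth (η j) := fun j => (hη j).1
  have hx : ∀ j, AEEq (extD (η j)) (smoothD (η j)) := fun j => (hs j).isExtDeriv.extD_aeEq
  have m0 : ∀ j, ChartMeasurable (η j - τ) := fun j => (hs j).chartMeasurable.sub hτH.1.1
  have m1 : ∀ j, ChartMeasurable (extD (η j) - extD τ) := fun j =>
    ChartMeasurable.sub ((hx j).symm.chartMeasurable (hs j).smoothD.chartMeasurable) hτH.2.2.1
  have t0 := tendsto_pairing_zero h hw.2.2 m0 h0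
  have t1 := tendsto_pairing_zero h' hw.1 m1 h1
  have t2 := (t1.const_mul ((-1) ^ (k + 1))).sub t0
  simp only [mul_zero, sub_zero] at t2
  have hev : ∀ᶠ j in Filter.atTop,
      (-1) ^ (k + 1) * pairing h' w (extD (η j) - extD τ) - pairing h (extD w) (η j - τ) =
        pairing h (extD w) τ - (-1) ^ (k + 1) * pairing h' w (extD τ) := by
    filter_upwards [h0.eventually_lt_const ENNReal.zero_lt_top,
      h1.eventually_lt_const ENNReal.zero_lt_top] with j hj0 hj1
    have e0 := pairing_add_right ht h hw.2.2 ⟨m0 j, hj0⟩ hτH.1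
    have e1 := pairing_add_right ht h' hw.1 ⟨m1 j, hj1⟩ hτH.2.2
    rw [Form.sub_add_cancel] at e0 e1
    rw [hw.isExtDeriv.pairing_test ht h h' (hη j), ← (hx j).pairing_right h' w, e1] at e0
    linear_combination e0
  have := tendsto_nhds_unique (t2.congr' hev) tendsto_const_nhds
  linarith

/-- Stokes' theorem: the exterior derivative is, up to sign, its own adjoint, if one of the forms
satisfies homogeneous boundary conditions. -/
theorem MemH.pairing_extD [T2Space M] (ht : t = -s) (h : k + 1 + l = n) (h' : k + (l + 1) = n)
    {w : Form n M s k} {τ : Form n M t l} (hw : MemH w) (hτ : MemH τ) (h0 : MemH0 w ∨ MemH0 τ) :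
    pairing h (extD w) τ = (-1) ^ (k + 1) * pairing h' w (extD τ) := by
  rcases h0 with h0 | h0
  -- When `w` is the form with the boundary condition, the roles are exchanged by graded
  -- commutativity. The signs match since `(k+1) + k(l+1) + (l+1)` and `(k+1)l` have the same
  -- parity.
  · have h1 := MemH0.pairing_extD (s := t) (t := s) (by rw [ht, neg_neg]) (by omega : l + 1 + k = n)
      (by omega : l + (k + 1) = n) hτ h0
    rw [pairing_comm h (by omega) (extD w), pairing_comm h' (by omega) w, h1, ← mul_assoc,
      ← mul_assoc, ← pow_add, ← pow_add]
    congr 1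
    rw [show k + 1 + k * (l + 1) + (l + 1) = (k + 1) * l + 2 * (k + 1) by ring, pow_add, pow_mul]
    simp
  · exact h0.pairing_extD ht h h' hw

theorem MemH.smul {w : Form n M s k} (hw : MemH w) (c : ℝ) : MemH (c • w) := by
  have h1 := hw.isExtDeriv.smul c
  exact ⟨hw.1.smul c, ⟨_, h1⟩, h1.extD_aeEq.symm.memL2 (hw.2.2.smul c)⟩

theorem AEEq.of_sub {w η : Form n M s k} (h : AEEq (w - η) 0) : AEEq w η := by
  filter_upwards [h] with x hx
  exact sub_eq_zero.1 hx

/-! ### Functional derivatives -/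

/-- Nonnegativity follows from the seminorm axioms: the seminorm of `η - η` is zero and at most
twice that of `η`. -/
theorem FormSpace.norm_nonneg (V : FormSpace n M s k) {η : Form n M s k} (hη : η ∈ V.carrier) :
    0 ≤ V.norm η := by
  have h1 := V.norm_add_le η hη ((-1 : ℝ) • η) (V.carrier.smul_mem _ hη)
  have h2 := V.norm_smul 0 η hη
  have e1 : η + (-1 : ℝ) • η = (0 : ℝ) • η := by
    rw [← show (1 + -1 : ℝ) • η = η + (-1 : ℝ) • η from (add_smul _ _ η).trans
      (congrArg (· + (-1 : ℝ) • η) (one_smul ℝ η)), add_neg_cancel]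
  rw [e1, h2, V.norm_smul _ η hη, abs_neg, abs_one, one_mul, abs_zero, zero_mul] at h1
  linarith

theorem FormSpace.norm_zero (V : FormSpace n M s k) : V.norm 0 = 0 := by
  have h2 := V.norm_smul 0 0 V.carrier.zero_mem
  rwa [show (0 : ℝ) • (0 : Form n M s k) = 0 from zero_smul ℝ _, abs_zero, zero_mul] at h2

/-- A homogeneous functional which is `o(‖η‖)` on a line vanishes on that line. -/
theorem FormSpace.eq_zero_of_isLittle (V : FormSpace n M s k) {η : Form n M s k}
    (hη : η ∈ V.carrier) {L : Form n M s k → ℝ} (hL : ∀ c : ℝ, L (c • η) = c * L η)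
    (H : ∀ ε > 0, ∃ δ > 0, ∀ c : ℝ, V.norm (c • η) < δ → |L (c • η)| ≤ ε * V.norm (c • η)) :
    L η = 0 := by
  have hN := V.norm_nonneg hη
  rw [← abs_nonpos_iff]
  refine le_of_forall_pos_le_add fun ε hε => ?_
  -- The added `1` keeps the divisor positive when the seminorm of `η` vanishes. Scaling `η` by `δ /
  -- (V.norm η + 1)` brings it below `δ`, and homogeneity cancels the scale.
  obtain ⟨δ, hδ, h⟩ := H (ε / (V.norm η + 1)) (by positivity)
  have hc : 0 < δ / (V.norm η + 1) := by positivity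
  have h1 := h (δ / (V.norm η + 1)) (by
    rw [V.norm_smul _ _ hη, abs_of_pos hc, div_mul_eq_mul_div, div_lt_iff₀ (by positivity)]
    nlinarith)
  rw [V.norm_smul _ _ hη, abs_of_pos hc, hL, abs_mul, abs_of_pos hc, mul_left_comm] at h1
  have h2 := le_of_mul_le_mul_left h1 hc
  rw [zero_add]
  refine h2.trans ?_
  rw [div_mul_eq_mul_div, div_le_iff₀ (by positivity)]
  nlinarith

theorem Represents.congr {P : Form n M s k → Form n M t l → ℝ} {V : Form n M s k → Prop}
    {N K : Form n M s k → ℝ} {w : Form n M s k} {ξ ξ' : Form n M t l} (h : Represents P V N K w ξ)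
    (hξ' : MemL2 ξ') (hP : ∀ η, P η ξ' = P η ξ) : Represents P V N K w ξ' :=
  ⟨hξ', by simpa only [hP] using h.2⟩

/-- Two representatives of a Fréchet derivative have the same pairings with all variations. -/
theorem Represents.pairing_eq (V : FormSpace n M s k) {P : Form n M s k → Form n M t l → ℝ}
    {K : Form n M s k → ℝ} {w : Form n M s k} {ξ ξ' : Form n M t l}
    (hP : ∀ (c : ℝ) η ξ, P (c • η) ξ = c * P η ξ)
    (h : Represents P (· ∈ V.carrier) V.norm K w ξ)
    (h' : Represents P (· ∈ V.carrier) V.norm K w ξ') {η : Form n M s k} (hη : η ∈ V.carrier) :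
    P η ξ = P η ξ' := by
  refine sub_eq_zero.1 (V.eq_zero_of_isLittle (L := fun η => P η ξ - P η ξ') hη
    (fun c => by simp only [hP]; ring) fun ε hε => ?_)
  obtain ⟨δ, hδ, h1⟩ := h.2 (ε / 2) (by positivity)
  obtain ⟨δ', hδ', h1'⟩ := h'.2 (ε / 2) (by positivity)
  refine ⟨min δ δ', lt_min hδ hδ', fun c hc => ?_⟩
  have h2 := h1 _ (V.carrier.smul_mem c hη) (hc.trans_le (min_le_left _ _))
  have h2' := h1' _ (V.carrier.smul_mem c hη) (hc.trans_le (min_le_right _ _))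
  rw [abs_le] at h2 h2' ⊢
  constructor <;> linarith [h2.1, h2.2, h2'.1, h2'.2]

/-- The chain rule for `K[w] = K̂[d w]`. -/
theorem Represents.comp_extD (V : FormSpace n M s k) {r : ℕ} {K : Form n M s k → ℝ}
    {Khat : Form n M s (k + 1) → ℝ} (hK : ∀ w ∈ V.carrier, K w = Khat (extD w))
    {P : Form n M s k → Form n M t r → ℝ} {Phat : Form n M s (k + 1) → Form n M t l → ℝ}
    {w : Form n M s k} (hw : w ∈ V.carrier) {ψ : Form n M t l} {ξ : Form n M t r} (hξ : MemL2 ξ)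
    (hP : ∀ η ∈ V.carrier, ∀ η' : Form n M s (k + 1), AEEq η' (extD η) → Phat η' ψ = P η ξ)
    (h : Represents Phat MemL2 l2Norm Khat (extD w) ψ) :
    Represents P (· ∈ V.carrier) V.norm K w ξ := by
  refine ⟨hξ, fun ε hε => ?_⟩
  obtain ⟨C, hC, hb⟩ := V.bound
  obtain ⟨δ, hδ, h1⟩ := h.2 (ε / C) (by positivity)
  refine ⟨δ / C, by positivity, fun η hη hN => ?_⟩
  have hηH := V.memH η hη
  -- As a chosen representative, `extD` is additive only almost everywhere, while `Khat` may
  -- distinguish representatives. The variation fed to it is therefore the exact difference, which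
  -- is why `hP` allows every `η'` almost equal to `extD η`.
  have hae : AEEq (extD (w + η) - extD w) (extD η) := by
    filter_upwards [((V.memH w hw).isExtDeriv.add hηH.isExtDeriv).extD_aeEq] with x hx
    change (extD (w + η)).1 x - (extD w).1 x = _
    rw [hx]
    exact add_sub_cancel_left _ _
  have hle : l2Norm (extD (w + η) - extD w) ≤ C * V.norm η := by
    rw [hae.l2Norm_eq]
    refine le_trans ?_ (hb η hη)
    refine Real.le_sqrt_of_sq_le ?_
    linarith [sq_nonneg (l2Norm η)]
  have h2 := h1 _ (hae.symm.memL2 hηH.2.2) (hle.trans_lt (by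
    rwa [lt_div_iff₀ hC, mul_comm] at hN))
  rw [Form.add_sub_cancel, hP η hη _ hae, ← hK _ hw, ← hK _ (V.carrier.add_mem hw hη)] at h2
  refine h2.trans ?_
  calc ε / C * l2Norm (extD (w + η) - extD w) ≤ ε / C * (C * V.norm η) := by gcongr
    _ = ε * V.norm η := by field_simp

variable [T2Space M]

theorem FormSpace.aeEq_zero (V : FormSpace n M s k) (ht : t = -s) (h : k + l = n)
    {ξ : Form n M t l} (hξ : MemL2 ξ) (H : ∀ η ∈ V.carrier, pairing h η ξ = 0) : AEEq ξ 0 :=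
  aeEq_zero_of_pairing_test ht h hξ.locallyIntegrableOn fun η hη => H η (V.test_mem η hη)

/-- The space `V` contains all test forms, so the fundamental lemma applies to the difference. -/
theorem FormSpace.aeEq (V : FormSpace n M s k) (ht : t = -s) (h : k + l = n)
    {ξ ξ' : Form n M t l} (hξ : MemL2 ξ) (hξ' : MemL2 ξ')
    (H : ∀ η ∈ V.carrier, pairing h η ξ = pairing h η ξ') : AEEq ξ ξ' := by
  refine AEEq.of_sub (aeEq_zero_of_pairing_test ht h
    (fun x₀ => LocallyIntegrableOn.sub (f := inChart ξ x₀) (g := inChart ξ' x₀)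
      (hξ.locallyIntegrableOn x₀) (hξ'.locallyIntegrableOn x₀)) fun η hη => ?_)
  have hV := V.test_mem η hη
  rw [pairing_sub_right ht h (V.memH η hV).1 hξ hξ', H η hV, sub_self]

/-- Stokes turns `⟨dη, ψ⟩` from the chain rule into a pairing with `η`; the boundary condition may
sit on the variations or on `ψ`. -/
theorem hasTwistedDeriv_comp_extD (V : FormSpace n M s k) (ht : t = -s) (h : k + 1 + l = n)
    (h' : k + (l + 1) = n) {K : Form n M s k → ℝ}
    {Khat : Form n M s (k + 1) → ℝ} (hK : ∀ w ∈ V.carrier, K w = Khat (extD w))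
    {w : Form n M s k} (hw : w ∈ V.carrier) {ψ : Form n M t l} (hψ : MemH ψ)
    (h0 : (∀ η ∈ V.carrier, MemH0 η) ∨ MemH0 ψ)
    (hd : HasTwistedDeriv h MemL2 l2Norm Khat (extD w) ψ) :
    HasTwistedDeriv h' (· ∈ V.carrier) V.norm K w ((-1 : ℝ) ^ (k + 1) • extD ψ) := by
  refine Represents.comp_extD V hK hw (hψ.2.2.smul _) (fun η hη η' hη' => ?_) hd
  rw [hη'.pairing_left h ψ, (V.memH η hη).pairing_extD ht h h' hψ (h0.imp_left fun h => h η hη),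
    pairing_smul_right]

/-- Stokes is applied with `ψ` as the first form, so the sign is governed by the degree `l` of `ψ`
instead of `k`. -/
theorem hasTwistedDerivLeft_comp_extD (V : FormSpace n M s k) (ht : t = -s) (h : l + (k + 1) = n)
    (h' : l + 1 + k = n) {K : Form n M s k → ℝ}
    {Khat : Form n M s (k + 1) → ℝ} (hK : ∀ w ∈ V.carrier, K w = Khat (extD w))
    {w : Form n M s k} (hw : w ∈ V.carrier) {ψ : Form n M t l} (hψ : MemH ψ)
    (h0 : (∀ η ∈ V.carrier, MemH0 η) ∨ MemH0 ψ)
    (hd : HasTwistedDerivLeft h MemL2 l2Norm Khat (extD w) ψ) :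
    HasTwistedDerivLeft h' (· ∈ V.carrier) V.norm K w ((-1 : ℝ) ^ (l + 1) • extD ψ) := by
  refine Represents.comp_extD V hK hw (hψ.2.2.smul _) (fun η hη η' hη' => ?_) hd
  rw [hη'.pairing_right h ψ, pairing_smul_left, hψ.pairing_extD (by rw [ht, neg_neg]) h' h
    (V.memH η hη) (h0.symm.imp_right fun h => h η hη), ← mul_assoc, ← mul_pow]
  simp

theorem HasTwistedDeriv.aeEq (V : FormSpace n M s k) (ht : t = -s) {h : k + l = n}
    {K : Form n M s k → ℝ} {w : Form n M s k} {ξ ξ' : Form n M t l}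
    (hξ : HasTwistedDeriv h (· ∈ V.carrier) V.norm K w ξ)
    (hξ' : HasTwistedDeriv h (· ∈ V.carrier) V.norm K w ξ') : AEEq ξ ξ' :=
  V.aeEq ht h hξ.1 hξ'.1 fun _ hη =>
    Represents.pairing_eq V (fun c η ξ => pairing_smul_left h c η ξ) hξ hξ' hη

theorem HasTwistedDerivLeft.aeEq (V : FormSpace n M s k) (ht : t = -s) {h : l + k = n}
    {K : Form n M s k → ℝ} {w : Form n M s k} {ξ ξ' : Form n M t l}
    (hξ : HasTwistedDerivLeft h (· ∈ V.carrier) V.norm K w ξ)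
    (hξ' : HasTwistedDerivLeft h (· ∈ V.carrier) V.norm K w ξ') : AEEq ξ ξ' := by
  refine V.aeEq ht (by omega) hξ.1 hξ'.1 fun η hη => ?_
  rw [pairing_comm (by omega) h η ξ, pairing_comm (by omega) h η ξ',
    Represents.pairing_eq V (fun c η ξ => pairing_smul_right h c ξ η) hξ hξ' hη]

theorem isExact_of_aeEq_smul_extD {ξ : Form n M s (k + 1)} {ψ : Form n M s k} (hψ : MemH ψ) {c : ℝ}
    (h : AEEq ξ (c • extD ψ)) : IsExact ξ :=
  ⟨c • ψ, hψ.smul c, h.trans (hψ.isExtDeriv.smul c).extD_aeEq.symm⟩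

theorem HasTwistedDeriv.congr_aeEq {h : k + l = n} {V : Form n M s k → Prop}
    {N K : Form n M s k → ℝ} {w : Form n M s k} {ξ ξ' : Form n M t l}
    (hξ : HasTwistedDeriv h V N K w ξ) (hξ' : MemL2 ξ') (hae : AEEq ξ' ξ) :
    HasTwistedDeriv h V N K w ξ' :=
  Represents.congr hξ hξ' fun η => hae.pairing_right h η

theorem HasTwistedDerivLeft.congr_aeEq {h : l + k = n} {V : Form n M s k → Prop}
    {N K : Form n M s k → ℝ} {w : Form n M s k} {ξ ξ' : Form n M t l}
    (hξ : HasTwistedDerivLeft h V N K w ξ) (hξ' : MemL2 ξ') (hae : AEEq ξ' ξ) :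
    HasTwistedDerivLeft h V N K w ξ' :=
  Represents.congr hξ hξ' fun η => hae.pairing_left h η

/-! ### Casimir invariants -/

/-- If the derivative of a functional vanishes along closed forms, then its representative is
closed. -/
theorem FormSpace.extD_aeEq_zero (V : FormSpace n M s (k + 1)) (ht : t = -s) (h : k + 1 + l = n)
    {ξ : Form n M t l} (hξ : MemH ξ)
    (H : ∀ ζ ∈ V.carrier, IsExtDeriv ζ 0 → pairing h ζ ξ = 0) : AEEq (extD ξ) 0 := by
  refine hξ.isExtDeriv.aeEq_zero_of_pairing_smoothD (t := s) (l := k) (by rw [ht, neg_neg])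
    (by omega) fun φ hφ => ?_
  -- Exact test forms are closed and belong to `V`, so they are among the variations covered by `H`.
  rw [pairing_comm (by omega) h ξ, H _ (V.test_mem _ hφ.smoothD)
    (IsSmooth.smoothD_isExtDeriv_zero hφ.1), mul_zero]

/-- The weak derivative sees only the class of `w` almost everywhere. The degree condition provides
test forms of complementary degree. -/
theorem MemH.extD_aeEq_zero {w : Form n M s k} (hw : MemH w) (h : k + 1 ≤ n) (h0 : AEEq w 0) :
    AEEq (extD w) 0 := by
  obtain ⟨l, hl⟩ := Nat.exists_eq_add_of_le h
  refine hw.isExtDeriv.aeEq_zero_of_pairing_smoothD (t := -s) (l := l) rfl (by omega) fun φ _ => ?_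
  rw [h0.pairing_left, pairing_zero_left]

end Sobolev

section Casimir

variable {n : ℕ} {M : Type*} [TopologicalSpace M] [T2Space M] [SecondCountableTopology M]
  [ChartedSpace (Model n) M] [IsManifold (𝓡 n) ∞ M]
  [RiemannianBundle (fun x : M => TangentSpace (𝓡 n) x)] [MeasurableSpace M] [BorelSpace M]
  [IsContinuousRiemannianBundle (Model n) (fun x : M => TangentSpace (𝓡 n) x)]

theorem memL2_zero {s : ℤˣ} {k : ℕ} : MemL2 (0 : Form n M s k) := by
  refine ⟨IsSmooth.zero.chartMeasurable, ?_⟩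
  have := eL2_smul 0 (0 : Form n M s k)
  rw [show (0 : ℝ) • (0 : Form n M s k) = 0 from zero_smul ℝ _, abs_zero, ENNReal.ofReal_zero,
    zero_mul] at this
  rw [this]
  exact ENNReal.zero_lt_top

variable {hn : 2 + 1 = n} {Vd : FormSpace n M (-1) 2} {Vb : FormSpace n M 1 2}
  {F : Twisted n M 2 → Straight n M 2 → ℝ} {d : Twisted n M 2} {b : Straight n M 2}
  {fd : Straight n M 1} {fb : Twisted n M 1}

/-- The partial derivative with respect to the twisted field vanishes along variations which do
not change the functional. -/
theorem HasFieldDerivs.pairing_eq_zero_twisted (h : HasFieldDerivs hn Vd Vb F d b fd fb)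
    {η : Twisted n M 2} (hη : η ∈ Vd.carrier) (hF : ∀ c : ℝ, F (d + c • η) b = F d b) :
    pairing hn η fd = 0 := by
  refine Vd.eq_zero_of_isLittle (L := fun η => pairing hn η fd) hη
    (fun c => pairing_smul_left hn c η fd) fun ε hε => ?_
  obtain ⟨δ, hδ, h1⟩ := h.2.2 ε hε
  refine ⟨δ, hδ, fun c hc => ?_⟩
  have h2 := h1 _ (Vd.carrier.smul_mem c hη) 0 Vb.carrier.zero_mem hc (by rwa [Vb.norm_zero])
  rw [show b + 0 = b from add_zero b, hF, pairing_zero_left, Vb.norm_zero, sub_self, add_zero,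
    add_zero, zero_sub, abs_neg] at h2
  exact h2

/-- The partial derivative with respect to the straight field vanishes along variations which do
not change the functional. -/
theorem HasFieldDerivs.pairing_eq_zero_straight (h : HasFieldDerivs hn Vd Vb F d b fd fb)
    {ζ : Straight n M 2} (hζ : ζ ∈ Vb.carrier) (hF : ∀ c : ℝ, F d (b + c • ζ) = F d b) :
    pairing hn ζ fb = 0 := by
  refine Vb.eq_zero_of_isLittle (L := fun ζ => pairing hn ζ fb) hζ
    (fun c => pairing_smul_left hn c ζ fb) fun ε hε => ?_
  obtain ⟨δ, hδ, h1⟩ := h.2.2 ε hε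
  refine ⟨δ, hδ, fun c hc => ?_⟩
  have h2 := h1 0 Vd.carrier.zero_mem _ (Vb.carrier.smul_mem c hζ) (by rwa [Vd.norm_zero]) hc
  rw [show d + 0 = d from add_zero d, hF, pairing_zero_left, Vd.norm_zero, sub_self, zero_add,
    zero_add, zero_sub, abs_neg] at h2
  exact h2

theorem extD_add_smul {s : ℤˣ} {k : ℕ} (b : Form n M s k) {ζ : Form n M s k}
    (hζ : IsExtDeriv ζ 0) (c : ℝ) : extD (b + c • ζ) = extD b := by
  refine extD_add_of_isExtDeriv_zero b ?_
  have := hζ.smul c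
  rwa [show c • (0 : Form n M s (k + 1)) = 0 from smul_zero c] at this

theorem neg_one_pow_three_smul {s : ℤˣ} {k : ℕ} (w : Form n M s k) :
    (-1 : ℝ) ^ (2 + 1) • w = -w := by
  rw [show (-1 : ℝ) ^ (2 + 1) = -1 by norm_num]
  exact neg_one_smul ℝ w

/-- Both terms vanish at once: `fd = 0` because the functional ignores `d`, and `d fb = 0` because
it is invariant under closed variations of `b`. The boundary conditions play no role here. -/
theorem isCasimir_comp_extD_straight (hn : n = 3) (c : ℝ) (Vd : FormSpace n M (-1) 2)
    (Vb : FormSpace n M 1 2) (F : Straight n M 3 → ℝ) :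
    IsCasimir hn c Vd Vb (fun _ b => F (extD b)) := by
  intro G d _ b _ fd fb gd gb hC _ hfd hfb _ _ _
  have h1 : AEEq fd 0 := Vd.aeEq_zero (by simp) (by omega) hfd.1 fun η hη =>
    hC.pairing_eq_zero_twisted hη fun _ => rfl
  have h2 : AEEq (extD fb) 0 := Vb.extD_aeEq_zero (k := 1) rfl (by omega) hfb fun ζ hζ hd =>
    hC.pairing_eq_zero_straight hζ fun c => congrArg F (extD_add_smul b hd c)
  rw [bracket, h1.pairing_left, h2.pairing_right, pairing_zero_left, pairing_zero_right]
  simp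

/-- Now `fb = 0` removes the second term, but the first one carries `d` on `gb` while it is `d fd`
that vanishes. Stokes moves the derivative, which is where the boundary conditions are used. -/
theorem isCasimir_comp_extD_twisted (hn : n = 3) (c : ℝ) (Vd : FormSpace n M (-1) 2)
    (Vb : FormSpace n M 1 2) (F : Twisted n M 3 → ℝ) :
    IsCasimir hn c Vd Vb (fun d _ => F (extD d)) := by
  intro G d _ b _ fd fb gd gb hC _ hfd hfb _ hgb h0
  have h1 : AEEq fb 0 := Vb.aeEq_zero rfl (by omega) hfb.1 fun ζ hζ =>
    hC.pairing_eq_zero_straight hζ fun _ => rfl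
  have h2 : AEEq (extD fd) 0 := Vd.extD_aeEq_zero (k := 1) (by simp) (by omega) hfd fun η hη hd =>
    hC.pairing_eq_zero_twisted hη fun c => congrArg F (extD_add_smul d hd c)
  have h3 : AEEq (extD fb) 0 := hfb.extD_aeEq_zero (by omega) h1
  -- Either alternative puts one of the two forms in this pairing, `fd` or `gb`, into `MemH0`.
  have h4 := hfd.pairing_extD rfl (by omega) (by omega : 1 + (1 + 1) = n) hgb
    (h0.imp And.left And.right)
  rw [h2.pairing_left, pairing_zero_left] at h4
  rw [bracket, h3.pairing_right, pairing_zero_right, show pairing _ fd (extD gb) = 0 by simpa using h4.symm]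
  simp

theorem hasFieldDerivs_of_straight {F : Straight n M 2 → ℝ} {ξ : Twisted n M 1}
    (h : HasTwistedDeriv hn (· ∈ Vb.carrier) Vb.norm F b ξ) :
    HasFieldDerivs hn Vd Vb (fun _ b => F b) d b 0 ξ := by
  refine ⟨memL2_zero, h.1, fun ε hε => ?_⟩
  obtain ⟨δ, hδ, h1⟩ := h.2 ε hε
  refine ⟨δ, hδ, fun η hη ζ hζ _ hN => ?_⟩
  rw [pairing_zero_right, zero_add]
  refine (h1 ζ hζ hN).trans ?_
  have := Vd.norm_nonneg hη
  gcongr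
  linarith

theorem hasFieldDerivs_of_twisted {F : Twisted n M 2 → ℝ} {ξ : Straight n M 1}
    (h : HasTwistedDeriv hn (· ∈ Vd.carrier) Vd.norm F d ξ) :
    HasFieldDerivs hn Vd Vb (fun d _ => F d) d b ξ 0 := by
  refine ⟨h.1, memL2_zero, fun ε hε => ?_⟩
  obtain ⟨δ, hδ, h1⟩ := h.2 ε hε
  refine ⟨δ, hδ, fun η hη ζ hζ hN _ => ?_⟩
  rw [pairing_zero_right, add_zero]
  refine (h1 η hη hN).trans ?_
  have := Vb.norm_nonneg hζ
  gcongr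
  linarith

end Casimir

end DoubleDeRham

end

/-! ### The functional derivative of `K̂[dω]` and the Casimir invariants -/

theorem mainTheorem4 {n : ℕ} {M : Type*} [TopologicalSpace M] [T2Space M]
    [SecondCountableTopology M] [ChartedSpace (Model n) M] [IsManifold (𝓡 n) ∞ M]
    [RiemannianBundle (fun x : M => TangentSpace (𝓡 n) x)]
    [IsContMDiffRiemannianBundle (𝓡 n) ∞ (Model n)
      (fun x : M => TangentSpace (𝓡 n) x)]
    [MeasurableSpace M] [BorelSpace M] :
    -- the chain rule, for straight (`s = 1`) and twisted (`s = -1`) arguments; `l = n - 1 - k`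
    (∀ (s : ℤˣ) (k l : ℕ) (hkl : k + (l + 1) = n) (V : FormSpace n M s k)
      (K : Form n M s k → ℝ) (Khat : Form n M s (k + 1) → ℝ),
      (∀ w ∈ V.carrier, K w = Khat (extD w)) →
      ∀ w ∈ V.carrier, ∀ ψ : Form n M (-s) l, MemH ψ →
      ((∀ η ∈ V.carrier, MemH0 η) ∨ MemH0 ψ) →
      -- with the pairing `⟨η, ξ⟩ = ∫ η ∧ ξ`
      (HasTwistedDeriv (by omega) MemL2 l2Norm Khat
          (extD w) ψ →
        (∀ ξ : Form n M (-s) (l + 1), MemL2 ξ →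
          (HasTwistedDeriv hkl (· ∈ V.carrier) V.norm K w ξ ↔
            AEEq ξ ((-1 : ℝ) ^ (k + 1) • extD ψ))) ∧
        (Odd n → ∀ ξ : Form n M (-s) (l + 1), MemL2 ξ →
          (HasTwistedDeriv hkl (· ∈ V.carrier) V.norm K w ξ ↔
            AEEq ξ ((-1 : ℝ) ^ (n - k) • extD ψ))) ∧
        (∃ ξ : Form n M (-s) (l + 1),
          HasTwistedDeriv hkl (· ∈ V.carrier) V.norm K w ξ) ∧
        (∀ ξ : Form n M (-s) (l + 1),
          HasTwistedDeriv hkl (· ∈ V.carrier) V.norm K w ξ →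
            IsExact ξ)) ∧
      -- with the pairing `⟨ξ, η⟩ = ∫ ξ ∧ η`
      (HasTwistedDerivLeft (by omega) MemL2 l2Norm Khat
          (extD w) ψ →
        (∀ ξ : Form n M (-s) (l + 1), MemL2 ξ →
          (HasTwistedDerivLeft (by omega) (· ∈ V.carrier) V.norm K w ξ ↔
            AEEq ξ ((-1 : ℝ) ^ (n - k) • extD ψ))) ∧
        (∃ ξ : Form n M (-s) (l + 1),
          HasTwistedDerivLeft (by omega) (· ∈ V.carrier) V.norm K w ξ) ∧
        (∀ ξ : Form n M (-s) (l + 1),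
          HasTwistedDerivLeft (by omega) (· ∈ V.carrier) V.norm K w ξ →
            IsExact ξ))) ∧
    -- the Casimir invariants `F[d b]` and `F[d d]` in dimension three
    (∀ (hn : n = 3) (c : ℝ) (Vd : FormSpace n M (-1) 2)
      (Vb : FormSpace n M 1 2),
      (∀ F : Straight n M 3 → ℝ,
        IsCasimir hn c Vd Vb (fun _ b => F (extD b)) ∧
        ∀ d ∈ Vd.carrier, ∀ b ∈ Vb.carrier, ∀ ψ : Twisted n M 0,
          MemH ψ →
          ((∀ η ∈ Vb.carrier, MemH0 η) ∨ MemH0 ψ) →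
          HasTwistedDeriv (by omega) MemL2 l2Norm F
            (extD b) ψ →
          HasFieldDerivs (by omega) Vd Vb (fun _ b => F (extD b)) d b
            0 (-extD ψ)) ∧
      (∀ F : Twisted n M 3 → ℝ,
        IsCasimir hn c Vd Vb (fun d _ => F (extD d)) ∧
        ∀ d ∈ Vd.carrier, ∀ b ∈ Vb.carrier, ∀ ψ : Straight n M 0,
          MemH ψ →
          ((∀ η ∈ Vd.carrier, MemH0 η) ∨ MemH0 ψ) →
          HasTwistedDeriv (by omega) MemL2 l2Norm F
            (extD d) ψ →
          HasFieldDerivs (by omega) Vd Vb (fun d _ => F (extD d)) d b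
            (-extD ψ) 0)) := by
  have := isContinuousRiemannianBundle_of_smooth (n := n) (M := M)
  refine ⟨fun s k l hkl V K Khat hK w hw ψ hψ h0 => ⟨fun hd => ?_, fun hd => ?_⟩, ?_⟩
  · have hξ := hasTwistedDeriv_comp_extD V rfl (by omega) hkl hK hw hψ h0 hd
    have hiff : ∀ ξ : Form n M (-s) (l + 1), MemL2 ξ →
        (HasTwistedDeriv hkl (· ∈ V.carrier) V.norm K w ξ ↔
          AEEq ξ ((-1 : ℝ) ^ (k + 1) • extD ψ)) := fun ξ hm =>
      ⟨fun h => HasTwistedDeriv.aeEq V rfl h hξ, fun h => hξ.congr_aeEq hm h⟩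
    refine ⟨hiff, fun hn => ?_, ⟨_, hξ⟩, fun ξ h =>
      isExact_of_aeEq_smul_extD hψ (HasTwistedDeriv.aeEq V rfl h hξ)⟩
    -- For odd `n`, the exponents `n - k` and `k + 1` have the same parity.
    have hpow : (-1 : ℝ) ^ (n - k) = (-1 : ℝ) ^ (k + 1) := by
      obtain ⟨m, hm⟩ := hn
      rcases Nat.even_or_odd k with hk | hk
      · rw [(Nat.Odd.sub_even (by omega) ⟨m, hm⟩ hk).neg_one_pow, hk.add_one.neg_one_pow]
      · rw [(Nat.Odd.sub_odd ⟨m, hm⟩ hk).neg_one_pow, hk.add_one.neg_one_pow]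
    rw [hpow]
    exact hiff
  · have hξ := hasTwistedDerivLeft_comp_extD V rfl (by omega) (by omega) hK hw hψ h0 hd
    rw [show (-1 : ℝ) ^ (l + 1) = (-1) ^ (n - k) by rw [show l + 1 = n - k by omega]] at hξ
    exact ⟨fun ξ hm => ⟨fun h => HasTwistedDerivLeft.aeEq V rfl h hξ, fun h => hξ.congr_aeEq hm h⟩,
      ⟨_, hξ⟩, fun ξ h => isExact_of_aeEq_smul_extD hψ (HasTwistedDerivLeft.aeEq V rfl h hξ)⟩
  · rintro rfl c Vd Vb
    refine ⟨fun F => ⟨?_, fun d hd b hb ψ hψ h0 hF => ?_⟩,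
      fun F => ⟨?_, fun d hd b hb ψ hψ h0 hF => ?_⟩⟩
    · exact isCasimir_comp_extD_straight _ c Vd Vb F
    -- The fields have degree `k = 2`, so the sign `(-1)^(k+1)` is `-1`.
    · have := hasTwistedDeriv_comp_extD Vb rfl (by omega) (by omega) (fun _ _ => rfl) hb hψ h0 hF
      rw [neg_one_pow_three_smul] at this
      exact hasFieldDerivs_of_straight this
    · exact isCasimir_comp_extD_twisted _ c Vd Vb F
    · have := hasTwistedDeriv_comp_extD Vd rfl (by omega) (by omega) (fun _ _ => rfl) hd hψ h0 hF
      rw [neg_one_pow_three_smul] at this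
      exact hasFieldDerivs_of_twisted this
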